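/- **Setting (the synchronous $\pi$-calculus $S\pi$).** Types are $1$, $\mathrm{list}(t)$, further inductive types (each with at least one value), and signal types $\mathrm{Sig}_\rho(t)$, where $\rho$ ranges over a finite strictly ordered set of regions. Constructors ($*$, $\mathsf{nil}$, $\mathsf{cons}$, and others returning inductive types), function symbols and thread identifiers have first-order types; all objects are well typed. Values are built from constructors and signal names, $|s|=|\mathsf c|=0$ for names and constants, and $|\mathsf c(v_1,\dots,v_n)|=1+\sum_i|v_i|$ for $n\ge1$. Each function symbol $f$ is a total function on values, $f(\vec v)\Downarrow v$, with $\mathrm{fn}(v)\subseteq\bigcup_i\mathrm{fn}(v_i)$ ($\mathrm{fn}$: free names), evaluated in time polynomial in $\sum_i|v_i|$; $\Downarrow$ extends to expressions. Programs are $$P::=0\mid A(\vec e)\mid \bar s e\mid s^y(x).P,\,B(\vec r)\mid[s_1=s_2]P_1,P_2\mid[u\rhd p]P_1,P_2\mid\nu s\,P\mid(P_1\mid P_2),$$ where $u$ is a variable or a value, $p$ is a non-variable pattern, and $\vec r$ may contain dereferenced signals $!^{y}s$. Every present statement and every dereferenciation carries its own label $y$, a variable of the type of the value read there, with the region of the signal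 read. A program runs relative to a finite system of equations $A(\vec x)=P_A$, one for each identifier $A$; the bodies $P_A$ have no free variable or name outside $\vec x$ and match patterns only against variables. *Semantics.* $\equiv$ is the usual structural equivalence: $\alpha$-renaming, $P\mid0\equiv P$, commutativity and associativity of $\mid$, $\nu s\,P\equiv P$ if $s\notin\mathrm{fn}(P)$, $\nu s\,P_1\mid P_2\equiv\nu s(P_1\mid P_2)$ if $s\notin\mathrm{fn}(P_2)$, closed under $\mid$ and $\nu$. Reduction $\to$ is taken up to $\equiv$, under $\mid$ and $\nu$, by the rules: $\bar se\mid s^y(x).P,K$ becomes $\bar se\mid[v/x]P$ if $e\Downarrow v$; $A(\vec e)$ becomes $[\vec v/\vec x]P_A$ if $\vec e\Downarrow\vec v$; comparisons of names and matchings of values choose the appropriate branch. A step takes time $1$ plus the time of evaluating the expressions in it. $P$ is suspended if it has no reduction. At the end of the instant a suspended $P\equiv\nu\vec s(S\mid In)$, with $S$ a composition of emissions and $In$ one of present statements $s_j^{y_j}(x_j).P_j,A_j(\vec r_j)$, evolves ($P\mapsto P'$) to $P'\equiv\nu\vec s{}'\prod_jA_j(\vec v_j)$: here $\vec r_j$ evaluates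 to $\vec v_j$ with each $!s$ replaced by a list, without repetition and in any order, of the values emitted on $s$ in $S$, and $\vec s{}'$ consists of the names of $\vec s$ that are not extruded, i.e. not in the least set that contains the free names of $\nu\vec s\,S$ and, with a name $s$, all names of the values emitted on $s$. An input is a fresh identifier $Env$ with $Env()=\bar s_1v_1\mid\dots\mid\bar s_nv_n$, of size $\sum_i(1+|v_i|)$; $P\stackrel{Env}{\longmapsto}P'$ means $P\mapsto P''$ and $P'\equiv P''\mid Env()$. A program of the form $\nu\vec s(A_1(\vec v_1)\mid\dots\mid A_n(\vec v_n))$ up to $\equiv$ has size $n+\sum|\vec v_i|$ (calls of inputs count as calls). *Feasible reactivity.* Such a $P$ is feasibly reactive if there is a polynomial $Q$ such that for every computation $P\equiv R_0\to^*R_0'\stackrel{Env_1}{\longmapsto}R_1\to^*R_1'\stackrel{Env_2}{\longmapsto}R_2\cdots$ and every $k\ge0$: if $d$ bounds the sizes of $P$ and of $Env_1,\dots,Env_k$, then $R_k$ again has the above form, with size at most $Q(d)$, and every reduction sequence from $R_k$ takes time less than $Q(d)$ (so $R_k$ is guaranteed to suspend). *Annotations.* The system is *finite control*: in no subprogram $P_1\mid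 P_2$ of a body do both $P_1$ and $P_2$ contain a recursive call (continuations of present statements included). A set $Reset$ of identifiers is given; every $A\in Reset$ has $P_A=\mathsf{pause}.K=\nu s(s^y(x).0,K)$ with $s$ not free in $K$, or occurs only in else branches of present statements. Let $Call(P,L)$ be: $\{(O,L)\}$ for $0$ and $\bar se$; $\{(A,L)\}$ for $A(\vec e)$; $Call(P,L\cup\{y\})\cup\{(A,L\cup Lab(\vec r))\}$ for $s^y(x).P,A(\vec r)$, where $Lab(\vec r)$ is the set of labels in $\vec r$; the union over the immediate subprograms, with the same $L$, otherwise; identifiers in $Reset$ are replaced by the sink $O$. In the call graph there is an edge $A\to B$ if some $(B,L)\in Call(P_A,\emptyset)$, labelled by the union of these $L$. The *read once condition* says that no loop goes through an edge with non-empty label. $\vec y_A$ is the ordered sequence of the labels on edges accessible from $A$. $\ge_F$ is the least pre-order with $A\ge_FB$ if $P_A$ contains a call of $B$ that is not in an else branch; $=_F$ and $>_F$ are the induced equivalence and strict order. Each $A$ has a status, $lex$ or $mset$, and identifiers equivalent under $=_F$ have the same arity and status; each $A$ has a set $I_A$ of parameter positions, containing all of them if $A\in Reset$. The rank of a region is the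 length of the longest chain below it; ${\downarrow}\rho$ is the set of regions of rank smaller than that of $\rho$; $\mathcal W(A)$ is the set of regions of the emissions in the bodies of identifiers reachable from $A$ in the call graph, or $\{\rho_\top\}$ if there are none, where ${\downarrow}\rho_\top$ contains all regions. *Inequalities.* To each $A$ belongs a symbol $A^+$ with parameters $\vec x,\vec y_A$ (proper and auxiliary). $A^+(\vec p)_{I_A}$ is $A^+(\vec p)$ with all auxiliary arguments and the proper arguments outside $I_A$ replaced by a constant $\mathtt 0$; in $A^+(\vec p)_{\downarrow\rho}$ the auxiliary arguments whose region is not in ${\downarrow}\rho$ are replaced by $\mathtt 0$. For $i=0,1,2$ the system generates the union over $A$ of $\mathcal C_i(P_A,A^+(\vec x,\vec y_A))$, where $\mathcal C_i(P,A^+(\vec p))$ is defined by: - $0$: $\emptyset$. $[x\rhd p]P_1,P_2$: $\mathcal C_i(P_1,A^+([p/x]\vec p))\cup\mathcal C_i(P_2,A^+(\vec p))$. $[s_1=s_2]P_1,P_2$ and $P_1\mid P_2$: $\mathcal C_i(P_1,A^+(\vec p))\cup\mathcal C_i(P_2,A^+(\vec p))$. $\nu s\,P'$: $\mathcal C_i(P',A^+(\vec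 p))$. - $\bar se$ with $s:\mathrm{Sig}_\rho(t)$: $A^+(\vec p)_{\downarrow\rho}\ge e$ if $i=2$, nothing otherwise. - $B(\vec e)$: if $i=0$ and not $A>_FB$, $A^+(\vec p)>_0B^+(\vec e,\vec y_B)$; if $i=1$, $A^+(\vec p)_{I_A}\ge B^+(\vec e,\vec y_B)_{I_B}$; if $i=2$ and $B\notin Reset$, $A^+(\vec p)_{\downarrow\rho}\ge B^+(\vec e,\vec y_B)_{\downarrow\rho}$ for all $\rho\in\mathcal W(B)$. - $s^y(x).P',B(\vec r)$: $\mathcal C_i([y/x]P',A^+(\vec p))$ and, if $i=1,2$, the inequalities of index $i$ for $B(\bar{\vec r})$, where $\bar{\vec r}$ is $\vec r$ with each $!^{y'}s'$ replaced by $y'$. *Quasi-interpretations.* An assignment $q$ gives each constructor, function symbol and $A^+$ of arity $n$ a function $q_h:\mathbb N^n\to\mathbb N$ such that: $q_{\mathsf c}=0$ for constants, and $q_{\mathsf c}=d_{\mathsf c}+\sum_ix_i$ with $d_{\mathsf c}\ge1$ for positive arity; names and $\mathtt 0$ are interpreted by $0$; every $q_h$ is monotone and is at least each of its arguments when these are interpretations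 of values of the right types (or, for $A^+$, of $\mathtt 0$); and $f(\vec v)\Downarrow v$ implies $q_{f(\vec v)}\ge q_v$. It is polynomially bounded if a polynomial $U$ satisfies $q_h(n,\dots,n)\le U(n)$ for all $h$ and $n$. An inequality $\ge$ is satisfied if it holds under $q$ for all ground (well-typed) substitutions $\sigma$. $A^+(\vec p)>_0B^+(\vec e)$ is satisfied, for status $lex$, if for some position $i$ and all $\sigma$, $q_{\sigma p_j}\ge q_{\sigma e_j}$ for $j<i$ and $q_{\sigma p_i}>q_{\sigma e_i}$; for status $mset$, if for all $\sigma$ the multiset of the $q_{\sigma p_j}$ is larger than that of the $q_{\sigma e_j}$ in the multiset order on $\mathbb N$. **Theorem.** Let a finite-control system of equations with reset, status, parameter and region annotations as above satisfy the read once condition, and suppose that some polynomially bounded assignment satisfies all generated inequalities of index $0$, $1$ and $2$. Then every program $\nu\vec s(A_1(\vec v_1)\mid\dots\mid A_n(\vec v_n))$ over this system is feasibly reactive. -/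

import Mathlib

namespace SPi

/-! ## Types, constructors, variables, values -/

/-- First-order types: the basic type `1`, lists, user-defined inductive types, and
types `Sig_ρ(t)` of signals of region `ρ` carrying values of type `t`. -/
inductive Ty (Ind Reg : Type) : Type
  | unit : Ty Ind Reg
  | list (t : Ty Ind Reg) : Ty Ind Reg
  | ind (i : Ind) : Ty Ind Reg
  | sig (ρ : Reg) (t : Ty Ind Reg) : Ty Ind Reg

/-- Names of the additional inductive types, the finite (strictly) ordered set of regions,
and the additional constructors with their first-order types. -/
structure DataSig where
  Ind : Type
  Reg : Type
  [regOrder : PartialOrder Reg]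
  [regFinite : Finite Reg]
  Con : Type
  conArgs : Con → List (Ty Ind Reg)
  conRes : Con → Ind

attribute [instance] DataSig.regOrder DataSig.regFinite

abbrev DataSig.T (D : DataSig) : Type := Ty D.Ind D.Reg

/-- `Cn D ts t`: the constructors of type `ts → t`. No constructor returns a signal. -/
inductive Cn (D : DataSig) : List D.T → D.T → Type
  | star : Cn D [] .unit
  | nil (t : D.T) : Cn D [] (.list t)
  | cons (t : D.T) : Cn D [t, .list t] (.list t)
  | user (c : D.Con) : Cn D (D.conArgs c) (.ind (D.conRes c))

/-- Typed membership in a context (typed de Bruijn indices). -/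
inductive Mem {α : Type} : List α → α → Type
  | z {t : α} {Γ : List α} : Mem (t :: Γ) t
  | s {t u : α} {Γ : List α} (x : Mem Γ t) : Mem (u :: Γ) t

def Mem.left {α : Type} {t : α} : ∀ {Ψ : List α} (Γ : List α), Mem Ψ t → Mem (Ψ ++ Γ) t
  | _, _, .z => .z
  | _, Γ, .s x => .s (x.left Γ)

def Mem.right {α : Type} {t : α} {Γ : List α} : ∀ (Ψ : List α), Mem Γ t → Mem (Ψ ++ Γ) t
  | [], x => x
  | _ :: Ψ, x => .s (x.right Ψ)

def Mem.split {α : Type} {t : α} {Γ : List α} :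
    ∀ (Ψ : List α), Mem (Ψ ++ Γ) t → Mem Ψ t ⊕ Mem Γ t
  | [], x => .inr x
  | _ :: _, .z => .inl .z
  | _ :: Ψ, .s x =>
    match x.split Ψ with
    | .inl y => .inl (.s y)
    | .inr y => .inr y

/-- A free signal name: every signal type has infinitely many names. -/
structure Name (D : DataSig) where
  reg : D.Reg
  ty : D.T
  idx : ℕ

/-- Variables: free signal names, and variables bound in the context `Γ` (parameters, variables
bound by `present`, by patterns or by `ν`), which may be signal variables. Programs are
represented up to renaming of bound variables. -/
inductive PV (D : DataSig) (Γ : List D.T) : D.T → Type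
  | name (ρ : D.Reg) (t : D.T) (k : ℕ) : PV D Γ (.sig ρ t)
  | bv {t : D.T} (x : Mem Γ t) : PV D Γ t

def Name.pv {D : DataSig} (n : Name D) (Γ : List D.T) : PV D Γ (.sig n.reg n.ty) :=
  .name n.reg n.ty n.idx

/-- Constructor terms over a family of variables. -/
inductive CTm (D : DataSig) (V : D.T → Type) : D.T → Type
  | var {t : D.T} (x : V t) : CTm D V t
  | con {ts : List D.T} {t : D.T} (c : Cn D ts t) (a : ∀ i : Fin ts.length, CTm D V (ts.get i)) :
      CTm D V t

/-- Values: constructor terms over signal names. -/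
abbrev Val (D : DataSig) (t : D.T) : Type := CTm D (PV D []) t

/-- A non-variable pattern `c(p₁,…,pₙ)`; `vars` is the context of the variables it binds. -/
structure Pattern (D : DataSig) (t : D.T) where
  vars : List D.T
  {ts : List D.T}
  con : Cn D ts t
  args : ∀ i : Fin ts.length, CTm D (Mem vars) (ts.get i)

section CTm

variable {D : DataSig}

def CTm.bind {V W : D.T → Type} {t : D.T} :
    CTm D V t → (∀ ⦃u⦄, V u → CTm D W u) → CTm D W t
  | .var x, f => f x
  | .con c a, f => .con c fun i => (a i).bind f

/-- The union of the sets attached to the leaves. -/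
def CTm.leaves {V : D.T → Type} {α : Type} (g : ∀ ⦃u⦄, V u → Set α) {t : D.T} :
    CTm D V t → Set α
  | .var x => g x
  | .con _ a => {n | ∃ i, n ∈ (a i).leaves g}

/-- The size of a value: names and constants have size `0`. -/
def CTm.size {V : D.T → Type} {t : D.T} : CTm D V t → ℕ
  | .var _ => 0
  | .con (ts := ts) _ a => if ts = [] then 0 else 1 + ∑ i, (a i).size

/-- There is no constructor of signal type. -/
def CTm.toSig {V : D.T → Type} {ρ : D.Reg} {t : D.T} : CTm D V (.sig ρ t) → V (.sig ρ t)
  | .var x => x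
  | .con c _ => nomatch c

def PV.names {Γ : List D.T} : ∀ ⦃t : D.T⦄, PV D Γ t → Set (Name D)
  | _, .name ρ t k => {⟨ρ, t, k⟩}
  | _, .bv _ => ∅

/-- Free signal names of a value. -/
def CTm.fn {Γ : List D.T} {t : D.T} (v : CTm D (PV D Γ) t) : Set (Name D) := v.leaves PV.names

def PV.weaken {Γ : List D.T} (Ψ : List D.T) : ∀ ⦃t : D.T⦄, PV D Γ t → PV D (Ψ ++ Γ) t
  | _, .name ρ t k => .name ρ t k
  | _, .bv x => .bv (x.right Ψ)

/-- Extension of a substitution under binders. -/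
def liftSub {Γ Δ : List D.T} (Ψ : List D.T) (f : ∀ ⦃t⦄, PV D Γ t → CTm D (PV D Δ) t) :
    ∀ ⦃t⦄, PV D (Ψ ++ Γ) t → CTm D (PV D (Ψ ++ Δ)) t
  | _, .name ρ t k => (f (.name ρ t k)).bind fun _ x => .var (x.weaken Ψ)
  | _, .bv x =>
    match x.split Ψ with
    | .inl y => .var (.bv (y.left Δ))
    | .inr y => (f (.bv y)).bind fun _ x => .var (x.weaken Ψ)

/-- The value `[v₁;…;vₙ]`. -/
def listVal {V : D.T → Type} {t : D.T} : List (CTm D V t) → CTm D V (.list t)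
  | [] => .con (.nil t) fun i => nomatch i
  | v :: l => .con (.cons t) fun i =>
      match i with
      | ⟨0, _⟩ => v
      | ⟨1, _⟩ => listVal l

def Pattern.toCTm {t : D.T} (p : Pattern D t) : CTm D (Mem p.vars) t := .con p.con p.args

/-- Every variable in `vars` occurs in the pattern. -/
def Pattern.Covers {t : D.T} (p : Pattern D t) : Prop :=
  ∀ (u : D.T) (x : Mem p.vars u),
    (⟨u, x⟩ : Σ u, Mem p.vars u) ∈ p.toCTm.leaves fun _ y => {⟨_, y⟩}

/-- `match(v,p) = σ`. -/
def Matches {t : D.T} (v : Val D t) (p : Pattern D t) (σ : ∀ ⦃u⦄, Mem p.vars u → Val D u) : Prop :=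
  p.toCTm.bind σ = v

end CTm

/-! ## Function symbols, thread identifiers, expressions, programs -/

/-- A signature: data types, function symbols with their evaluation, and finitely many thread
identifiers with the types of their parameters. `ev f v⃗` is the unique value `v` such that
`f(v⃗) ⇓ v`, and `time f v⃗` is the time taken by the evaluation. Every type has a value. -/
structure Sgn where
  D : DataSig
  inhabited : ∀ i : D.Ind, Nonempty (Val D (.ind i))
  Fn : Type
  fnArgs : Fn → List D.T
  fnRes : Fn → D.T
  ev : ∀ f : Fn, (∀ i : Fin (fnArgs f).length, Val D ((fnArgs f).get i)) → Val D (fnRes f)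
  ev_fn : ∀ (f : Fn) (a : ∀ i : Fin (fnArgs f).length, Val D ((fnArgs f).get i)) (n : Name D),
    n ∈ (ev f a).fn → ∃ i, n ∈ (a i).fn
  time : ∀ f : Fn, (∀ i : Fin (fnArgs f).length, Val D ((fnArgs f).get i)) → ℕ
  time_poly : ∀ f : Fn, ∃ p : Polynomial ℕ,
    ∀ a : ∀ i : Fin (fnArgs f).length, Val D ((fnArgs f).get i),
      time f a ≤ p.eval (∑ i, (a i).size)
  N : ℕ
  params : Fin N → List D.T

abbrev Sgn.T (S : Sgn) : Type := S.D.T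

/-- Thread identifiers. -/
abbrev Sgn.Id (S : Sgn) : Type := Fin S.N

/-- The positions of the (proper) parameters of a thread identifier. -/
abbrev Sgn.Pos (S : Sgn) (A : S.Id) : Type := Fin (S.params A).length

/-- Expressions over a family of variables. -/
inductive Exp (S : Sgn) (V : S.T → Type) : S.T → Type
  | var {t : S.T} (x : V t) : Exp S V t
  | con {ts : List S.T} {t : S.T} (c : Cn S.D ts t)
      (a : ∀ i : Fin ts.length, Exp S V (ts.get i)) : Exp S V t
  | app (f : S.Fn) (a : ∀ i : Fin (S.fnArgs f).length, Exp S V ((S.fnArgs f).get i)) :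
      Exp S V (S.fnRes f)

/-- Leaves of expressions with dereferenciation: variables, and `!^y s`, where the number `k`
determines the label `y` (see `Lab`). -/
inductive RLeaf (S : Sgn) (Γ : List S.T) : S.T → Type
  | var {t : S.T} (x : PV S.D Γ t) : RLeaf S Γ t
  | deref {ρ : S.D.Reg} {t : S.T} (k : ℕ) (s : PV S.D Γ (.sig ρ t)) : RLeaf S Γ (.list t)

/-- Labels of read instructions. Labels are variables, so they carry a type and a region. -/
inductive Lab (S : Sgn) : Type
  | read (k : ℕ) (ρ : S.D.Reg) (t : S.T) : Lab S
  | deref (k : ℕ) (ρ : S.D.Reg) (t : S.T) : Lab S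

/-- The type of the value read at a label. -/
@[reducible] def Lab.ty {S : Sgn} : Lab S → S.T
  | .read _ _ t => t
  | .deref _ _ t => .list t

/-- The region of the signal that is read at a label. -/
def Lab.reg {S : Sgn} : Lab S → S.D.Reg
  | .read _ ρ _ => ρ
  | .deref _ ρ _ => ρ

/-- The emission of a value, as in an input of the environment. -/
structure EmV (S : Sgn) (Γ : List S.T) where
  {reg : S.D.Reg}
  {ty : S.T}
  sg : PV S.D Γ (.sig reg ty)
  val : CTm S.D (PV S.D Γ) ty

/-- Programs whose variables are in the context `Γ`. `env E` is a call of the fresh identifier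
`Env` that is defined by the emissions in `E`; `present k s P B r` is `s^y(x).P, B(r)` with the
label `y = Lab.read k ρ t`; `matchv u p P₁ P₂` matches a variable or a value `u` against `p`. -/
inductive Prog (S : Sgn) : List S.T → Type
  | zero {Γ : List S.T} : Prog S Γ
  | call {Γ : List S.T} (A : S.Id) (e : ∀ i : S.Pos A, Exp S (PV S.D Γ) ((S.params A).get i)) :
      Prog S Γ
  | env {Γ : List S.T} (E : List (EmV S Γ)) : Prog S Γ
  | emit {Γ : List S.T} {ρ : S.D.Reg} {t : S.T} (s : PV S.D Γ (.sig ρ t))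
      (e : Exp S (PV S.D Γ) t) : Prog S Γ
  | present {Γ : List S.T} {ρ : S.D.Reg} {t : S.T} (k : ℕ) (s : PV S.D Γ (.sig ρ t))
      (P : Prog S (t :: Γ)) (B : S.Id)
      (r : ∀ i : S.Pos B, Exp S (RLeaf S Γ) ((S.params B).get i)) : Prog S Γ
  | matchs {Γ : List S.T} {ρ : S.D.Reg} {t : S.T} (s₁ s₂ : PV S.D Γ (.sig ρ t))
      (P₁ P₂ : Prog S Γ) : Prog S Γ
  | matchv {Γ : List S.T} {t : S.T} (u : CTm S.D (PV S.D Γ) t) (p : Pattern S.D t)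
      (P₁ : Prog S (p.vars ++ Γ)) (P₂ : Prog S Γ) : Prog S Γ
  | nu {Γ : List S.T} (ρ : S.D.Reg) (t : S.T) (P : Prog S (.sig ρ t :: Γ)) : Prog S Γ
  | par {Γ : List S.T} (P₁ P₂ : Prog S Γ) : Prog S Γ

section Terms

variable {S : Sgn}

def Exp.bind {V W : S.T → Type} {t : S.T} : Exp S V t → (∀ ⦃u⦄, V u → Exp S W u) → Exp S W t
  | .var x, f => f x
  | .con c a, f => .con c fun i => (a i).bind f
  | .app g a, f => .app g fun i => (a i).bind f

def Exp.leaves {V : S.T → Type} {α : Type} (g : ∀ ⦃u⦄, V u → Set α) {t : S.T} :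
    Exp S V t → Set α
  | .var x => g x
  | .con _ a => {n | ∃ i, n ∈ (a i).leaves g}
  | .app _ a => {n | ∃ i, n ∈ (a i).leaves g}

/-- The sequence attached to the leaves, from left to right. -/
def Exp.leafList {V : S.T → Type} {α : Type} (g : ∀ ⦃u⦄, V u → List α) {t : S.T} :
    Exp S V t → List α
  | .var x => g x
  | .con _ a => (List.ofFn fun i => (a i).leafList g).flatten
  | .app _ a => (List.ofFn fun i => (a i).leafList g).flatten

end Terms

/-- A constructor term is an expression. -/
def CTm.toExp {S : Sgn} {V : S.T → Type} {t : S.T} : CTm S.D V t → Exp S V t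
  | .var x => .var x
  | .con c a => .con c fun i => (a i).toExp

section Programs

variable {S : Sgn}

/-- Evaluation of closed expressions, `e ⇓ e.eval`. -/
def Exp.eval {t : S.T} : Exp S (PV S.D []) t → Val S.D t
  | .var x => .var x
  | .con c a => .con c fun i => (a i).eval
  | .app f a => S.ev f fun i => (a i).eval

/-- The time of the evaluation of a closed expression. -/
def Exp.cost {t : S.T} : Exp S (PV S.D []) t → ℕ
  | .var _ => 1
  | .con _ a => 1 + ∑ i, (a i).cost
  | .app f a => 1 + (∑ i, (a i).cost) + S.time f fun i => (a i).eval

def RLeaf.names {Γ : List S.T} : ∀ ⦃t : S.T⦄, RLeaf S Γ t → Set (Name S.D)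
  | _, .var x => x.names
  | _, .deref _ s => s.names

/-- The labels in an expression with dereferenciation. -/
def RLeaf.labels {Γ : List S.T} : ∀ ⦃t : S.T⦄, RLeaf S Γ t → List (Lab S)
  | _, .var _ => []
  | _, .deref (ρ := ρ) (t := t) k _ => [.deref k ρ t]

def RLeaf.bind {Γ Δ : List S.T} (f : ∀ ⦃t⦄, PV S.D Γ t → CTm S.D (PV S.D Δ) t) :
    ∀ ⦃t : S.T⦄, RLeaf S Γ t → Exp S (RLeaf S Δ) t
  | _, .var x => ((f x).toExp).bind fun _ y => .var (.var y)
  | _, .deref k s => .var (.deref k (f s).toSig)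

def EmV.bind {Γ Δ : List S.T} (f : ∀ ⦃t⦄, PV S.D Γ t → CTm S.D (PV S.D Δ) t) (E : EmV S Γ) :
    EmV S Δ :=
  ⟨(f E.sg).toSig, E.val.bind f⟩

/-- Simultaneous substitution for the variables and the free names of a program. -/
def Prog.bind : ∀ {Γ Δ : List S.T}, Prog S Γ →
    (∀ ⦃t⦄, PV S.D Γ t → CTm S.D (PV S.D Δ) t) → Prog S Δ
  | _, _, .zero, _ => .zero
  | _, _, .call A e, f => .call A fun i => (e i).bind fun _ x => (f x).toExp
  | _, _, .env E, f => .env (E.map fun m => m.bind f)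
  | _, _, .emit s e, f => .emit (f s).toSig (e.bind fun _ x => (f x).toExp)
  | _, _, .present (t := t) k s P B r, f =>
      .present k (f s).toSig (P.bind (liftSub [t] f)) B fun i => (r i).bind (RLeaf.bind f)
  | _, _, .matchs s₁ s₂ P₁ P₂, f => .matchs (f s₁).toSig (f s₂).toSig (P₁.bind f) (P₂.bind f)
  | _, _, .matchv u p P₁ P₂, f =>
      .matchv (u.bind f) p (P₁.bind (liftSub p.vars f)) (P₂.bind f)
  | _, _, .nu ρ t P, f => .nu ρ t (P.bind (liftSub [.sig ρ t] f))
  | _, _, .par P₁ P₂, f => .par (P₁.bind f) (P₂.bind f)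

/-- `[v⃗/x⃗]P`. -/
def Prog.inst {Γ : List S.T} (P : Prog S Γ) (σ : ∀ ⦃t⦄, Mem Γ t → Val S.D t) : Prog S [] :=
  P.bind fun _ x =>
    match x with
    | .name ρ t k => .var (.name ρ t k)
    | .bv y => σ y

/-- The substitution given by a vector of values. -/
def valSub : ∀ {Γ : List S.T}, (∀ i : Fin Γ.length, Val S.D (Γ.get i)) →
    ∀ ⦃t⦄, Mem Γ t → Val S.D t
  | _ :: _, v, _, .z => v ⟨0, Nat.succ_pos _⟩
  | _ :: _, v, _, .s x => valSub (fun i => v i.succ) x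

/-- The free signal names of a program. -/
def Prog.fn : ∀ {Γ : List S.T}, Prog S Γ → Set (Name S.D)
  | _, .zero => ∅
  | _, .call _ e => {n | ∃ i, n ∈ (e i).leaves PV.names}
  | _, .env E => {n | ∃ m ∈ E, n ∈ m.sg.names ∨ n ∈ m.val.fn}
  | _, .emit s e => s.names ∪ e.leaves PV.names
  | _, .present _ s P _ r => s.names ∪ P.fn ∪ {n | ∃ i, n ∈ (r i).leaves RLeaf.names}
  | _, .matchs s₁ s₂ P₁ P₂ => s₁.names ∪ s₂.names ∪ P₁.fn ∪ P₂.fn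
  | _, .matchv u _ P₁ P₂ => u.fn ∪ P₁.fn ∪ P₂.fn
  | _, .nu _ _ P => P.fn
  | _, .par P₁ P₂ => P₁.fn ∪ P₂.fn

open Classical in
/-- `νn P` for a name `n`, which becomes bound in `P`. -/
noncomputable def newName (n : Name S.D) (P : Prog S []) : Prog S [] :=
  .nu n.reg n.ty <| P.bind fun _ x =>
    match x with
    | .name ρ t k =>
      if h : n = ⟨ρ, t, k⟩ then
        .var (.bv (show Mem [Ty.sig n.reg n.ty] (Ty.sig ρ t) by subst h; exact .z))
      else .var (.name ρ t k)

/-- `νn₁ … νnₖ P`. -/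
noncomputable def newNames (ns : List (Name S.D)) (P : Prog S []) : Prog S [] :=
  ns.foldr newName P

/-- Parallel composition of a list; the empty one is `0`. -/
def pars {Γ : List S.T} (l : List (Prog S Γ)) : Prog S Γ := l.foldr .par .zero

/-! ## Reduction semantics -/

/-- Structural equivalence (a congruence for static contexts; programs are already taken up to
renaming of bound names). -/
inductive Equ : Prog S [] → Prog S [] → Prop
  | refl (P : Prog S []) : Equ P P
  | symm {P Q : Prog S []} : Equ P Q → Equ Q P
  | trans {P Q R : Prog S []} : Equ P Q → Equ Q R → Equ P R
  | par_zero (P : Prog S []) : Equ (.par P .zero) P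
  | par_comm (P Q : Prog S []) : Equ (.par P Q) (.par Q P)
  | par_assoc (P Q R : Prog S []) : Equ (.par (.par P Q) R) (.par P (.par Q R))
  | new_drop (n : Name S.D) (P : Prog S []) : n ∉ P.fn → Equ (newName n P) P
  | new_par (n : Name S.D) (P Q : Prog S []) : n ∉ Q.fn →
      Equ (.par (newName n P) Q) (newName n (.par P Q))
  | cong_par {P P' : Prog S []} (Q : Prog S []) : Equ P P' → Equ (.par P Q) (.par P' Q)
  | cong_new (n : Name S.D) {P P' : Prog S []} : Equ P P' → Equ (newName n P) (newName n P')

/-- The reduction rules. `Red P c Q` says that `P` reduces to `Q`, and that the step takes time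
`c`: one unit plus the time of the evaluation of expressions. -/
inductive Red (body : ∀ A : S.Id, Prog S (S.params A)) : Prog S [] → ℕ → Prog S [] → Prop
  | read {ρ : S.D.Reg} {t : S.T} (k : ℕ) (s : PV S.D [] (.sig ρ t)) (e : Exp S (PV S.D []) t)
      (P : Prog S [t]) (B : S.Id)
      (r : ∀ i : S.Pos B, Exp S (RLeaf S []) ((S.params B).get i)) :
      Red body (.par (.emit s e) (.present k s P B r)) (1 + e.cost)
        (.par (.emit s e) (P.inst (valSub (Γ := [t]) fun i =>
          match i with
          | ⟨0, _⟩ => e.eval)))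
  | call (A : S.Id) (e : ∀ i : S.Pos A, Exp S (PV S.D []) ((S.params A).get i)) :
      Red body (.call A e) (1 + ∑ i, (e i).cost) ((body A).inst (valSub fun i => (e i).eval))
  | env (E : List (EmV S [])) :
      Red body (.env E) 1 (pars (E.map fun m => .emit m.sg m.val.toExp))
  | matchs_eq {ρ : S.D.Reg} {t : S.T} (s : PV S.D [] (.sig ρ t)) (P₁ P₂ : Prog S []) :
      Red body (.matchs s s P₁ P₂) 1 P₁
  | matchs_ne {ρ : S.D.Reg} {t : S.T} (s₁ s₂ : PV S.D [] (.sig ρ t)) (P₁ P₂ : Prog S []) :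
      s₁ ≠ s₂ → Red body (.matchs s₁ s₂ P₁ P₂) 1 P₂
  | matchv_yes {t : S.T} (v : Val S.D t) (p : Pattern S.D t) (P₁ : Prog S (p.vars ++ []))
      (P₂ : Prog S []) (σ : ∀ ⦃u⦄, Mem p.vars u → Val S.D u) : Matches v p σ →
      Red body (.matchv v p P₁ P₂) 1 (P₁.inst fun _ x =>
        match x.split p.vars with
        | .inl y => σ y
        | .inr y => nomatch y)
  | matchv_no {t : S.T} (v : Val S.D t) (p : Pattern S.D t) (P₁ : Prog S (p.vars ++ []))
      (P₂ : Prog S []) : (¬ ∃ σ : ∀ ⦃u⦄, Mem p.vars u → Val S.D u, Matches v p σ) →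
      Red body (.matchv v p P₁ P₂) 1 P₂

/-- Static contexts `C ::= [ ] | νn C | (C | P)`. -/
inductive SCtx (S : Sgn) : Type
  | hole : SCtx S
  | new (n : Name S.D) (C : SCtx S) : SCtx S
  | par (C : SCtx S) (P : Prog S []) : SCtx S

noncomputable def SCtx.plug : SCtx S → Prog S [] → Prog S []
  | .hole, Q => Q
  | .new n C, Q => newName n (C.plug Q)
  | .par C P, Q => .par (C.plug Q) P

/-- The reduction relation; the step takes time `c`. -/
def Step (body : ∀ A : S.Id, Prog S (S.params A)) (P : Prog S []) (c : ℕ) (Q : Prog S []) : Prop :=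
  ∃ (C : SCtx S) (P' Q' : Prog S []), Equ P (C.plug P') ∧ Red body P' c Q' ∧ Equ (C.plug Q') Q

/-- Finite sequences of reductions, with the total time. -/
inductive Steps (body : ∀ A : S.Id, Prog S (S.params A)) : Prog S [] → ℕ → Prog S [] → Prop
  | refl (P : Prog S []) : Steps body P 0 P
  | tail {P Q R : Prog S []} {c c' : ℕ} : Steps body P c Q → Step body Q c' R →
      Steps body P (c + c') R

def Suspended (body : ∀ A : S.Id, Prog S (S.params A)) (P : Prog S []) : Prop :=
  ¬ ∃ (c : ℕ) (Q : Prog S []), Step body P c Q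

/-- An emission of a closed expression. -/
structure Emi (S : Sgn) where
  {reg : S.D.Reg}
  {ty : S.T}
  sg : PV S.D [] (.sig reg ty)
  exp : Exp S (PV S.D []) ty

def Emi.prog (m : Emi S) : Prog S [] := .emit m.sg m.exp

/-- A closed `present` statement. -/
structure Inp (S : Sgn) where
  {reg : S.D.Reg}
  {ty : S.T}
  lab : ℕ
  sg : PV S.D [] (.sig reg ty)
  cont : Prog S [ty]
  id : S.Id
  args : ∀ i : S.Pos id, Exp S (RLeaf S []) ((S.params id).get i)

def Inp.prog (m : Inp S) : Prog S [] := .present m.lab m.sg m.cont m.id m.args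

/-- A function from signals to lists of values. -/
abbrev SigVal (S : Sgn) : Type :=
  ∀ ⦃ρ : S.D.Reg⦄ ⦃t : S.T⦄, PV S.D [] (.sig ρ t) → List (Val S.D t)

/-- `V` lists, without repetition and in any order, the values emitted on every signal. -/
def Represents (V : SigVal S) (E : List (Emi S)) : Prop :=
  ∀ ⦃ρ : S.D.Reg⦄ ⦃t : S.T⦄ (s : PV S.D [] (.sig ρ t)),
    (V s).Nodup ∧ ∀ v : Val S.D t, v ∈ V s ↔ ∃ e : Exp S (PV S.D []) t, ⟨s, e⟩ ∈ E ∧ e.eval = v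

/-- The signal names that are free in `νns E`, or extruded by its emissions. -/
inductive FreeOut (ns : List (Name S.D)) (E : List (Emi S)) : Name S.D → Prop
  | free (m : Emi S) (n : Name S.D) : m ∈ E → n ∈ m.prog.fn → n ∉ ns → FreeOut ns E n
  | emitted (m : Emi S) (n n' : Name S.D) : m ∈ E → n ∈ m.sg.names → FreeOut ns E n →
      n' ∈ m.exp.eval.fn → FreeOut ns E n'

/-- `V(r)`. -/
def derefWith (V : SigVal S) : ∀ ⦃t : S.T⦄, RLeaf S [] t → Exp S (PV S.D []) t
  | _, .var x => .var x
  | _, .deref _ s => (listVal (V s)).toExp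

/-- A call of a thread identifier with values as arguments. -/
structure VCall (S : Sgn) where
  id : S.Id
  args : ∀ i : S.Pos id, Val S.D ((S.params id).get i)

def VCall.prog (m : VCall S) : Prog S [] := .call m.id fun i => (m.args i).toExp

def Inp.evalCont (V : SigVal S) (m : Inp S) : VCall S :=
  ⟨m.id, fun i => ((m.args i).bind (derefWith V)).eval⟩

/-- Evaluation at the end of the instant, `P ↦ P'`. -/
def EndInstant (body : ∀ A : S.Id, Prog S (S.params A)) (P P' : Prog S []) : Prop :=
  Suspended body P ∧
  ∃ (ns ns' : List (Name S.D)) (E : List (Emi S)) (I : List (Inp S)) (V : SigVal S),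
    ns.Nodup ∧ Equ P (newNames ns (.par (pars (E.map Emi.prog)) (pars (I.map Inp.prog)))) ∧
    Represents V E ∧
    ns'.Nodup ∧ (∀ n, n ∈ ns' ↔ n ∈ ns ∧ ¬ FreeOut ns E n) ∧
    Equ P' (newNames ns' (pars (I.map fun m => (m.evalCont V).prog)))

/-! ## Feasible reactivity -/

/-- The input received at the beginning of an instant. -/
abbrev Input (S : Sgn) : Type := List (EmV S [])

/-- The size of the list of the emitted values. -/
def inputSize (E : Input S) : ℕ := (E.map fun m => 1 + m.val.size).sum

/-- The size of a call: one, plus the sizes of the arguments. -/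
def VCall.size (m : VCall S) : ℕ := 1 + ∑ i, (m.args i).size

/-- `P` is, up to structural equivalence, a parallel composition under `ν` of calls of thread
identifiers with values as arguments, and it has size `m`. -/
def HasInitSize (P : Prog S []) (m : ℕ) : Prop :=
  ∃ (ns : List (Name S.D)) (l : List (VCall S)),
    Equ P (newNames ns (pars (l.map VCall.prog))) ∧ m = (l.map VCall.size).sum

/-- The same for a program at the beginning of an instant, where identifiers `Env` (which have
no argument) may occur too. -/
def HasSize (P : Prog S []) (m : ℕ) : Prop :=
  ∃ (ns : List (Name S.D)) (l : List (VCall S)) (l' : List (Input S)),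
    Equ P (newNames ns (pars (l.map VCall.prog ++ l'.map .env))) ∧
    m = (l.map VCall.size).sum + l'.length

/-- `Reaches body P Es R`: in a computation of `P` with the inputs `Es` (the last one comes first),
`R` is the program at the beginning of the instant that follows the last input. -/
inductive Reaches (body : ∀ A : S.Id, Prog S (S.params A)) (P : Prog S []) :
    List (Input S) → Prog S [] → Prop
  | start {R : Prog S []} : Equ P R → Reaches body P [] R
  | next {Es : List (Input S)} {R R' R'' R''' : Prog S []} {c : ℕ} (E : Input S) :
      Reaches body P Es R → Steps body R c R' → EndInstant body R' R'' →
      Equ R''' (.par R'' (.env E)) → Reaches body P (E :: Es) R'''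

/-- Every sequence of reductions that starts with `R` takes time less than `m` (every step takes
time at least one, so `R` is guaranteed to suspend). -/
def SuspendsWithin (body : ∀ A : S.Id, Prog S (S.params A)) (R : Prog S []) (m : ℕ) : Prop :=
  ∀ (c : ℕ) (R' : Prog S []), Steps body R c R' → c < m

/-- Feasible reactivity of a program of the initial shape. -/
def FeasiblyReactive (body : ∀ A : S.Id, Prog S (S.params A)) (P : Prog S []) : Prop :=
  ∃ Q : Polynomial ℕ, ∀ (Es : List (Input S)) (R : Prog S []) (d : ℕ),
    Reaches body P Es R → (∃ m, HasInitSize P m ∧ m ≤ d) → (∀ E ∈ Es, inputSize E ≤ d) →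
    (∃ m, HasSize R m) ∧ (∀ m, HasSize R m → m ≤ Q.eval d) ∧ SuspendsWithin body R (Q.eval d)

end Programs

/-! ## Systems of equations and their annotations -/

section Syntactic

variable {S : Sgn}

/-- Bodies of equations: no call of an input, patterns are matched against variables only,
and the variables bound by a pattern are those that occur in it. -/
def Prog.IsSource : ∀ {Γ : List S.T}, Prog S Γ → Prop
  | _, .zero => True
  | _, .call _ _ => True
  | _, .env _ => False
  | _, .emit _ _ => True
  | _, .present _ _ P _ _ => P.IsSource
  | _, .matchs _ _ P₁ P₂ => P₁.IsSource ∧ P₂.IsSource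
  | _, .matchv u p P₁ P₂ => (∃ x, u = .var (.bv x)) ∧ p.Covers ∧ P₁.IsSource ∧ P₂.IsSource
  | _, .nu _ _ P => P.IsSource
  | _, .par P₁ P₂ => P₁.IsSource ∧ P₂.IsSource

/-- The program contains a recursive call, possibly as the continuation of a `present`. -/
def Prog.HasCall : ∀ {Γ : List S.T}, Prog S Γ → Prop
  | _, .zero => False
  | _, .call _ _ => True
  | _, .env _ => False
  | _, .emit _ _ => False
  | _, .present _ _ _ _ _ => True
  | _, .matchs _ _ P₁ P₂ => P₁.HasCall ∨ P₂.HasCall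
  | _, .matchv _ _ P₁ P₂ => P₁.HasCall ∨ P₂.HasCall
  | _, .nu _ _ P => P.HasCall
  | _, .par P₁ P₂ => P₁.HasCall ∨ P₂.HasCall

/-- The program cannot spawn two recursive calls that run in parallel. -/
def Prog.FiniteControl : ∀ {Γ : List S.T}, Prog S Γ → Prop
  | _, .zero => True
  | _, .call _ _ => True
  | _, .env _ => True
  | _, .emit _ _ => True
  | _, .present _ _ P _ _ => P.FiniteControl
  | _, .matchs _ _ P₁ P₂ => P₁.FiniteControl ∧ P₂.FiniteControl
  | _, .matchv _ _ P₁ P₂ => P₁.FiniteControl ∧ P₂.FiniteControl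
  | _, .nu _ _ P => P.FiniteControl
  | _, .par P₁ P₂ => P₁.FiniteControl ∧ P₂.FiniteControl ∧ ¬ (P₁.HasCall ∧ P₂.HasCall)

/-- The labels of the read instructions, in the order of their occurrences. -/
def Prog.labels : ∀ {Γ : List S.T}, Prog S Γ → List (Lab S)
  | _, .zero => []
  | _, .call _ _ => []
  | _, .env _ => []
  | _, .emit _ _ => []
  | _, .present (ρ := ρ) (t := t) k _ P _ r =>
      .read k ρ t :: (P.labels ++ (List.ofFn fun i => (r i).leafList RLeaf.labels).flatten)
  | _, .matchs _ _ P₁ P₂ => P₁.labels ++ P₂.labels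
  | _, .matchv _ _ P₁ P₂ => P₁.labels ++ P₂.labels
  | _, .nu _ _ P => P.labels
  | _, .par P₁ P₂ => P₁.labels ++ P₂.labels

/-- The identifiers with an occurrence outside the else branches of `present` statements, that is,
those that may be called within the same instant. -/
def Prog.instCalls : ∀ {Γ : List S.T}, Prog S Γ → Set S.Id
  | _, .zero => ∅
  | _, .call A _ => {A}
  | _, .env _ => ∅
  | _, .emit _ _ => ∅
  | _, .present _ _ P _ _ => P.instCalls
  | _, .matchs _ _ P₁ P₂ => P₁.instCalls ∪ P₂.instCalls
  | _, .matchv _ _ P₁ P₂ => P₁.instCalls ∪ P₂.instCalls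
  | _, .nu _ _ P => P.instCalls
  | _, .par P₁ P₂ => P₁.instCalls ∪ P₂.instCalls

/-- The regions of the signals on which the program emits. -/
def Prog.emitRegs : ∀ {Γ : List S.T}, Prog S Γ → Set S.D.Reg
  | _, .zero => ∅
  | _, .call _ _ => ∅
  | _, .env _ => ∅
  | _, .emit (ρ := ρ) _ _ => {ρ}
  | _, .present _ _ P _ _ => P.emitRegs
  | _, .matchs _ _ P₁ P₂ => P₁.emitRegs ∪ P₂.emitRegs
  | _, .matchv _ _ P₁ P₂ => P₁.emitRegs ∪ P₂.emitRegs
  | _, .nu _ _ P => P.emitRegs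
  | _, .par P₁ P₂ => P₁.emitRegs ∪ P₂.emitRegs

/-- `P = pause.K`, that is, `P = νs (s(x).0, K)` where `s` does not occur in `K`. -/
def Prog.IsPause {Γ : List S.T} (P : Prog S Γ) : Prop :=
  ∃ (ρ : S.D.Reg) (t : S.T) (k : ℕ) (B : S.Id)
    (r : ∀ i : S.Pos B, Exp S (RLeaf S Γ) ((S.params B).get i)),
    P = .nu ρ t (.present k (.bv .z) .zero B fun i =>
      (r i).bind (RLeaf.bind fun _ x => .var (x.weaken [.sig ρ t])))

end Syntactic

/-- A finite system of recursive equations `A(x⃗) = body A`. The bodies have no free names, and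
every read instruction has its own label. -/
structure Sys (S : Sgn) where
  body : ∀ A : S.Id, Prog S (S.params A)
  source : ∀ A, (body A).IsSource
  closed : ∀ A, (body A).fn = ∅
  labels_nodup : ((List.finRange S.N).flatMap fun A => (body A).labels).Nodup

/-- The ordered sequence of all labels. -/
def Sys.labels {S : Sgn} (X : Sys S) : List (Lab S) :=
  (List.finRange S.N).flatMap fun A => (X.body A).labels

def Sys.FiniteControl {S : Sgn} (X : Sys S) : Prop := ∀ A, (X.body A).FiniteControl

inductive Status : Type
  | lex : Status
  | mset : Status

/-- Annotations: the set `Reset`, the status, and the set `I_A` of relevant parameters of every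
thread identifier. (The regions are part of the types.) -/
structure Ann (S : Sgn) where
  reset : Set S.Id
  status : S.Id → Status
  mask : ∀ A : S.Id, Set (S.Pos A)

section Graphs

variable {S : Sgn}

open Classical in
/-- The function `Call`; `none` is the sink `O`. -/
def Prog.calls (reset : Set S.Id) : ∀ {Γ : List S.T}, Prog S Γ → Set (Lab S) →
    Set (Option S.Id × Set (Lab S))
  | _, .zero, L => {(none, L)}
  | _, .call A _, L => {(if A ∈ reset then none else some A, L)}
  | _, .env _, L => {(none, L)}
  | _, .emit _ _, L => {(none, L)}
  | _, .present (ρ := ρ) (t := t) k _ P A r, L =>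
      P.calls reset (L ∪ {.read k ρ t}) ∪
        {(if A ∈ reset then none else some A,
          L ∪ {y | ∃ i, y ∈ (r i).leafList RLeaf.labels})}
  | _, .matchs _ _ P₁ P₂, L => P₁.calls reset L ∪ P₂.calls reset L
  | _, .matchv _ _ P₁ P₂, L => P₁.calls reset L ∪ P₂.calls reset L
  | _, .nu _ _ P, L => P.calls reset L
  | _, .par P₁ P₂, L => P₁.calls reset L ∪ P₂.calls reset L

variable (X : Sys S) (N : Ann S)

/-- Edges of the call graph within a cycle. -/
def Edge (A : S.Id) (b : Option S.Id) : Prop := ∃ L, (b, L) ∈ (X.body A).calls N.reset ∅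

/-- The label of an edge of the call graph. -/
def edgeLabel (A : S.Id) (b : Option S.Id) : Set (Lab S) :=
  {y | ∃ L, (b, L) ∈ (X.body A).calls N.reset ∅ ∧ y ∈ L}

/-- Reachability within a cycle. -/
def CycReach : S.Id → S.Id → Prop := Relation.ReflTransGen fun A B => Edge X N A (some B)

/-- The read once condition: no loop of the call graph goes through an edge whose label is
non-empty. (The sink has no outgoing edge.) -/
def ReadOnce : Prop :=
  ∀ A B : S.Id, Edge X N A (some B) → (edgeLabel X N A (some B)).Nonempty → ¬ CycReach X N B A

/-- `R(A)`: the labels of the edges accessible from `A`. -/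
def readSet (A : S.Id) : Set (Lab S) :=
  {y | ∃ (A' : S.Id) (b : Option S.Id), CycReach X N A A' ∧ y ∈ edgeLabel X N A' b}

open Classical in
/-- `y⃗_A`: the ordered sequence of the labels in `R(A)`. -/
noncomputable def readSeq (A : S.Id) : List (Lab S) :=
  X.labels.filter fun y => y ∈ readSet X N A

/-- The pre-order `A ≥_F B`. -/
def GeF : S.Id → S.Id → Prop := Relation.ReflTransGen fun A B => B ∈ (X.body A).instCalls

def EqF (A B : S.Id) : Prop := GeF X A B ∧ GeF X B A

def GtF (A B : S.Id) : Prop := GeF X A B ∧ ¬ EqF X A B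

/-- The conditions on the reset, status and parameter annotations. -/
structure Ann.Valid : Prop where
  reset : ∀ A ∈ N.reset, (X.body A).IsPause ∨ ∀ A', A ∉ (X.body A').instCalls
  status : ∀ A B, EqF X A B →
    (S.params A).length = (S.params B).length ∧ N.status A = N.status B
  mask : ∀ A ∈ N.reset, N.mask A = Set.univ

/-- `W'(A)`: the regions of the emissions that may arise in a cycle that starts from `A`. -/
def emitSet' (A : S.Id) : Set S.D.Reg :=
  {ρ | ∃ A', CycReach X N A A' ∧ ρ ∈ (X.body A').emitRegs}

open Classical in
/-- `W(A)`, where `⊤` is the additional region `ρ_⊤` above all others. -/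
def emitSet (A : S.Id) : Set (WithTop S.D.Reg) :=
  if emitSet' X N A = ∅ then {⊤} else {ρ | ∃ ρ' ∈ emitSet' X N A, ρ = (ρ' : WithTop S.D.Reg)}

/-- The regions of smaller rank; the rank of `ρ` is the length of the longest chain below `ρ`. -/
noncomputable def below {D : DataSig} : WithTop D.Reg → Set D.Reg
  | none => Set.univ
  | some ρ => {ρ' | Order.height ρ' < Order.height ρ}

end Graphs

/-! ## Inequalities -/

/-- Symbolic variables: signal constants, variables of a context, and labels. -/
inductive SV (S : Sgn) (Δ : List S.T) : S.T → Type
  | name (ρ : S.D.Reg) (t : S.T) (k : ℕ) : SV S Δ (.sig ρ t)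
  | bv {t : S.T} (x : Mem Δ t) : SV S Δ t
  | lab (y : Lab S) : SV S Δ y.ty

/-- The formula `A⁺(p⃗)`. The auxiliary parameters are indexed by the labels; those that are not
in `R(A)` are irrelevant. -/
structure Hat (S : Sgn) (A : S.Id) (Δ : List S.T) where
  proper : ∀ i : S.Pos A, Exp S (SV S Δ) ((S.params A).get i)
  aux : ∀ y : Lab S, Exp S (SV S Δ) y.ty

/-- A formula `A⁺(p⃗)_I`: the arguments that are not in `keepP`, `keepA` are set to `0`. -/
structure MHat (S : Sgn) (A : S.Id) (Δ : List S.T) where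
  hat : Hat S A Δ
  keepP : Set (S.Pos A)
  keepA : Set (Lab S)

/-- Inequalities `A⁺(p⃗) >₀ B⁺(e⃗)`, `A⁺(p⃗)_I ≥ B⁺(e⃗)_J`, `A⁺(p⃗)_I ≥ e`. -/
inductive Ineq (S : Sgn) : Type
  | gt {Δ : List S.T} {A B : S.Id} (l : Hat S A Δ) (r : Hat S B Δ) : Ineq S
  | ge {Δ : List S.T} {A B : S.Id} (l : MHat S A Δ) (r : MHat S B Δ) : Ineq S
  | geExp {Δ : List S.T} {A : S.Id} (l : MHat S A Δ) {t : S.T} (e : Exp S (SV S Δ) t) : Ineq S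

section Inequalities

variable {S : Sgn}

def SV.weaken {Δ : List S.T} (Ψ : List S.T) : ∀ ⦃t : S.T⦄, SV S Δ t → SV S (Ψ ++ Δ) t
  | _, .name ρ t k => .name ρ t k
  | _, .bv x => .bv (x.right Ψ)
  | _, .lab y => .lab y

def Hat.bind {A : S.Id} {Δ Δ' : List S.T} (h : Hat S A Δ)
    (f : ∀ ⦃t⦄, SV S Δ t → Exp S (SV S Δ') t) : Hat S A Δ' :=
  ⟨fun i => (h.proper i).bind f, fun y => (h.aux y).bind f⟩

def Hat.weaken {A : S.Id} {Δ : List S.T} (Ψ : List S.T) (h : Hat S A Δ) : Hat S A (Ψ ++ Δ) :=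
  h.bind fun _ x => .var (x.weaken Ψ)

open Classical in
/-- The substitution `[p/x]`; the variables of `p` are added to the context. -/
noncomputable def patSub {Δ : List S.T} {t : S.T} (x : SV S Δ t) (p : Pattern S.D t) :
    ∀ ⦃u⦄, SV S Δ u → Exp S (SV S (p.vars ++ Δ)) u := fun u w =>
  if h : (⟨t, x⟩ : Σ t, SV S Δ t) = ⟨u, w⟩ then
    have e : t = u := congrArg Sigma.fst h
    e ▸ (p.toCTm.toExp).bind fun _ z => .var (.bv (z.left Δ))
  else .var (w.weaken p.vars)

/-- `A⁺(p⃗)_{I_A}`; the auxiliary parameters are set to `0`. -/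
def Hat.maskI (N : Ann S) {A : S.Id} {Δ : List S.T} (h : Hat S A Δ) : MHat S A Δ :=
  ⟨h, N.mask A, ∅⟩

/-- `A⁺(p⃗)_{↓ρ}`; only auxiliary parameters are set to `0`. -/
def Hat.maskR (ρ : WithTop S.D.Reg) {A : S.Id} {Δ : List S.T} (h : Hat S A Δ) : MHat S A Δ :=
  ⟨h, Set.univ, {y | y.reg ∈ below ρ}⟩

/-- `B⁺(e⃗, y⃗_B)`. -/
def Hat.call {B : S.Id} {Δ : List S.T} (e : ∀ i : S.Pos B, Exp S (SV S Δ) ((S.params B).get i)) :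
    Hat S B Δ :=
  ⟨e, fun y => .var (.lab y)⟩

/-- The symbolic counterpart of the variables of a program in the context `Γ`. -/
def symVar {Γ Δ : List S.T} (θ : ∀ ⦃t⦄, Mem Γ t → SV S Δ t) : ∀ ⦃t : S.T⦄, PV S.D Γ t → SV S Δ t
  | _, .name ρ t k => .name ρ t k
  | _, .bv x => θ x

/-- The same for expressions with dereferenciation: `!^y s` is replaced by `y`. -/
def symLeaf {Γ Δ : List S.T} (θ : ∀ ⦃t⦄, Mem Γ t → SV S Δ t) : ∀ ⦃t : S.T⦄, RLeaf S Γ t → SV S Δ t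
  | _, .var x => symVar θ x
  | _, .deref (ρ := ρ) (t := t) k _ => .lab (.deref k ρ t)

def extSym {Γ Δ : List S.T} (Ψ : List S.T) (θ : ∀ ⦃t⦄, Mem Γ t → SV S Δ t) :
    ∀ ⦃t⦄, Mem (Ψ ++ Γ) t → SV S (Ψ ++ Δ) t := fun _ x =>
  match x.split Ψ with
  | .inl y => .bv (y.left Δ)
  | .inr y => (θ y).weaken Ψ

/-- The variable bound by a `present` statement is replaced by the label of the statement. -/
def labSym {Γ Δ : List S.T} (k : ℕ) (ρ : S.D.Reg) (t : S.T) (θ : ∀ ⦃u⦄, Mem Γ u → SV S Δ u) :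
    ∀ ⦃u⦄, Mem (t :: Γ) u → SV S Δ u
  | _, .z => .lab (.read k ρ t)
  | _, .s x => θ x

variable (X : Sys S) (N : Ann S)

/-- The inequalities of index `0` for a call within the instant. -/
def callIneqs0 {A B : S.Id} {Δ : List S.T} (l : Hat S A Δ) (r : Hat S B Δ) : Set (Ineq S) :=
  {c | ¬ GtF X A B ∧ c = .gt l r}

/-- The inequalities of index `1` for a call within or at the end of the instant. -/
def callIneqs1 {A B : S.Id} {Δ : List S.T} (l : Hat S A Δ) (r : Hat S B Δ) : Set (Ineq S) :=
  {.ge (l.maskI N) (r.maskI N)}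

/-- The inequalities of index `2` for a call within or at the end of the instant. -/
def callIneqs2 {A B : S.Id} {Δ : List S.T} (l : Hat S A Δ) (r : Hat S B Δ) : Set (Ineq S) :=
  {c | B ∉ N.reset ∧ ∃ ρ ∈ emitSet X N B, c = .ge (l.maskR ρ) (r.maskR ρ)}

/-- The inequalities `C_i(P, A⁺(p⃗))` of index `i = 0, 1, 2`; `θ` maps the variables of `P` to
symbolic variables. -/
noncomputable def ineqs (i : Fin 3) {A : S.Id} : ∀ {Γ Δ : List S.T}, Prog S Γ →
    (∀ ⦃t⦄, Mem Γ t → SV S Δ t) → Hat S A Δ → Set (Ineq S)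
  | _, _, .zero, _, _ => ∅
  | _, _, .matchv u p P₁ P₂, θ, h =>
      ineqs i P₁ (extSym p.vars θ)
        (match u with
          | .var x => h.bind (patSub (symVar θ x) p)
          | .con _ _ => h.weaken p.vars) ∪
      ineqs i P₂ θ h
  | _, _, .matchs _ _ P₁ P₂, θ, h => ineqs i P₁ θ h ∪ ineqs i P₂ θ h
  | _, _, .par P₁ P₂, θ, h => ineqs i P₁ θ h ∪ ineqs i P₂ θ h
  | _, _, .nu ρ t P, θ, h => ineqs i P (extSym [.sig ρ t] θ) (h.weaken [.sig ρ t])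
  | _, _, .env _, _, _ => ∅
  | _, _, .emit (ρ := ρ) _ e, θ, h =>
      match i with
      | 0 => ∅
      | 1 => ∅
      | 2 => {.geExp (h.maskR (ρ : WithTop S.D.Reg)) (e.bind fun _ x => .var (symVar θ x))}
  | _, _, .call _ e, θ, h =>
      let r := Hat.call fun j => (e j).bind fun _ x => .var (symVar θ x)
      match i with
      | 0 => callIneqs0 X h r
      | 1 => callIneqs1 N h r
      | 2 => callIneqs2 X N h r
  | _, _, .present (ρ := ρ) (t := t) k _ P _ e, θ, h =>
      let r := Hat.call fun j => (e j).bind fun _ x => .var (symLeaf θ x)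
      ineqs i P (labSym k ρ t θ) h ∪
      match i with
      | 0 => ∅
      | 1 => callIneqs1 N h r
      | 2 => callIneqs2 X N h r

/-- The vector of the variables of a context. -/
def ctxVec : ∀ (Γ : List S.T) (i : Fin Γ.length), Mem Γ (Γ.get i)
  | _ :: _, ⟨0, _⟩ => .z
  | _ :: Γ, ⟨i + 1, h⟩ => .s (ctxVec Γ ⟨i, Nat.lt_of_succ_lt_succ h⟩)

/-- `A⁺(x⃗, y⃗_A)`. -/
def Hat.init (A : S.Id) : Hat S A (S.params A) :=
  Hat.call fun i => .var (.bv (ctxVec (S.params A) i))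

/-- The inequalities of index `i` generated by the system of equations. -/
def sysIneqs (i : Fin 3) : Set (Ineq S) :=
  {c | ∃ A : S.Id, c ∈ ineqs X N i (X.body A) (fun _ x => .bv x) (Hat.init A)}

end Inequalities

/-! ## Assignments and quasi-interpretations -/

/-- Numerical functions for the constructors (given by their additive constants), the function
symbols and the identifiers `A⁺`. -/
structure Assign {S : Sgn} (X : Sys S) (N : Ann S) where
  d : ∀ {ts : List S.T} {t : S.T}, Cn S.D ts t → ℕ
  qf : ∀ f : S.Fn, (Fin (S.fnArgs f).length → ℕ) → ℕ
  qA : ∀ A : S.Id, (S.Pos A → ℕ) → ({y // y ∈ readSet X N A} → ℕ) → ℕ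

/-- Ground substitutions for the symbolic variables. -/
structure GSub (S : Sgn) (Δ : List S.T) where
  bv : ∀ ⦃t : S.T⦄, Mem Δ t → Val S.D t
  lab : ∀ y : Lab S, Val S.D y.ty

section Quasi

variable {S : Sgn} {X : Sys S} {N : Ann S}

def GSub.app {Δ : List S.T} (σ : GSub S Δ) : ∀ ⦃t : S.T⦄, SV S Δ t → Val S.D t
  | _, .name ρ t k => .var (.name ρ t k)
  | _, .bv x => σ.bv x
  | _, .lab y => σ.lab y

/-- The function `q_c`: zero for a constant, `d_c + x₁ + … + xₙ` for positive arity. -/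
def Assign.qc (q : Assign X N) {ts : List S.T} {t : S.T} (c : Cn S.D ts t)
    (x : Fin ts.length → ℕ) : ℕ :=
  if ts = [] then 0 else q.d c + ∑ i, x i

/-- The number `q_v` of a value. -/
def Assign.qv (q : Assign X N) {t : S.T} : Val S.D t → ℕ
  | .var _ => 0
  | .con c a => q.qc c fun i => q.qv (a i)

/-- The function `q_e` of an expression, given the numbers of its variables. -/
def Assign.qe (q : Assign X N) {V : S.T → Type} (x : ∀ ⦃t⦄, V t → ℕ) {t : S.T} : Exp S V t → ℕ
  | .var z => x z
  | .con c a => q.qc c fun i => q.qe x (a i)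
  | .app f a => q.qf f fun i => q.qe x (a i)

/-- `q_{σe}`. -/
def Assign.qσ (q : Assign X N) {Δ : List S.T} (σ : GSub S Δ) {t : S.T} (e : Exp S (SV S Δ) t) : ℕ :=
  q.qe (fun _ z => q.qv (σ.app z)) e

open Classical in
/-- `q_{σ A⁺(p⃗)_I}`. -/
noncomputable def Assign.qh (q : Assign X N) {Δ : List S.T} (σ : GSub S Δ) {A : S.Id}
    (m : MHat S A Δ) : ℕ :=
  q.qA A (fun i => if i ∈ m.keepP then q.qσ σ (m.hat.proper i) else 0)
    (fun y => if y.1 ∈ m.keepA then q.qσ σ (m.hat.aux y.1) else 0)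

/-- The vector of the numbers of the arguments of `σ A⁺(p⃗)`. -/
noncomputable def Assign.vec (q : Assign X N) {Δ : List S.T} (σ : GSub S Δ) {A : S.Id}
    (h : Hat S A Δ) : List ℕ :=
  (List.ofFn fun i => q.qσ σ (h.proper i)) ++ (readSeq X N A).map fun y => q.qσ σ (h.aux y)

/-- The conditions on an assignment. In `A⁺(p⃗)_I` arguments are replaced by the fresh constant `0`,
so the arguments of `A⁺` in `subA` range over the values and this constant. -/
structure Assign.Valid (q : Assign X N) : Prop where
  con : ∀ {ts : List S.T} {t : S.T} (c : Cn S.D ts t), ts ≠ [] → 1 ≤ q.d c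
  subf : ∀ (f : S.Fn) (v : ∀ i : Fin (S.fnArgs f).length, Val S.D ((S.fnArgs f).get i)) (i),
    q.qv (v i) ≤ q.qf f fun j => q.qv (v j)
  subA : ∀ (A : S.Id) (x : S.Pos A → ℕ) (y : {y // y ∈ readSet X N A} → ℕ),
    (∀ i, x i = 0 ∨ ∃ v : Val S.D ((S.params A).get i), x i = q.qv v) →
    (∀ i, y i = 0 ∨ ∃ v : Val S.D i.1.ty, y i = q.qv v) →
    (∀ i, x i ≤ q.qA A x y) ∧ (∀ i, y i ≤ q.qA A x y)
  monof : ∀ f : S.Fn, Monotone (q.qf f)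
  monoA : ∀ (A : S.Id) (x x' : S.Pos A → ℕ) (y y' : {y // y ∈ readSet X N A} → ℕ),
    x ≤ x' → y ≤ y' → q.qA A x y ≤ q.qA A x' y'
  ev : ∀ (f : S.Fn) (v : ∀ i : Fin (S.fnArgs f).length, Val S.D ((S.fnArgs f).get i)),
    q.qv (S.ev f v) ≤ q.qf f fun i => q.qv (v i)

/-- A polynomial bounds `q_h(n,…,n)` for all symbols `h` and all `n`. -/
def Assign.PolyBounded (q : Assign X N) : Prop :=
  ∃ U : Polynomial ℕ, ∀ n : ℕ,
    (∀ {ts : List S.T} {t : S.T} (c : Cn S.D ts t), q.qc c (fun _ => n) ≤ U.eval n) ∧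
    (∀ f : S.Fn, q.qf f (fun _ => n) ≤ U.eval n) ∧
    (∀ A : S.Id, q.qA A (fun _ => n) (fun _ => n) ≤ U.eval n)

/-- Comparison of vectors of formulae, given as functions of the ground substitution. -/
def VecGt {G : Type} : Status → (G → List ℕ) → (G → List ℕ) → Prop
  | .lex, a, b => ∃ i : ℕ, ∀ σ : G, ∃ (ha : i < (a σ).length) (hb : i < (b σ).length),
      (∀ (j : ℕ) (hj : j < i), (b σ)[j] ≤ (a σ)[j]) ∧ (b σ)[i] < (a σ)[i]
  | .mset, a, b => ∀ σ : G, Multiset.IsDershowitzMannaLT (b σ : Multiset ℕ) (a σ : Multiset ℕ)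

/-- Satisfaction of an inequality. -/
def Assign.Sat (q : Assign X N) : Ineq S → Prop
  | .gt (A := A) l r => VecGt (N.status A) (fun σ => q.vec σ l) (fun σ => q.vec σ r)
  | .ge l r => ∀ σ, q.qh σ r ≤ q.qh σ l
  | .geExp l e => ∀ σ, q.qσ σ e ≤ q.qh σ l

/-- A polynomially bounded quasi-interpretation. -/
structure Assign.IsQuasi (q : Assign X N) : Prop where
  valid : q.Valid
  poly : q.PolyBounded
  sat : ∀ i : Fin 3, ∀ c ∈ sysIneqs X N i, q.Sat c

end Quasi

end SPi

namespace SPi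

/-! ## Substitution calculus -/

section SubstitutionCalculus

/-! Up to structural equivalence a program is a multiset of threads. By finite control a call never
spawns two calls running in parallel, so the number of threads that survive an instant never grows.
It remains to bound the values and the number of steps of an instant by polynomials that are the
same for all instants.

Call a cycle of a thread the stretch of its computation between two calls of identifiers in `Reset`.
The three families of inequalities play separate roles.

Index 1. The number `A⁺(v)_{I_A}` never increases along a thread, through all instants, and starts
below a polynomial in `d`. At a reset `I_B` contains all positions, so every argument is at most
`A⁺(v)_{I_A}`: each cycle starts with arguments below the same bound `reset`.

Index 2. Within a cycle the values read enter as auxiliary arguments. By the read once condition a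
label is read at most once per cycle, so its value can be left undetermined until it is read, and
fixed from then on. Then `A⁺(v, y)_{↓ρ}` does not increase, for every region `ρ` on which the rest
of the cycle may emit; it bounds the arguments of the calls and the values emitted on `ρ`, and
depends only on values read on regions of smaller rank.

Index 0. Between equivalent identifiers the proper arguments decrease in the lexicographic or
multiset order, because the auxiliary ones are the same on both sides. An argument vector with `K`
entries at most `M` has at most `(M+1)^K` smaller vectors with such entries, so the rank of a call
is polynomial in `M`. For the emissions on `ρ` only the calls that may still lead to an emission on
`ρ` are counted, and their arguments are below the bound for `ρ`.

These facts combine by induction on the rank of regions: values read on smaller ranks bound the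
arguments for `ρ`, hence the size and the number of the emissions on `ρ`, hence the lists read on
`ρ`. As the number of regions is fixed, this is a fixed number of compositions of polynomials
(`levelPoly`, `exists_bounds`).

The invariant `Inv` assigns to each thread a potential, whose components bound the surviving
threads, the remaining steps (component `⊤`) and the emissions on each region. `Frag` is the
invariant of a thread inside a body, and `CycleInv` that of a cycle. `Inv.step` shows that a
reduction pays one unit of the component `⊤` and takes time at most `bd.cost`; `Inv.endInstant`
restarts each surviving thread with the potential `startPot`; `Inv.of_reaches` yields the same bound
at all instants. Names are interpreted by `0`, so threads can be compared after all indices of names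
have been erased. -/

theorem Mem.split_left {α : Type} {t : α} : ∀ {Ψ : List α} (Γ : List α) (x : Mem Ψ t),
    (x.left Γ).split Ψ = .inl x
  | _, _, .z => rfl
  | _, Γ, .s x => by simp [Mem.left, Mem.split, Mem.split_left Γ x]

theorem Mem.split_right {α : Type} {t : α} {Γ : List α} : ∀ (Ψ : List α) (x : Mem Γ t),
    (x.right Ψ).split Ψ = .inr x
  | [], _ => rfl
  | _ :: Ψ, x => by simp [Mem.right, Mem.split, Mem.split_right Ψ x]

theorem Mem.left_or_right {α : Type} {t : α} {Γ : List α} : ∀ (Ψ : List α) (x : Mem (Ψ ++ Γ) t),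
    (∃ y : Mem Ψ t, x = y.left Γ) ∨ ∃ y : Mem Γ t, x = y.right Ψ
  | [], x => .inr ⟨x, rfl⟩
  | _ :: _, .z => .inl ⟨.z, rfl⟩
  | _ :: Ψ, .s x => by
    rcases Mem.left_or_right Ψ x with ⟨y, rfl⟩ | ⟨y, rfl⟩
    · exact .inl ⟨.s y, rfl⟩
    · exact .inr ⟨y, rfl⟩

variable {D : DataSig} {V W Z : D.T → Type} {t : D.T}

theorem CTm.bind_bind (v : CTm D V t) (f : ∀ ⦃u⦄, V u → CTm D W u)
    (g : ∀ ⦃u⦄, W u → CTm D Z u) :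
    (v.bind f).bind g = v.bind fun _ x => (f x).bind g := by
  induction v with
  | var x => rfl
  | con c a ih => simp only [CTm.bind, ih]

theorem CTm.bind_var (v : CTm D V t) : v.bind (fun _ x => .var x) = v := by
  induction v with
  | var x => rfl
  | con c a ih => simp only [CTm.bind, ih]

theorem CTm.toSig_bind {ρ : D.Reg} (v : CTm D V (.sig ρ t)) (f : ∀ ⦃u⦄, V u → CTm D W u) :
    (v.bind f).toSig = (f v.toSig).toSig := by
  cases v with
  | var x => rfl
  | con c a => cases c

/-- Substitutions for the variables and names of programs. -/
abbrev Sub (D : DataSig) (Γ Δ : List D.T) : Type := ∀ ⦃t : D.T⦄, PV D Γ t → CTm D (PV D Δ) t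

/-- Composition of substitutions. -/
def Sub.comp {Γ Δ Θ : List D.T} (f : Sub D Γ Δ) (g : Sub D Δ Θ) : Sub D Γ Θ :=
  fun _ x => (f x).bind g

theorem liftSub_weaken {Γ Δ : List D.T} (Ψ : List D.T) (f : Sub D Γ Δ) (x : PV D Γ t) :
    liftSub Ψ f (x.weaken Ψ) = (f x).bind fun _ y => .var (y.weaken Ψ) := by
  cases x with
  | name ρ t k => rfl
  | bv x => simp only [PV.weaken, liftSub, Mem.split_right]

theorem liftSub_left {Γ Δ : List D.T} (Ψ : List D.T) (f : Sub D Γ Δ) (x : Mem Ψ t) :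
    liftSub Ψ f (.bv (x.left Γ)) = .var (.bv (x.left Δ)) := by
  simp only [liftSub, Mem.split_left]

theorem liftSub_right {Γ Δ : List D.T} (Ψ : List D.T) (f : Sub D Γ Δ) (x : Mem Γ t) :
    liftSub Ψ f (.bv (x.right Ψ)) = (f (.bv x)).bind fun _ y => .var (y.weaken Ψ) := by
  simp only [liftSub, Mem.split_right]

theorem liftSub_comp {Γ Δ Θ : List D.T} (Ψ : List D.T) (f : Sub D Γ Δ) (g : Sub D Δ Θ) :
    Sub.comp (liftSub Ψ f) (liftSub Ψ g) = liftSub Ψ (f.comp g) := by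
  funext t x
  have key : ∀ v : CTm D (PV D Δ) t,
      (v.bind fun _ y => .var (y.weaken Ψ)).bind (liftSub Ψ g) =
        (v.bind g).bind fun _ y => .var (y.weaken Ψ) := by
    intro v
    rw [CTm.bind_bind, CTm.bind_bind]
    congr 1
    funext u y
    exact liftSub_weaken Ψ g y
  cases x with
  | name ρ t k => exact key _
  | bv x =>
    rcases Mem.left_or_right Ψ x with ⟨y, rfl⟩ | ⟨y, rfl⟩
    · simp only [Sub.comp, liftSub_left, CTm.bind]
    · simp only [Sub.comp, liftSub_right]
      exact key _

end SubstitutionCalculus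

/-! ### Composition of substitutions in expressions and programs. -/

section ProgramSubstitution

variable {S : Sgn}

theorem Exp.bind_bind {V W Z : S.T → Type} {t : S.T} (e : Exp S V t)
    (f : ∀ ⦃u⦄, V u → Exp S W u) (g : ∀ ⦃u⦄, W u → Exp S Z u) :
    (e.bind f).bind g = e.bind fun _ x => (f x).bind g := by
  induction e with
  | var x => rfl
  | con c a ih => simp only [Exp.bind, ih]
  | app c a ih => simp only [Exp.bind, ih]

theorem CTm.toExp_bind {V W : S.T → Type} {t : S.T} (v : CTm S.D V t)
    (f : ∀ ⦃u⦄, V u → CTm S.D W u) :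
    (v.bind f).toExp = v.toExp.bind fun _ x => (f x).toExp := by
  induction v with
  | var x => rfl
  | con c a ih => simp only [CTm.bind, CTm.toExp, Exp.bind, ih]

theorem RLeaf.bind_comp {Γ Δ Θ : List S.T} (f : Sub S.D Γ Δ) (g : Sub S.D Δ Θ) {t : S.T}
    (x : RLeaf S Γ t) :
    (RLeaf.bind f x).bind (RLeaf.bind g) = RLeaf.bind (f.comp g) x := by
  cases x with
  | var x =>
    simp only [RLeaf.bind, Sub.comp, CTm.toExp_bind, Exp.bind_bind]
    congr 1
  | deref k s => simp only [RLeaf.bind, Exp.bind, Sub.comp, CTm.toSig_bind]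

theorem EmV.bind_comp {Γ Δ Θ : List S.T} (f : Sub S.D Γ Δ) (g : Sub S.D Δ Θ) (m : EmV S Γ) :
    (m.bind f).bind g = m.bind (f.comp g) := by
  simp only [EmV.bind, Sub.comp, CTm.toSig_bind, CTm.bind_bind]
  rfl

theorem Exp.bind_toExp_comp {Γ Δ Θ : List S.T} (f : Sub S.D Γ Δ) (g : Sub S.D Δ Θ) {t : S.T}
    (e : Exp S (PV S.D Γ) t) :
    (e.bind fun _ x => (f x).toExp).bind (fun _ x => (g x).toExp) =
      e.bind fun _ x => (f.comp g x).toExp := by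
  simp only [Exp.bind_bind, Sub.comp, CTm.toExp_bind]

theorem Prog.bind_comp {Γ : List S.T} (P : Prog S Γ) : ∀ {Δ Θ : List S.T} (f : Sub S.D Γ Δ)
    (g : Sub S.D Δ Θ), (P.bind f).bind g = P.bind (f.comp g) := by
  induction P with
  | zero => intros; rfl
  | call A e => intros; simp only [Prog.bind, Exp.bind_toExp_comp]
  | env E =>
    intros
    simp only [Prog.bind, List.map_map]
    congr 1
    exact List.map_congr_left fun m _ => EmV.bind_comp _ _ m
  | emit s e => intros; simp only [Prog.bind, Exp.bind_toExp_comp, Sub.comp, CTm.toSig_bind]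
  | present k s P B r ih =>
    intros
    simp only [Prog.bind, ih, liftSub_comp, Sub.comp, CTm.toSig_bind, Exp.bind_bind]
    congr 1
    funext i
    congr 1
    funext u x
    exact RLeaf.bind_comp _ _ x
  | matchs s₁ s₂ P₁ P₂ ih₁ ih₂ =>
    intros; simp only [Prog.bind, ih₁, ih₂, Sub.comp, CTm.toSig_bind]
  | matchv u p P₁ P₂ ih₁ ih₂ =>
    intros
    simp only [Prog.bind, ih₁, ih₂, liftSub_comp, CTm.bind_bind]
    rfl
  | nu ρ t P ih => intros; simp only [Prog.bind, ih, liftSub_comp]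
  | par P₁ P₂ ih₁ ih₂ => intros; simp only [Prog.bind, ih₁, ih₂]

end ProgramSubstitution

/-! ## The threads of a program -/

section Threads

variable {S : Sgn}

/-- Extension of a substitution to a bound signal name, which is replaced by the name of index
`0`. -/
def Sub.extNu {D : DataSig} {Γ : List D.T} (ρ : D.Reg) (t : D.T) (f : Sub D Γ []) :
    Sub D (.sig ρ t :: Γ) []
  | _, .name ρ t k => f (.name ρ t k)
  | _, .bv .z => .var (.name ρ t 0)
  | _, .bv (.s x) => f (.bv x)

/-- The multiset of the maximal subprograms under `ν` and `|`, with the substitution `f` for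
free variables; bound names are replaced by names of index `0`. -/
def Prog.threads : ∀ {Γ : List S.T}, Prog S Γ → Sub S.D Γ [] → Multiset (Prog S [])
  | _, .zero, _ => 0
  | _, .call A e, f => {(Prog.call A e).bind f}
  | _, .env E, f => {(Prog.env E).bind f}
  | _, .emit s e, f => {(Prog.emit s e).bind f}
  | _, .present k s P B r, f => {(Prog.present k s P B r).bind f}
  | _, .matchs s₁ s₂ P₁ P₂, f => {(Prog.matchs s₁ s₂ P₁ P₂).bind f}
  | _, .matchv u p P₁ P₂, f => {(Prog.matchv u p P₁ P₂).bind f}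
  | _, .nu ρ t P, f => P.threads (f.extNu ρ t)
  | _, .par P₁ P₂, f => P₁.threads f + P₂.threads f

/-- The substitution that sets the index of every name to `0`. -/
def Sub.erase {D : DataSig} {Γ : List D.T} : Sub D Γ Γ
  | _, .name ρ t _ => .var (.name ρ t 0)
  | _, .bv x => .var (.bv x)

theorem Sub.comp_extNu {D : DataSig} {Γ Δ : List D.T} (ρ : D.Reg) (t : D.T) (f : Sub D Γ Δ)
    (g : Sub D Δ []) :
    Sub.comp (liftSub [.sig ρ t] f) (g.extNu ρ t) = (f.comp g).extNu ρ t := by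
  have key : ∀ {u : D.T} (v : CTm D (PV D Δ) u),
      (v.bind fun _ y => .var (y.weaken [.sig ρ t])).bind (g.extNu ρ t) = v.bind g := by
    intro u v
    rw [CTm.bind_bind]
    congr 1
    funext w y
    cases y with
    | name ρ t k => rfl
    | bv x => simp only [PV.weaken, Mem.right, CTm.bind, Sub.extNu]
  funext u x
  match x with
  | .name ρ t k => exact key _
  | .bv .z => rfl
  | .bv (.s x) =>
    have h : liftSub [.sig ρ t] f (.bv (.s x)) = (f (.bv x)).bind fun _ y => .var (y.weaken _) :=
      liftSub_right [.sig ρ t] f x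
    rw [Sub.comp, h, key]
    simp only [Sub.extNu, Sub.comp]

theorem Prog.threads_bind {Γ : List S.T} (P : Prog S Γ) : ∀ {Δ : List S.T} (f : Sub S.D Γ Δ)
    (g : Sub S.D Δ []), (P.bind f).threads g = P.threads (f.comp g) := by
  induction P with
  | zero => intros; rfl
  | call A e => intro _ f g; exact congrArg _ (Prog.bind_comp (.call A e) f g)
  | env E => intro _ f g; exact congrArg _ (Prog.bind_comp (.env E) f g)
  | emit s e => intro _ f g; exact congrArg _ (Prog.bind_comp (.emit s e) f g)
  | present k s P B r ih =>
    intro _ f g; exact congrArg _ (Prog.bind_comp (.present k s P B r) f g)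
  | matchs s₁ s₂ P₁ P₂ ih₁ ih₂ =>
    intro _ f g; exact congrArg _ (Prog.bind_comp (.matchs s₁ s₂ P₁ P₂) f g)
  | matchv u p P₁ P₂ ih₁ ih₂ =>
    intro _ f g; exact congrArg _ (Prog.bind_comp (.matchv u p P₁ P₂) f g)
  | nu ρ t P ih => intro _ f g; simp only [Prog.bind, Prog.threads, ih, Sub.comp_extNu]
  | par P₁ P₂ ih₁ ih₂ => intros; simp only [Prog.bind, Prog.threads, ih₁, ih₂]

/-- The threads of a closed program, up to the identity of names. -/
def Prog.thr (P : Prog S []) : Multiset (Prog S []) := P.threads Sub.erase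

/-- The bound variable that replaces `n` is sent by `Sub.extNu` to the name of index `0`, which is
also the image of `n` under `Sub.erase`. So a restriction leaves no trace in `thr`. -/
theorem thr_newName (n : Name S.D) (P : Prog S []) : (newName n P).thr = P.thr := by
  simp only [Prog.thr, newName, Prog.threads, Prog.threads_bind]
  congr 1
  funext t x
  match x with
  | .name ρ t k =>
    by_cases h : n = ⟨ρ, t, k⟩
    · subst h
      simp only [Sub.comp, dite_true]
      rfl
    · simp only [Sub.comp, h, dite_false]
      rfl

theorem thr_newNames (ns : List (Name S.D)) (P : Prog S []) : (newNames ns P).thr = P.thr := by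
  induction ns with
  | nil => rfl
  | cons n ns ih => exact (thr_newName n _).trans ih

theorem thr_par (P Q : Prog S []) : (Prog.par P Q).thr = P.thr + Q.thr := rfl

theorem thr_pars (l : List (Prog S [])) : (pars l).thr = (l.map Prog.thr).sum := by
  induction l with
  | nil => rfl
  | cons P l ih => rw [List.map_cons, List.sum_cons, ← ih]; rfl

/-- With the indices erased, the scope rules hold trivially and the remaining rules are those of a
commutative monoid. Erasure identifies all names of the same region and type, which is harmless:
names are interpreted by `0`, and no estimate uses that two names differ. -/
theorem Equ.thr_eq {P Q : Prog S []} (h : Equ P Q) : P.thr = Q.thr := by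
  induction h with
  | refl => rfl
  | symm _ ih => exact ih.symm
  | trans _ _ ih₁ ih₂ => exact ih₁.trans ih₂
  | par_zero P => exact add_zero _
  | par_comm P Q => exact add_comm _ _
  | par_assoc P Q R => exact add_assoc _ _ _
  | new_drop n P _ => exact thr_newName n P
  | new_par n P Q _ => simp only [thr_par, thr_newName]
  | cong_par Q _ ih => simp only [thr_par, ih]
  | cong_new n _ ih => simp only [thr_newName, ih]

/-- The multiset contributed by the context does not depend on the plugged program, so a reduction
changes only the threads of its redex. -/
theorem SCtx.thr_plug (C : SCtx S) :
    ∃ M : Multiset (Prog S []), ∀ P, (C.plug P).thr = P.thr + M := by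
  induction C with
  | hole => exact ⟨0, fun P => (add_zero _).symm⟩
  | new n C ih =>
    obtain ⟨M, h⟩ := ih
    exact ⟨M, fun P => (thr_newName n _).trans (h P)⟩
  | par C Q ih =>
    obtain ⟨M, h⟩ := ih
    exact ⟨M + Q.thr, fun P => by rw [SCtx.plug, thr_par, h, add_assoc]⟩

theorem thr_pars_map {α : Type} (l : List α) (f : α → Prog S []) (g : α → Prog S [])
    (h : ∀ a, (f a).thr = {g a}) : (pars (l.map f)).thr = ↑(l.map g) := by
  rw [thr_pars]
  induction l with
  | nil => rfl
  | cons a l ih => simp only [List.map_cons, List.sum_cons, ih, h, Multiset.singleton_add,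
      Multiset.cons_coe]

end Threads

/-! ## Interpretations of values and expressions -/

section Interpretation

variable {S : Sgn} {X : Sys S} {N : Ann S} (q : Assign X N)

/-- The polynomial `U` bounds all the functions of the assignment on the diagonal. -/
def Assign.BoundedBy (U : Polynomial ℕ) : Prop :=
  ∀ n : ℕ,
    (∀ {ts : List S.T} {t : S.T} (c : Cn S.D ts t), q.qc c (fun _ => n) ≤ U.eval n) ∧
    (∀ f : S.Fn, q.qf f (fun _ => n) ≤ U.eval n) ∧
    (∀ A : S.Id, q.qA A (fun _ => n) (fun _ => n) ≤ U.eval n)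

theorem evalMono (p : Polynomial ℕ) : Monotone fun n : ℕ => p.eval n := by
  intro a b h
  simp only [Polynomial.eval_eq_sum_range]
  gcongr

variable {q}

theorem Assign.qc_mono {ts : List S.T} {t : S.T} (c : Cn S.D ts t) : Monotone (q.qc c) := by
  intro x y h
  unfold Assign.qc
  split_ifs
  · exact le_rfl
  · gcongr with i _
    exact h i

theorem Assign.qe_bind {V W : S.T → Type} (x : ∀ ⦃t⦄, W t → ℕ) {t : S.T} (e : Exp S V t)
    (f : ∀ ⦃u⦄, V u → Exp S W u) :
    q.qe x (e.bind f) = q.qe (fun _ z => q.qe x (f z)) e := by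
  induction e with
  | var z => rfl
  | con c a ih => simp only [Exp.bind, Assign.qe, ih]
  | app g a ih => simp only [Exp.bind, Assign.qe, ih]

theorem Assign.qe_mono (hq : q.Valid) {V : S.T → Type} {x y : ∀ ⦃t⦄, V t → ℕ} {t : S.T}
    (e : Exp S V t) (h : ∀ ⦃t⦄ (z : V t), x z ≤ y z) : q.qe x e ≤ q.qe y e := by
  induction e with
  | var z => exact h z
  | con c a ih => exact q.qc_mono c ih
  | app g a ih => exact hq.monof g ih

/-- Two valuations that agree on the leaves of an expression give the same number. -/
theorem Assign.qe_congr_leaves {V : S.T → Type} {x y : ∀ ⦃t⦄, V t → ℕ} {t : S.T} (e : Exp S V t)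
    (h : ∀ ⦃u⦄ (z : V u), (⟨u, z⟩ : Σ u, V u) ∈ e.leaves (fun _ w => {⟨_, w⟩}) → x z = y z) :
    q.qe x e = q.qe y e := by
  induction e with
  | var z => exact h z rfl
  | con c a ih =>
    simp only [Assign.qe]
    congr 1
    funext i
    exact ih i fun u z hz => h z ⟨i, hz⟩
  | app g a ih =>
    simp only [Assign.qe]
    congr 1
    funext i
    exact ih i fun u z hz => h z ⟨i, hz⟩

theorem Assign.qe_toExp {t : S.T} (v : Val S.D t) : q.qe (fun _ _ => 0) v.toExp = q.qv v := by
  induction v with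
  | var z => rfl
  | con c a ih => simp only [CTm.toExp, Assign.qe, Assign.qv, ih]

theorem Assign.qv_bind {V : S.T → Type} {t : S.T} (v : CTm S.D V t)
    (f : ∀ ⦃u⦄, V u → Val S.D u) : q.qv (v.bind f) = q.qe (fun _ z => q.qv (f z)) v.toExp := by
  rw [← Assign.qe_toExp, CTm.toExp_bind, Assign.qe_bind]
  simp only [Assign.qe_toExp]

theorem Assign.qv_erase {t : S.T} (v : Val S.D t) : q.qv (v.bind Sub.erase) = q.qv v := by
  rw [Assign.qv_bind, ← Assign.qe_toExp]
  congr 1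
  funext t z
  cases z <;> rfl

theorem Assign.qv_eval_le (hq : q.Valid) {t : S.T} (e : Exp S (PV S.D []) t) :
    q.qv e.eval ≤ q.qe (fun _ _ => 0) e := by
  induction e with
  | var z => exact le_rfl
  | con c a ih => exact q.qc_mono c ih
  | app f a ih => exact (hq.ev f _).trans (hq.monof f ih)

theorem CTm.size_le_qv (hq : q.Valid) {t : S.T} (v : Val S.D t) : v.size ≤ q.qv v := by
  induction v with
  | var z => exact le_rfl
  | con c a ih =>
    simp only [CTm.size, Assign.qv, Assign.qc]
    split_ifs with h
    · exact le_rfl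
    · exact add_le_add (hq.con c h) (Finset.sum_le_sum fun i _ => ih i)

variable {U : Polynomial ℕ}

/-- At the point `0` the function of a constructor takes the value `d_c`; at the point `1`, in the
next lemma, it takes `d_c` plus the arity. One polynomial thus controls constants and arities of all
constructors, of which there may be infinitely many. -/
theorem Assign.BoundedBy.d_le (hU : q.BoundedBy U) {ts : List S.T} {t : S.T} (c : Cn S.D ts t)
    (h : ts ≠ []) : q.d c ≤ U.eval 0 := by
  simpa [Assign.qc, h] using (hU 0).1 c

theorem Assign.BoundedBy.arity_le (hU : q.BoundedBy U) {ts : List S.T} {t : S.T}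
    (c : Cn S.D ts t) : ts.length ≤ U.eval 1 := by
  by_cases h : ts = []
  · simp [h]
  · have := (hU 1).1 c
    simp [Assign.qc, h] at this
    omega

/-- Together with `CTm.size_le_qv`, this makes size and interpretation of values equivalent up to a
constant factor. -/
theorem Assign.BoundedBy.qv_le (hU : q.BoundedBy U) {t : S.T} (v : Val S.D t) :
    q.qv v ≤ U.eval 0 * v.size := by
  induction v with
  | var z => exact Nat.zero_le _
  | con c a ih =>
    simp only [CTm.size, Assign.qv, Assign.qc]
    split_ifs with h
    · exact Nat.zero_le _
    · rw [mul_add, mul_one, Finset.mul_sum]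
      exact add_le_add (hU.d_le c h) (Finset.sum_le_sum fun i _ => ih i)

theorem Assign.qv_listVal_le (hU : q.BoundedBy U) {t : S.T} {b : ℕ} :
    ∀ l : List (Val S.D t), (∀ v ∈ l, q.qv v ≤ b) →
      q.qv (listVal l) ≤ l.length * (U.eval 0 + b)
  | [], _ => by simp [listVal, Assign.qv, Assign.qc]
  | v :: l, h => by
    have ih := Assign.qv_listVal_le hU l fun w hw => h w (List.mem_cons_of_mem _ hw)
    have hd := hU.d_le (.cons t) (by simp)
    have hv := h v List.mem_cons_self
    have : q.qv (listVal (v :: l)) = q.d (.cons t) + (q.qv v + q.qv (listVal l)) := by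
      simp only [listVal, Assign.qv, Assign.qc]
      rw [if_neg (by simp)]
      congr 1
    rw [this, List.length_cons, add_mul, one_mul]
    omega

/-- The interpretation of a pattern variable that occurs in the pattern. -/
theorem Assign.le_qv_of_mem_leaves {V : S.T → Type} {t : S.T} (v : CTm S.D V t)
    (f : ∀ ⦃u⦄, V u → Val S.D u) {u : S.T} (x : V u)
    (h : (⟨u, x⟩ : Σ u, V u) ∈ v.leaves fun _ y => {⟨_, y⟩}) : q.qv (f x) ≤ q.qv (v.bind f) := by
  induction v with
  | var z =>
    obtain ⟨rfl, h⟩ := Sigma.mk.inj_iff.1 (Set.mem_singleton_iff.1 h)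
    cases h
    exact le_rfl
  | con c a ih =>
    obtain ⟨i, hi⟩ := h
    refine (ih i hi).trans ?_
    simp only [CTm.bind, Assign.qv, Assign.qc]
    split_ifs with h
    · subst h; exact i.elim0
    · exact (Finset.single_le_sum (f := fun i => q.qv ((a i).bind f))
        (fun _ _ => Nat.zero_le _) (Finset.mem_univ i)).trans (Nat.le_add_left _ _)

end Interpretation

/-! ## Polynomial bounds for the evaluation of expressions -/

section Cost

variable {S : Sgn} {X : Sys S} {N : Ann S}

/-- A polynomial that bounds the time of the evaluation of a function symbol. -/
noncomputable def timePoly (f : S.Fn) : Polynomial ℕ := (S.time_poly f).choose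

/-- A bound of the time of an evaluation, given the interpretations `x` and the costs `y` of the
leaves. -/
noncomputable def Assign.costBound (q : Assign X N) {V : S.T → Type} (x y : ∀ ⦃t⦄, V t → ℕ)
    {t : S.T} : Exp S V t → ℕ
  | .var z => y z
  | .con _ a => 1 + ∑ i, Assign.costBound q x y (a i)
  | .app f a => 1 + (∑ i, q.costBound x y (a i)) + (timePoly f).eval (∑ i, q.qe x (a i))

variable {q : Assign X N}

/-- The cost of a function symbol depends on the interpretations of its arguments, so both
valuations have to be composed with the substitution. -/
theorem Assign.costBound_bind {V W : S.T → Type} (x y : ∀ ⦃t⦄, W t → ℕ) {t : S.T} (e : Exp S V t)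
    (f : ∀ ⦃u⦄, V u → Exp S W u) :
    q.costBound x y (e.bind f) =
      q.costBound (fun _ z => q.qe x (f z)) (fun _ z => q.costBound x y (f z)) e := by
  induction e with
  | var z => rfl
  | con c a ih => simp only [Exp.bind, Assign.costBound, ih]
  | app g a ih => simp only [Exp.bind, Assign.costBound, ih, Assign.qe_bind]

/-- The bound for closed expressions. -/
noncomputable abbrev Assign.closedCost (q : Assign X N) {t : S.T} (e : Exp S (PV S.D []) t) : ℕ :=
  q.costBound (fun _ _ => 0) (fun _ _ => 1) e

/-- Evaluation times are polynomial in the sizes of values, and these are bounded by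
interpretations. -/
theorem Exp.cost_le (hq : q.Valid) {t : S.T} (e : Exp S (PV S.D []) t) :
    e.cost ≤ q.closedCost e := by
  induction e with
  | var z => exact le_rfl
  | con c a ih =>
    simp only [Exp.cost, Assign.closedCost, Assign.costBound]
    gcongr with i
    exact ih i
  | app f a ih =>
    simp only [Exp.cost, Assign.closedCost, Assign.costBound]
    gcongr with i
    · exact ih i
    · refine ((S.time_poly f).choose_spec _).trans (evalMono _ ?_)
      gcongr with i
      exact ((a i).eval.size_le_qv hq).trans (q.qv_eval_le hq _)

theorem Assign.closedCost_erase {t : S.T} (e : Exp S (PV S.D []) t) :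
    q.closedCost (e.bind fun _ x => (Sub.erase x).toExp) = q.closedCost e := by
  rw [Assign.closedCost, Assign.costBound_bind]
  congr 1 <;>
  · funext t z
    cases z <;> rfl

theorem Assign.qe_erase {t : S.T} (e : Exp S (PV S.D []) t) :
    q.qe (fun _ _ => 0) (e.bind fun _ x => (Sub.erase x).toExp) = q.qe (fun _ _ => 0) e := by
  rw [Assign.qe_bind]
  congr 1
  funext t z
  cases z <;> rfl

theorem Assign.closedCost_toExp_le (hq : q.Valid) {U : Polynomial ℕ} (hU : q.BoundedBy U) {t : S.T}
    (v : Val S.D t) : q.closedCost v.toExp ≤ 1 + (U.eval 1 + 1) * q.qv v := by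
  induction v with
  | var z => exact Nat.le_add_right _ _
  | con c a ih =>
    rename_i ts t
    simp only [CTm.toExp, Assign.closedCost, Assign.costBound, Assign.qv, Assign.qc] at ih ⊢
    split_ifs with h
    · subst h; simp
    · have h1 := hq.con c h
      have h2 := hU.arity_le c
      have h3 := Finset.sum_le_sum fun i (_ : i ∈ Finset.univ) => ih i
      rw [Finset.sum_add_distrib, ← Finset.mul_sum] at h3
      simp only [Finset.sum_const, Finset.card_univ, Fintype.card_fin, smul_eq_mul, mul_one] at h3
      -- `d_c ≥ 1` gives `(U(1) + 1) * d_c ≥ U(1) + 1`, which pays for one unit per argument, as the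
      -- arity is at most `U(1)`.
      nlinarith

/-- Every expression has a polynomial bound for its interpretation and for its cost. -/
theorem Assign.exists_poly (hq : q.Valid) {U : Polynomial ℕ} (hU : q.BoundedBy U)
    {V : S.T → Type} {t : S.T} (e : Exp S V t) :
    ∃ p : Polynomial ℕ, ∀ (b : ℕ) (x y : ∀ ⦃t⦄, V t → ℕ), (∀ ⦃t⦄ (z : V t), x z ≤ b) →
      (∀ ⦃t⦄ (z : V t), y z ≤ b) → q.qe x e ≤ p.eval b ∧ q.costBound x y e ≤ p.eval b := by
  induction e with
  | var z => exact ⟨.X, fun b x y hx hy => by simpa using ⟨hx z, hy z⟩⟩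
  | con c a ih =>
    choose p hp using ih
    refine ⟨U.comp (∑ i, p i) + (1 + ∑ i, p i), fun b x y hx hy => ?_⟩
    have hs : ∀ i, (p i).eval b ≤ (∑ i, p i).eval b := fun i => by
      rw [Polynomial.eval_finsetSum]
      exact Finset.single_le_sum (f := fun i => (p i).eval b) (fun _ _ => Nat.zero_le _)
        (Finset.mem_univ i)
    have h1 : q.qe x (.con c a) ≤ U.eval ((∑ i, p i).eval b) :=
      (q.qc_mono c fun i => ((hp i b x y hx hy).1.trans (hs i))).trans ((hU _).1 c)
    have h2 : ∑ i, q.costBound x y (a i) ≤ (∑ i, p i).eval b := by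
      rw [Polynomial.eval_finsetSum]
      exact Finset.sum_le_sum fun i _ => (hp i b x y hx hy).2
    simp only [Polynomial.eval_add, Polynomial.eval_comp, Polynomial.eval_one, Assign.costBound]
    omega
  | app f a ih =>
    choose p hp using ih
    refine ⟨U.comp (∑ i, p i) + (1 + ∑ i, p i) + (timePoly f).comp (∑ i, p i),
      fun b x y hx hy => ?_⟩
    have hs : ∀ i, (p i).eval b ≤ (∑ i, p i).eval b := fun i => by
      rw [Polynomial.eval_finsetSum]
      exact Finset.single_le_sum (f := fun i => (p i).eval b) (fun _ _ => Nat.zero_le _)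
        (Finset.mem_univ i)
    have h1 : q.qe x (.app f a) ≤ U.eval ((∑ i, p i).eval b) :=
      (hq.monof f fun i => ((hp i b x y hx hy).1.trans (hs i))).trans ((hU _).2.1 f)
    have h2 : ∑ i, q.costBound x y (a i) ≤ (∑ i, p i).eval b := by
      rw [Polynomial.eval_finsetSum]
      exact Finset.sum_le_sum fun i _ => (hp i b x y hx hy).2
    have h3 : (timePoly f).eval (∑ i, q.qe x (a i)) ≤ (timePoly f).eval ((∑ i, p i).eval b) := by
      refine evalMono _ ?_
      rw [Polynomial.eval_finsetSum]
      exact Finset.sum_le_sum fun i _ => (hp i b x y hx hy).1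
    simp only [Polynomial.eval_add, Polynomial.eval_comp, Polynomial.eval_one, Assign.costBound]
    omega

end Cost

/-! ## Call graphs and labels -/

section CallGraph

variable {S : Sgn}

theorem Prog.subset_of_mem_calls {reset : Set S.Id} {Γ : List S.T} (P : Prog S Γ) :
    ∀ {L L' : Set (Lab S)} {b : Option S.Id}, (b, L') ∈ P.calls reset L → L ⊆ L' := by
  induction P with
  | zero => intro L L' b h; cases h; exact subset_rfl
  | call A e => intro L L' b h; cases h; exact subset_rfl
  | env E => intro L L' b h; cases h; exact subset_rfl
  | emit s e => intro L L' b h; cases h; exact subset_rfl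
  | present k s P B r ih =>
    intro L L' b h
    rcases h with h | h
    · exact Set.subset_union_left.trans (ih h)
    · cases h; exact Set.subset_union_left
  | matchs s₁ s₂ P₁ P₂ ih₁ ih₂ =>
    intro L L' b h; rcases h with h | h; exacts [ih₁ h, ih₂ h]
  | matchv u p P₁ P₂ ih₁ ih₂ =>
    intro L L' b h; rcases h with h | h; exacts [ih₁ h, ih₂ h]
  | nu ρ t P ih => intro L L' b h; exact ih h
  | par P₁ P₂ ih₁ ih₂ => intro L L' b h; rcases h with h | h; exacts [ih₁ h, ih₂ h]

/-- A program without calls still has an edge to the sink; hence the label of every `present`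
statement lies on some edge of the call graph. -/
theorem Prog.calls_nonempty {reset : Set S.Id} {Γ : List S.T} (P : Prog S Γ) :
    ∀ L : Set (Lab S), (P.calls reset L).Nonempty := by
  induction P with
  | zero => exact fun L => ⟨_, rfl⟩
  | call A e => exact fun L => ⟨_, rfl⟩
  | env E => exact fun L => ⟨_, rfl⟩
  | emit s e => exact fun L => ⟨_, rfl⟩
  | present k s P B r ih => exact fun L => (ih _).inl
  | matchs s₁ s₂ P₁ P₂ ih₁ ih₂ => exact fun L => (ih₁ _).inl
  | matchv u p P₁ P₂ ih₁ ih₂ => exact fun L => (ih₁ _).inl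
  | nu ρ t P ih => exact ih
  | par P₁ P₂ ih₁ ih₂ => exact fun L => (ih₁ _).inl

/-- The labels of the arguments of the else branch of a `present`. -/
def argLabels {Γ : List S.T} {B : S.Id}
    (r : ∀ i : S.Pos B, Exp S (RLeaf S Γ) ((S.params B).get i)) : Set (Lab S) :=
  {y | ∃ i, y ∈ (r i).leafList RLeaf.labels}

theorem mem_flatten_ofFn {α : Type} {n : ℕ} {f : Fin n → List α} {a : α} :
    a ∈ (List.ofFn f).flatten ↔ ∃ i, a ∈ f i := by
  simp [List.mem_flatten, List.mem_ofFn']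

theorem Prog.mem_of_mem_calls {reset : Set S.Id} {Γ : List S.T} (P : Prog S Γ) :
    ∀ {L L' : Set (Lab S)} {b : Option S.Id} {y : Lab S}, (b, L') ∈ P.calls reset L → y ∈ L' →
      y ∈ L ∨ y ∈ P.labels := by
  induction P with
  | zero => intro L L' b y h hy; cases h; exact .inl hy
  | call A e => intro L L' b y h hy; cases h; exact .inl hy
  | env E => intro L L' b y h hy; cases h; exact .inl hy
  | emit s e => intro L L' b y h hy; cases h; exact .inl hy
  | present k s P B r ih =>
    intro L L' b y h hy
    simp only [Prog.labels, List.mem_cons, List.mem_append, mem_flatten_ofFn]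
    rcases h with h | h
    · rcases ih h hy with (h | h) | h
      · exact .inl h
      · exact .inr (.inl h)
      · exact .inr (.inr (.inl h))
    · cases h
      rcases hy with h | h
      · exact .inl h
      · exact .inr (.inr (.inr h))
  | matchs s₁ s₂ P₁ P₂ ih₁ ih₂ =>
    intro L L' b y h hy
    simp only [Prog.labels, List.mem_append]
    rcases h with h | h
    · exact (ih₁ h hy).imp_right .inl
    · exact (ih₂ h hy).imp_right .inr
  | matchv u p P₁ P₂ ih₁ ih₂ =>
    intro L L' b y h hy
    simp only [Prog.labels, List.mem_append]
    rcases h with h | h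
    · exact (ih₁ h hy).imp_right .inl
    · exact (ih₂ h hy).imp_right .inr
  | nu ρ t P ih => intro L L' b y h hy; exact ih h hy
  | par P₁ P₂ ih₁ ih₂ =>
    intro L L' b y h hy
    simp only [Prog.labels, List.mem_append]
    rcases h with h | h
    · exact (ih₁ h hy).imp_right .inl
    · exact (ih₂ h hy).imp_right .inr

theorem Prog.exists_mem_calls {reset : Set S.Id} {Γ : List S.T} (P : Prog S Γ) {B : S.Id}
    (hB : B ∉ reset) : B ∈ P.instCalls → ∀ L, ∃ L', (some B, L') ∈ P.calls reset L := by
  induction P with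
  | zero => exact fun h => h.elim
  | call A e => intro h L; cases h; exact ⟨L, by simp [Prog.calls, hB]⟩
  | env E => exact fun h => h.elim
  | emit s e => exact fun h => h.elim
  | present k s P B r ih => exact fun h L => (ih h _).imp fun _ h => .inl h
  | matchs s₁ s₂ P₁ P₂ ih₁ ih₂ =>
    intro h L
    rcases h with h | h
    · exact (ih₁ h L).imp fun _ h => .inl h
    · exact (ih₂ h L).imp fun _ h => .inr h
  | matchv u p P₁ P₂ ih₁ ih₂ =>
    intro h L
    rcases h with h | h
    · exact (ih₁ h L).imp fun _ h => .inl h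
    · exact (ih₂ h L).imp fun _ h => .inr h
  | nu ρ t P ih => exact ih
  | par P₁ P₂ ih₁ ih₂ =>
    intro h L
    rcases h with h | h
    · exact (ih₁ h L).imp fun _ h => .inl h
    · exact (ih₂ h L).imp fun _ h => .inr h

variable (X : Sys S) (N : Ann S)

/-- The labels that may be read during the rest of the cycle. -/
def Prog.future : ∀ {Γ : List S.T}, Prog S Γ → Set (Lab S)
  | _, .zero => ∅
  | _, .call B _ => {y | B ∉ N.reset ∧ y ∈ readSet X N B}
  | _, .env _ => ∅
  | _, .emit _ _ => ∅
  | _, .present (ρ := ρ) (t := t) k _ P B r =>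
      {.read k ρ t} ∪ P.future ∪ argLabels r ∪ {y | B ∉ N.reset ∧ y ∈ readSet X N B}
  | _, .matchs _ _ P₁ P₂ => P₁.future ∪ P₂.future
  | _, .matchv _ _ P₁ P₂ => P₁.future ∪ P₂.future
  | _, .nu _ _ P => P.future
  | _, .par P₁ P₂ => P₁.future ∪ P₂.future

/-- `P` is a subprogram of the body of `A`, and `L` contains the labels on the path to it. -/
structure Within (A : S.Id) (L : Set (Lab S)) {Γ : List S.T} (P : Prog S Γ) : Prop where
  calls : P.calls N.reset L ⊆ (X.body A).calls N.reset ∅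
  labels : P.labels.Sublist (X.body A).labels
  inst : P.instCalls ⊆ (X.body A).instCalls
  emits : P.emitRegs ⊆ (X.body A).emitRegs
  fin : P.FiniteControl
  source : P.IsSource

variable {X N} {A : S.Id} {L : Set (Lab S)} {Γ : List S.T}

theorem Within.body (hfin : X.FiniteControl) (A : S.Id) : Within X N A ∅ (X.body A) :=
  ⟨subset_rfl, List.Sublist.refl _, subset_rfl, subset_rfl, hfin A, X.source A⟩

theorem Within.matchs_left {ρ : S.D.Reg} {t : S.T} {s₁ s₂ : PV S.D Γ (.sig ρ t)}
    {P₁ P₂ : Prog S Γ} (h : Within X N A L (.matchs s₁ s₂ P₁ P₂)) : Within X N A L P₁ :=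
  ⟨Set.subset_union_left.trans h.calls, (List.sublist_append_left _ _).trans h.labels,
    Set.subset_union_left.trans h.inst, Set.subset_union_left.trans h.emits, h.fin.1, h.source.1⟩

theorem Within.matchs_right {ρ : S.D.Reg} {t : S.T} {s₁ s₂ : PV S.D Γ (.sig ρ t)}
    {P₁ P₂ : Prog S Γ} (h : Within X N A L (.matchs s₁ s₂ P₁ P₂)) : Within X N A L P₂ :=
  ⟨Set.subset_union_right.trans h.calls, (List.sublist_append_right _ _).trans h.labels,
    Set.subset_union_right.trans h.inst, Set.subset_union_right.trans h.emits, h.fin.2, h.source.2⟩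

theorem Within.par_left {P₁ P₂ : Prog S Γ} (h : Within X N A L (.par P₁ P₂)) : Within X N A L P₁ :=
  ⟨Set.subset_union_left.trans h.calls, (List.sublist_append_left _ _).trans h.labels,
    Set.subset_union_left.trans h.inst, Set.subset_union_left.trans h.emits, h.fin.1, h.source.1⟩

theorem Within.par_right {P₁ P₂ : Prog S Γ} (h : Within X N A L (.par P₁ P₂)) :
    Within X N A L P₂ :=
  ⟨Set.subset_union_right.trans h.calls, (List.sublist_append_right _ _).trans h.labels,
    Set.subset_union_right.trans h.inst, Set.subset_union_right.trans h.emits, h.fin.2.1,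
    h.source.2⟩

theorem Within.matchv_left {t : S.T} {u : CTm S.D (PV S.D Γ) t} {p : Pattern S.D t}
    {P₁ : Prog S (p.vars ++ Γ)} {P₂ : Prog S Γ} (h : Within X N A L (.matchv u p P₁ P₂)) :
    Within X N A L P₁ :=
  ⟨Set.subset_union_left.trans h.calls, (List.sublist_append_left _ _).trans h.labels,
    Set.subset_union_left.trans h.inst, Set.subset_union_left.trans h.emits, h.fin.1,
    h.source.2.2.1⟩

theorem Within.matchv_right {t : S.T} {u : CTm S.D (PV S.D Γ) t} {p : Pattern S.D t}
    {P₁ : Prog S (p.vars ++ Γ)} {P₂ : Prog S Γ} (h : Within X N A L (.matchv u p P₁ P₂)) :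
    Within X N A L P₂ :=
  ⟨Set.subset_union_right.trans h.calls, (List.sublist_append_right _ _).trans h.labels,
    Set.subset_union_right.trans h.inst, Set.subset_union_right.trans h.emits, h.fin.2,
    h.source.2.2.2⟩

theorem Within.nu {ρ : S.D.Reg} {t : S.T} {P : Prog S (.sig ρ t :: Γ)}
    (h : Within X N A L (.nu ρ t P)) : Within X N A L P :=
  ⟨h.calls, h.labels, h.inst, h.emits, h.fin, h.source⟩

section Present

variable {ρ : S.D.Reg} {t : S.T} {k : ℕ} {s : PV S.D Γ (.sig ρ t)} {P : Prog S (t :: Γ)} {B : S.Id}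
  {r : ∀ i : S.Pos B, Exp S (RLeaf S Γ) ((S.params B).get i)}

theorem Within.present (h : Within X N A L (.present k s P B r)) :
    Within X N A (L ∪ {.read k ρ t}) P :=
  ⟨Set.subset_union_left.trans h.calls,
    ((List.sublist_append_left _ _).trans (List.sublist_cons_self _ _)).trans h.labels,
    h.inst, h.emits, h.fin, h.source⟩

theorem Within.else_mem_calls (h : Within X N A L (.present k s P B r)) (hB : B ∉ N.reset) :
    (some B, L ∪ argLabels r) ∈ (X.body A).calls N.reset ∅ :=
  h.calls (.inr (by simp [hB, argLabels]))

end Present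

theorem readSet_subset {A B : S.Id} (h : CycReach X N A B) : readSet X N B ⊆ readSet X N A := by
  rintro y ⟨A', b, h', hy⟩
  exact ⟨A', b, h.trans h', hy⟩

theorem emitSet'_subset {A B : S.Id} (h : CycReach X N A B) :
    emitSet' X N B ⊆ emitSet' X N A := by
  rintro y ⟨A', h', hy⟩
  exact ⟨A', h.trans h', hy⟩

theorem CycReach.single {A B : S.Id} {L : Set (Lab S)}
    (h : (some B, L) ∈ (X.body A).calls N.reset ∅) : CycReach X N A B :=
  Relation.ReflTransGen.single ⟨L, h⟩

/-- This compares the labels still to be read from a fragment with the global set `R(A)`: the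
invariant at the call of `A` leaves all of `R(A)` undetermined, hence also what the fragment needs.
-/
theorem Within.future_subset : ∀ {Γ : List S.T} {P : Prog S Γ} {L : Set (Lab S)},
    Within X N A L P → P.future X N ⊆ readSet X N A := by
  intro Γ P
  induction P with
  | zero => exact fun _ => Set.empty_subset _
  | env E => exact fun _ => Set.empty_subset _
  | emit s e => exact fun _ => Set.empty_subset _
  | call B e =>
    rintro L h y ⟨hB, hy⟩
    refine readSet_subset (CycReach.single (L := L) (h.calls ?_)) hy
    simp [Prog.calls, hB]
  | present k s P B r ih =>
    rintro L h y (((hy | hy) | hy) | ⟨hB, hy⟩)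
    · obtain ⟨⟨b, L'⟩, hb⟩ := P.calls_nonempty (reset := N.reset) (L ∪ {.read k _ _})
      exact ⟨A, b, .refl, L', h.present.calls hb, P.subset_of_mem_calls hb (.inr hy)⟩
    · exact ih h.present hy
    · exact ⟨A, _, .refl, _, h.calls (.inr rfl), .inr hy⟩
    · exact readSet_subset (CycReach.single (h.else_mem_calls hB)) hy
  | matchs s₁ s₂ P₁ P₂ ih₁ ih₂ =>
    exact fun h => Set.union_subset (ih₁ h.matchs_left) (ih₂ h.matchs_right)
  | matchv u p P₁ P₂ ih₁ ih₂ =>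
    exact fun h => Set.union_subset (ih₁ h.matchv_left) (ih₂ h.matchv_right)
  | nu ρ t P ih => exact fun h => ih h.nu
  | par P₁ P₂ ih₁ ih₂ =>
    exact fun h => Set.union_subset (ih₁ h.par_left) (ih₂ h.par_right)

/-- A later read occurs either in the same fragment, where labels are unique, or after a call, where
the read once condition applies. -/
theorem Prog.mem_labels_or_of_mem_future {Γ : List S.T} (P : Prog S Γ) :
    ∀ (L : Set (Lab S)) {y : Lab S}, y ∈ P.future X N →
      y ∈ P.labels ∨ ∃ B L', (some B, L') ∈ P.calls N.reset L ∧ y ∈ readSet X N B := by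
  induction P with
  | zero => exact fun _ _ h => h.elim
  | env E => exact fun _ _ h => h.elim
  | emit s e => exact fun _ _ h => h.elim
  | call B e =>
    rintro L y ⟨hB, hy⟩
    exact .inr ⟨B, L, by simp [Prog.calls, hB], hy⟩
  | present k s P B r ih =>
    rintro L y (((hy | hy) | hy) | ⟨hB, hy⟩)
    · exact .inl (List.mem_cons.2 (.inl hy))
    · rcases ih (L ∪ {.read k _ _}) hy with h | ⟨B, L', h, hy⟩
      · exact .inl (List.mem_cons_of_mem _ (List.mem_append_left _ h))
      · exact .inr ⟨B, L', .inl h, hy⟩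
    · exact .inl (List.mem_cons_of_mem _ (List.mem_append_right _ (mem_flatten_ofFn.2 hy)))
    · exact .inr ⟨B, _, .inr (by simp [hB]; rfl), hy⟩
  | matchs s₁ s₂ P₁ P₂ ih₁ ih₂ =>
    rintro L y (hy | hy)
    · exact (ih₁ L hy).imp (List.mem_append_left _) fun ⟨B, L', h, hy⟩ => ⟨B, L', .inl h, hy⟩
    · exact (ih₂ L hy).imp (List.mem_append_right _) fun ⟨B, L', h, hy⟩ => ⟨B, L', .inr h, hy⟩
  | matchv u p P₁ P₂ ih₁ ih₂ =>
    rintro L y (hy | hy)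
    · exact (ih₁ L hy).imp (List.mem_append_left _) fun ⟨B, L', h, hy⟩ => ⟨B, L', .inl h, hy⟩
    · exact (ih₂ L hy).imp (List.mem_append_right _) fun ⟨B, L', h, hy⟩ => ⟨B, L', .inr h, hy⟩
  | nu ρ t P ih => exact ih
  | par P₁ P₂ ih₁ ih₂ =>
    rintro L y (hy | hy)
    · exact (ih₁ L hy).imp (List.mem_append_left _) fun ⟨B, L', h, hy⟩ => ⟨B, L', .inl h, hy⟩
    · exact (ih₂ L hy).imp (List.mem_append_right _) fun ⟨B, L', h, hy⟩ => ⟨B, L', .inr h, hy⟩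

theorem mem_labels_of_mem_edgeLabel {b : Option S.Id} {y : Lab S} (h : y ∈ edgeLabel X N A b) :
    y ∈ (X.body A).labels := by
  obtain ⟨L, hL, hy⟩ := h
  exact ((X.body A).mem_of_mem_calls hL hy).resolve_left id

theorem mem_labels_of_mem_readSet {y : Lab S} (h : y ∈ readSet X N A) : y ∈ X.labels := by
  obtain ⟨A', b, -, hy⟩ := h
  exact List.mem_flatMap.2 ⟨A', List.mem_finRange _, mem_labels_of_mem_edgeLabel hy⟩

variable (X) in
theorem Sys.body_labels_nodup (A : S.Id) : (X.body A).labels.Nodup :=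
  (List.nodup_flatMap.1 X.labels_nodup).1 A (List.mem_finRange A)

theorem Sys.label_unique {A B : S.Id} {y : Lab S} (hA : y ∈ (X.body A).labels)
    (hB : y ∈ (X.body B).labels) : A = B := by
  by_contra hne
  have h := (List.nodup_flatMap.1 X.labels_nodup).2
  have : Std.Symm (Function.onFun List.Disjoint fun A => (X.body A).labels) :=
    ⟨fun _ _ h => List.Disjoint.symm h⟩
  exact h.forall (List.mem_finRange A) (List.mem_finRange B) hne hA hB

/-- A label that is read on the way to a call of `B` is not read again after this call. -/
theorem ReadOnce.not_mem_readSet (hread : ReadOnce X N) {B : S.Id} {L : Set (Lab S)}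
    (h : (some B, L) ∈ (X.body A).calls N.reset ∅) {y : Lab S} (hy : y ∈ L) :
    y ∉ readSet X N B := by
  rintro ⟨A', b, hr, hy'⟩
  have he : y ∈ edgeLabel X N A (some B) := ⟨L, h, hy⟩
  -- A label determines the body in which it occurs, so the later edge leaves `A` as well. The path
  -- from `B` to its source closes a loop through the edge from `A` to `B`, whose label contains
  -- `y`.
  obtain rfl := Sys.label_unique (mem_labels_of_mem_edgeLabel hy') (mem_labels_of_mem_edgeLabel he)
  exact hread _ _ ⟨L, h⟩ ⟨y, he⟩ hr

section Present

variable {ρ : S.D.Reg} {t : S.T} {k : ℕ} {s : PV S.D Γ (.sig ρ t)} {P : Prog S (t :: Γ)} {B : S.Id}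
  {r : ∀ i : S.Pos B, Exp S (RLeaf S Γ) ((S.params B).get i)}

/-- This permits fixing the value of the label at the moment of the read. -/
theorem Within.read_not_mem_future (hread : ReadOnce X N)
    (h : Within X N A L (.present k s P B r)) : Lab.read k ρ t ∉ P.future X N := by
  intro hy
  rcases P.mem_labels_or_of_mem_future (L ∪ {.read k ρ t}) hy with hy | ⟨B', L', hc, hy⟩
  · have := h.labels.nodup (X.body_labels_nodup A)
    simp only [Prog.labels, List.nodup_cons, List.mem_append, not_or] at this
    exact this.1.1 hy
  · exact hread.not_mem_readSet (h.present.calls hc) (P.subset_of_mem_calls hc (.inr rfl)) hy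

/-- The lists dereferenced in the else branch are fixed at the end of the instant, and the rest of
the cycle does not consult these labels again. -/
theorem Within.argLabels_not_mem (hread : ReadOnce X N)
    (h : Within X N A L (.present k s P B r)) (hB : B ∉ N.reset) {y : Lab S}
    (hy : y ∈ argLabels r) : y ∉ readSet X N B :=
  hread.not_mem_readSet (h.else_mem_calls hB) (.inr hy)

end Present

/-! ### Calls within an instant -/

theorem Prog.IsPause.instCalls_eq {P : Prog S Γ} (h : P.IsPause) : P.instCalls = ∅ := by
  obtain ⟨ρ, t, k, B, r, rfl⟩ := h
  rfl

theorem Prog.IsPause.emitRegs_eq {P : Prog S Γ} (h : P.IsPause) : P.emitRegs = ∅ := by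
  obtain ⟨ρ, t, k, B, r, rfl⟩ := h
  rfl

theorem Ann.Valid.isPause (hann : N.Valid X) {A B : S.Id} (h : B ∈ (X.body A).instCalls)
    (hB : B ∈ N.reset) : (X.body B).IsPause :=
  (hann.reset B hB).resolve_right fun h' => h' A h

/-- The relation `≥_F` may pass through `Reset`, while the call graph stops there. But an identifier
in `Reset` that is called within an instant is a `pause`, which calls nothing within the instant; so
it could only be the last one, and this is excluded by `hC`. -/
theorem Ann.Valid.cycReach (hann : N.Valid X) {B C : S.Id} (h : GeF X B C)
    (hC : ¬ (X.body C).IsPause) : CycReach X N B C := by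
  induction h with
  | refl => exact .refl
  | tail hd hs ih =>
    rename_i C' C
    have h1 : ¬ (X.body C').IsPause := fun h => by
      rw [h.instCalls_eq] at hs
      exact hs
    have h2 : C ∉ N.reset := fun h => hC (hann.isPause hs h)
    exact (ih h1).tail ((X.body C').exists_mem_calls h2 hs ∅)

/-- `B` may cause an emission on the region `ρ` within the instant; no condition for `⊤`. -/
def Emits (X : Sys S) (ρ : WithTop S.D.Reg) (B : S.Id) : Prop :=
  ∀ ρ' : S.D.Reg, ρ = ρ' → ∃ C, GeF X B C ∧ ρ' ∈ (X.body C).emitRegs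

theorem mem_emitSet {ρ : S.D.Reg} (h : ρ ∈ emitSet' X N A) :
    (ρ : WithTop S.D.Reg) ∈ emitSet X N A := by
  rw [emitSet, if_neg (Set.nonempty_iff_ne_empty.1 ⟨ρ, h⟩)]
  exact ⟨ρ, h, rfl⟩

theorem top_mem_emitSet (h : emitSet' X N A = ∅) : (⊤ : WithTop S.D.Reg) ∈ emitSet X N A := by
  rw [emitSet, if_pos h]
  rfl

variable (X N) in
theorem emitSet_nonempty (A : S.Id) : (emitSet X N A).Nonempty := by
  by_cases h : emitSet' X N A = ∅
  · exact ⟨⊤, top_mem_emitSet h⟩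
  · obtain ⟨ρ, hρ⟩ := Set.nonempty_iff_ne_empty.2 h
    exact ⟨ρ, mem_emitSet hρ⟩

/-- Emissions that may follow within the instant are also accounted for within the cycle, because a
`pause` neither emits nor calls before the instant ends. -/
theorem Ann.Valid.emits (hann : N.Valid X) {B : S.Id} (hB : B ∈ (X.body A).instCalls)
    {ρ : S.D.Reg} (h : Emits X ρ B) : B ∉ N.reset ∧ (ρ : WithTop S.D.Reg) ∈ emitSet X N B := by
  obtain ⟨C, hC, hρ⟩ := h ρ rfl
  have h1 : ¬ (X.body C).IsPause := fun h => by
    rw [h.emitRegs_eq] at hρ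
    exact hρ
  refine ⟨fun hr => ?_, mem_emitSet ⟨C, hann.cycReach hC h1, hρ⟩⟩
  have hp := hann.isPause hB hr
  rcases Relation.ReflTransGen.cases_head hC with rfl | ⟨C', hC', -⟩
  · exact h1 hp
  · rw [hp.instCalls_eq] at hC'
    exact hC'

/-- By this, both sides of an inequality of index `0` have the same auxiliary arguments, so the
decrease takes place among the proper ones. Neither `A` nor `B` is a `pause`, since each lies on a
loop of calls within the instant. -/
theorem Ann.Valid.readSet_eq (hann : N.Valid X) {B : S.Id} (hB : B ∈ (X.body A).instCalls)
    (h : EqF X A B) : readSet X N A = readSet X N B := by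
  have hA : ¬ (X.body A).IsPause := fun h => by
    rw [h.instCalls_eq] at hB
    exact hB
  have hB' : ¬ (X.body B).IsPause := fun hp => by
    rcases Relation.ReflTransGen.cases_head h.2 with rfl | ⟨C', hC', -⟩
    · exact hA hp
    · rw [hp.instCalls_eq] at hC'
      exact hC'
  exact (readSet_subset (hann.cycReach h.2 hA)).antisymm (readSet_subset (hann.cycReach h.1 hB'))

theorem Prog.HasCall.of_instCalls {P : Prog S Γ} (h : P.instCalls.Nonempty) : P.HasCall := by
  induction P with
  | zero => exact h.elim fun _ h => h
  | env E => exact h.elim fun _ h => h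
  | emit s e => exact h.elim fun _ h => h
  | call B e => trivial
  | present k s P B r ih => trivial
  | matchs s₁ s₂ P₁ P₂ ih₁ ih₂ => exact (Set.union_nonempty.1 h).imp ih₁ ih₂
  | matchv u p P₁ P₂ ih₁ ih₂ => exact (Set.union_nonempty.1 h).imp ih₁ ih₂
  | nu ρ t P ih => exact ih h
  | par P₁ P₂ ih₁ ih₂ => exact (Set.union_nonempty.1 h).imp ih₁ ih₂

end CallGraph

/-! ## Termination orders and their ranks -/

section StatusOrder

/-- The orders on vectors of numbers given by the status; `m` exceeds the number of arguments. -/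
def StatusLt (m : ℕ) {K : ℕ} : Status → (Fin K → ℕ) → (Fin K → ℕ) → Prop
  | .lex, a, b => ∃ i, (∀ j < i, a j ≤ b j) ∧ a i < b i
  | .mset, a, b => ∑ j, m ^ a j < ∑ j, m ^ b j

theorem StatusLt.trans {m K : ℕ} {st : Status} {a b c : Fin K → ℕ} (h : StatusLt m st a b)
    (h' : StatusLt m st b c) : StatusLt m st a c := by
  cases st with
  | mset => exact Nat.lt_trans h h'
  | lex =>
    obtain ⟨i, hi, hi'⟩ := h
    obtain ⟨j, hj, hj'⟩ := h'
    rcases lt_trichotomy i j with hij | rfl | hij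
    · exact ⟨i, fun k hk => (hi k hk).trans (hj k (hk.trans hij)), hi'.trans_le (hj i hij)⟩
    · exact ⟨i, fun k hk => (hi k hk).trans (hj k hk), hi'.trans hj'⟩
    · exact ⟨j, fun k hk => (hi k (hk.trans hij)).trans (hj k hk), (hi j hij).trans_lt hj'⟩

theorem StatusLt.irrefl {m K : ℕ} {st : Status} {a : Fin K → ℕ} : ¬ StatusLt m st a a := by
  cases st with
  | mset => exact Nat.lt_irrefl _
  | lex => exact fun ⟨i, _, hi⟩ => Nat.lt_irrefl _ hi

/-- The vectors with entries at most `M`. -/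
def box (K M : ℕ) : Finset (Fin K → ℕ) := Fintype.piFinset fun _ => Finset.range (M + 1)

theorem mem_box {K M : ℕ} {a : Fin K → ℕ} : a ∈ box K M ↔ ∀ i, a i ≤ M := by
  simp [box]

theorem card_box (K M : ℕ) : (box K M).card = (M + 1) ^ K := by
  simp [box]

open Classical in
/-- The number of smaller vectors in the box. -/
noncomputable def boxRank (m : ℕ) {K : ℕ} (st : Status) (M : ℕ) (a : Fin K → ℕ) : ℕ :=
  ((box K M).filter fun w => StatusLt m st w a).card

theorem boxRank_le (m : ℕ) {K : ℕ} (st : Status) (M : ℕ) (a : Fin K → ℕ) :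
    boxRank m st M a ≤ (M + 1) ^ K := by
  classical
  exact (Finset.card_filter_le _ _).trans (card_box K M).le

/-- Only the smaller vector has to lie in the box: it is counted for `b` and not for itself. Since
the rank counts vectors, it is polynomial in `M` for both statuses, although the comparison for
`mset` goes through exponentially large sums. -/
theorem boxRank_lt {m K : ℕ} {st : Status} {M : ℕ} {a b : Fin K → ℕ} (ha : ∀ i, a i ≤ M)
    (h : StatusLt m st a b) : boxRank m st M a < boxRank m st M b := by
  classical
  refine Finset.card_lt_card (Finset.ssubset_iff_of_subset ?_ |>.2 ⟨a, ?_, ?_⟩)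
  · intro w hw
    rw [Finset.mem_filter] at hw ⊢
    exact ⟨hw.1, hw.2.trans h⟩
  · exact Finset.mem_filter.2 ⟨mem_box.2 ha, h⟩
  · exact fun h' => StatusLt.irrefl (Finset.mem_filter.1 h').2

/-- Let `z₀` be the largest of the removed elements `Z`. Every inserted `y` is smaller than `z₀`, so
the inserted powers sum to at most `|Y| * m ^ (z₀ - 1)`, which is less than `m ^ z₀` because `|Y| <
m`. -/
theorem sum_pow_lt_of_isDershowitzMannaLT {m : ℕ} {M N : Multiset ℕ}
    (h : Multiset.IsDershowitzMannaLT M N) (hm : M.card < m) :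
    (M.map fun x => m ^ x).sum < (N.map fun x => m ^ x).sum := by
  obtain ⟨X, Y, Z, hZ, rfl, rfl, hlt⟩ := h
  obtain ⟨z₀, hz₀, hmax⟩ := Z.toFinset.exists_max_image id
    (Multiset.toFinset_nonempty.2 hZ)
  rw [Multiset.mem_toFinset] at hz₀
  simp only [Multiset.map_add, Multiset.sum_add, Multiset.card_add] at hm ⊢
  refine Nat.add_lt_add_left ?_ _
  have hY : (Y.map fun x => m ^ x).sum * m ≤ Y.card * m ^ z₀ := by
    rw [← Multiset.sum_map_mul_right, ← smul_eq_mul, ← Multiset.card_map (fun x => m ^ x * m) Y]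
    refine Multiset.sum_le_card_nsmul _ _ ?_
    intro x hx
    obtain ⟨y, hy, rfl⟩ := Multiset.mem_map.1 hx
    obtain ⟨z, hz, hyz⟩ := hlt y hy
    have hz' : z ≤ z₀ := hmax z (Multiset.mem_toFinset.2 hz)
    rw [← pow_succ]
    exact Nat.pow_le_pow_right (by omega) (by omega)
  have hZ' : m ^ z₀ ≤ (Z.map fun x => m ^ x).sum :=
    Multiset.single_le_sum (fun _ _ => Nat.zero_le _) _ (Multiset.mem_map_of_mem _ hz₀)
  have hpos : 0 < m ^ z₀ := Nat.pow_pos (by omega)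
  by_contra hcon
  have h1 : m ^ z₀ * m ≤ (Y.map fun x => m ^ x).sum * m :=
    Nat.mul_le_mul_right _ (hZ'.trans (not_lt.1 hcon))
  nlinarith

/-- A vector, completed with zeros. -/
def pad {n : ℕ} (K : ℕ) (x : Fin n → ℕ) : Fin K → ℕ := fun j =>
  if h : j.1 < n then x ⟨j, h⟩ else 0

theorem sum_pow_pad {n K m : ℕ} (hn : n ≤ K) (x : Fin n → ℕ) :
    ∑ j, m ^ pad K x j = ∑ i, m ^ x i + (K - n) := by
  obtain ⟨l, rfl⟩ := Nat.exists_eq_add_of_le hn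
  rw [Fin.sum_univ_add]
  -- Each of the `K - n` added zeros contributes `m ^ 0 = 1`; the contribution is the same for two
  -- vectors of equal arity.
  simp [pad]

/-- The order on lists that underlies `VecGt`. -/
def ListGt : Status → List ℕ → List ℕ → Prop
  | .lex, a, b => ∃ (i : ℕ) (ha : i < a.length) (hb : i < b.length),
      (∀ (j : ℕ) (hj : j < i), b[j] ≤ a[j]) ∧ b[i] < a[i]
  | .mset, a, b => Multiset.IsDershowitzMannaLT (b : Multiset ℕ) (a : Multiset ℕ)

theorem VecGt.listGt {G : Type} {st : Status} {a b : G → List ℕ} (h : VecGt st a b) (σ : G) :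
    ListGt st (a σ) (b σ) := by
  cases st with
  | lex => obtain ⟨i, h⟩ := h; exact ⟨i, h σ⟩
  | mset => exact h σ

/-- A common tail of two vectors does not matter for their comparison. -/
theorem ListGt.statusLt {st : Status} {n n' K m : ℕ} (hnn : n = n') {x : Fin n → ℕ}
    {y z : Fin n' → ℕ} {l : List ℕ} (h : ListGt st (List.ofFn x ++ l) (List.ofFn y ++ l))
    (hzy : z ≤ y) (hn : n ≤ K) (hm : n + l.length < m) : StatusLt m st (pad K z) (pad K x) := by
  subst hnn
  cases st with
  | mset =>
    have h' := sum_pow_lt_of_isDershowitzMannaLT (m := m) h (by simpa using hm)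
    simp only [Multiset.map_coe, List.map_append, Multiset.sum_coe, List.sum_append, List.map_ofFn,
      List.sum_ofFn, Function.comp_apply] at h'
    have h1 : ∑ i, m ^ z i ≤ ∑ i, m ^ y i :=
      Finset.sum_le_sum fun i _ => Nat.pow_le_pow_right (by omega) (hzy i)
    simp only [StatusLt, sum_pow_pad hn]
    omega
  | lex =>
    obtain ⟨i, ha, hb, hj, hi⟩ := h
    by_cases hin : i < n
    · refine ⟨⟨i, hin.trans_le hn⟩, fun j hji => ?_, ?_⟩
      · have hjn : j.1 < n := lt_trans hji hin
        have := hj j hji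
        simp only [List.getElem_append, List.length_ofFn, hjn, dite_true, List.getElem_ofFn] at this
        simp only [pad, hjn, dite_true]
        exact (hzy _).trans this
      · simp only [List.getElem_append, List.length_ofFn, hin, dite_true, List.getElem_ofFn] at hi
        simp only [pad, hin, dite_true]
        exact (hzy _).trans_lt hi
    -- A strict decrease cannot occur in the common tail.
    · simp [List.getElem_append, hin] at hi

end StatusOrder

/-! ## Potentials -/

section Potential

variable {S : Sgn}

open Classical in
/-- The number of identifiers that may be called within the instant. -/
noncomputable def level (X : Sys S) (A : S.Id) : ℕ := (Finset.univ.filter fun C => GeF X A C).card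

theorem level_le (X : Sys S) (A : S.Id) : level X A ≤ S.N := by
  classical
  exact (Finset.card_filter_le _ _).trans (by simp)

theorem level_mono {X : Sys S} {A B : S.Id} (h : GeF X A B) : level X B ≤ level X A := by
  classical
  refine Finset.card_le_card fun C hC => ?_
  rw [Finset.mem_filter] at hC ⊢
  exact ⟨hC.1, h.trans hC.2⟩

theorem level_lt {X : Sys S} {A B : S.Id} (h : GtF X A B) : level X B < level X A := by
  classical
  refine Finset.card_lt_card (Finset.ssubset_iff_of_subset ?_ |>.2 ⟨A, ?_, ?_⟩)
  · intro C hC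
    rw [Finset.mem_filter] at hC ⊢
    exact ⟨hC.1, h.1.trans hC.2⟩
  · exact Finset.mem_filter.2 ⟨Finset.mem_univ _, .refl⟩
  · exact fun h' => h.2 ⟨h.1, (Finset.mem_filter.1 h').2⟩

/-- A bound of the number of calls that may follow a call of `A` within an instant. -/
noncomputable def callPot (X : Sys S) (N : Ann S) (m M : ℕ) {K : ℕ} (A : S.Id) (w : Fin K → ℕ) :
    ℕ :=
  level X A * ((M + 1) ^ K + 1) + boxRank m (N.status A) M w

theorem callPot_le (X : Sys S) (N : Ann S) (m M : ℕ) {K : ℕ} (A : S.Id) (w : Fin K → ℕ) :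
    callPot X N m M A w ≤ (S.N + 1) * ((M + 1) ^ K + 1) := by
  have h1 := level_le X A
  have h2 := boxRank_le m (N.status A) M w
  have h3 := Nat.mul_le_mul_right ((M + 1) ^ K + 1) h1
  rw [callPot, add_mul]
  omega

/-- `callPot` encodes a lexicographic pair: the factor `(M + 1) ^ K + 1` exceeds every rank, so a
drop of the level outweighs any change of the arguments. At equal level the rank drops. -/
theorem callPot_lt {X : Sys S} {N : Ann S} {m M K : ℕ} {A B : S.Id} {w w' : Fin K → ℕ}
    (hAB : GeF X A B) (h : EqF X A B → N.status A = N.status B ∧ StatusLt m (N.status A) w' w)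
    (hw : ∀ i, w' i ≤ M) : callPot X N m M B w' < callPot X N m M A w := by
  by_cases he : EqF X A B
  · obtain ⟨h1, h2⟩ := h he
    have h3 := boxRank_lt hw h2
    have h4 := Nat.mul_le_mul_right ((M + 1) ^ K + 1) (level_mono hAB)
    rw [callPot, callPot, ← h1]
    omega
  · have h1 := level_lt ⟨hAB, he⟩
    have h2 := boxRank_le m (N.status B) M w'
    have h3 := Nat.mul_le_mul_right ((M + 1) ^ K + 1) (Nat.succ_le_of_lt h1)
    rw [Nat.succ_mul] at h3
    rw [callPot, callPot]
    omega

open Classical in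
/-- The weight of one step: steps are counted by the index `⊤`. -/
noncomputable def tick (ρ : WithTop S.D.Reg) : ℕ := if ρ = ⊤ then 1 else 0

open Classical in
/-- The number of possible steps of the program, up to calls, for the index `⊤`; the number of
possible emissions on `ρ` for a region `ρ`. -/
noncomputable def Prog.weight (ρ : WithTop S.D.Reg) : ∀ {Γ : List S.T}, Prog S Γ → ℕ
  | _, .zero => 0
  | _, .call _ _ => tick ρ
  | _, .env _ => 0
  | _, .emit (ρ := ρ') _ _ => if ρ = ρ' then 1 else 0
  | _, .present _ _ P _ _ => tick ρ + P.weight ρ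
  | _, .matchs _ _ P₁ P₂ => tick ρ + (P₁.weight ρ + P₂.weight ρ)
  | _, .matchv _ _ P₁ P₂ => tick ρ + (P₁.weight ρ + P₂.weight ρ)
  | _, .nu _ _ P => P.weight ρ
  | _, .par P₁ P₂ => P₁.weight ρ + P₂.weight ρ

theorem Prog.weight_eq_zero {ρ : S.D.Reg} {Γ : List S.T} (P : Prog S Γ) (h : ρ ∉ P.emitRegs) :
    P.weight ρ = 0 := by
  induction P with
  | zero => rfl
  | env E => rfl
  | call B e => simp [Prog.weight, tick]
  | emit s e =>
    rw [Prog.weight, if_neg fun h' => h (WithTop.coe_injective h')]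
  | present k s P B r ih => simp [Prog.weight, tick, ih h]
  | matchs s₁ s₂ P₁ P₂ ih₁ ih₂ =>
    simp [Prog.weight, tick, ih₁ fun h' => h (.inl h'), ih₂ fun h' => h (.inr h')]
  | matchv u p P₁ P₂ ih₁ ih₂ =>
    simp [Prog.weight, tick, ih₁ fun h' => h (.inl h'), ih₂ fun h' => h (.inr h')]
  | nu ρ t P ih => exact ih h
  | par P₁ P₂ ih₁ ih₂ =>
    simp [Prog.weight, ih₁ fun h' => h (.inl h'), ih₂ fun h' => h (.inr h')]

/-- The number of all subprograms. -/
def Prog.nodes : ∀ {Γ : List S.T}, Prog S Γ → ℕ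
  | _, .zero => 1
  | _, .call _ _ => 1
  | _, .env _ => 1
  | _, .emit _ _ => 1
  | _, .present _ _ P _ _ => 1 + P.nodes
  | _, .matchs _ _ P₁ P₂ => 1 + (P₁.nodes + P₂.nodes)
  | _, .matchv _ _ P₁ P₂ => 1 + (P₁.nodes + P₂.nodes)
  | _, .nu _ _ P => 1 + P.nodes
  | _, .par P₁ P₂ => 1 + (P₁.nodes + P₂.nodes)

theorem tick_le (ρ : WithTop S.D.Reg) : tick ρ ≤ 1 := by
  unfold tick
  split_ifs <;> simp

theorem Prog.weight_le_nodes (ρ : WithTop S.D.Reg) {Γ : List S.T} (P : Prog S Γ) :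
    P.weight ρ ≤ P.nodes := by
  have := tick_le ρ
  induction P with
  | emit s e => simp only [Prog.weight, Prog.nodes]; split_ifs <;> simp
  | _ => simp only [Prog.weight, Prog.nodes]; omega

/-- The program contains a call, within the instant, that may cause an emission on `ρ`. -/
def Prog.CanCall (X : Sys S) (ρ : WithTop S.D.Reg) {Γ : List S.T} (P : Prog S Γ) : Prop :=
  ∃ B ∈ P.instCalls, Emits X ρ B

open Classical in
/-- The potential of a subprogram, where a call has the potential `c`. -/
noncomputable def Prog.pot (X : Sys S) (ρ : WithTop S.D.Reg) (c : ℕ) {Γ : List S.T}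
    (P : Prog S Γ) : ℕ :=
  (if P.CanCall X ρ then c else 0) + P.weight ρ

theorem Prog.pot_le_of_subset {X : Sys S} {ρ : WithTop S.D.Reg} {c a : ℕ} {Γ Γ' : List S.T}
    {P : Prog S Γ} {P' : Prog S Γ'} (h : P'.instCalls ⊆ P.instCalls)
    (hw : P'.weight ρ + a ≤ P.weight ρ) : P'.pot X ρ c + a ≤ P.pot X ρ c := by
  have h1 : P'.CanCall X ρ → P.CanCall X ρ := fun ⟨B, hB, he⟩ => ⟨B, h hB, he⟩
  unfold Prog.pot
  split_ifs with h2 h3 h3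
  · omega
  · exact absurd (h1 h2) h3
  · omega
  · omega

/-- By finite control at most one side contains a call, so the potential `c` is not duplicated. -/
theorem Prog.pot_par {X : Sys S} {ρ : WithTop S.D.Reg} {c : ℕ} {Γ : List S.T} {P₁ P₂ : Prog S Γ}
    (h : (Prog.par P₁ P₂).FiniteControl) :
    P₁.pot X ρ c + P₂.pot X ρ c ≤ (Prog.par P₁ P₂).pot X ρ c := by
  have h' : ¬ (P₁.CanCall X ρ ∧ P₂.CanCall X ρ) := fun ⟨⟨B, hB, _⟩, ⟨B', hB', _⟩⟩ =>
    h.2.2 ⟨.of_instCalls ⟨B, hB⟩, .of_instCalls ⟨B', hB'⟩⟩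
  have h1 : P₁.CanCall X ρ → (Prog.par P₁ P₂).CanCall X ρ := fun ⟨B, hB, he⟩ => ⟨B, .inl hB, he⟩
  have h2 : P₂.CanCall X ρ → (Prog.par P₁ P₂).CanCall X ρ := fun ⟨B, hB, he⟩ => ⟨B, .inr hB, he⟩
  unfold Prog.pot
  simp only [Prog.weight]
  split_ifs <;> first | omega | tauto

/-- A body without emissions on `ρ` within the instant has no potential. -/
theorem Prog.pot_body_eq_zero {X : Sys S} {ρ : S.D.Reg} {c : ℕ} {B : S.Id}
    (h : ¬ Emits X ρ B) : (X.body B).pot X ρ c = 0 := by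
  have h1 : ρ ∉ (X.body B).emitRegs := fun h' => h fun ρ' hρ => by
    obtain rfl := WithTop.coe_injective hρ
    exact ⟨B, .refl, h'⟩
  rw [Prog.pot, Prog.weight_eq_zero _ h1, if_neg]
  rintro ⟨C, hC, he⟩
  refine h fun ρ' hρ => ?_
  obtain ⟨C', h2, h3⟩ := he ρ' hρ
  exact ⟨C', .head hC h2, h3⟩

end Potential

/-! ## The invariant of threads -/

section Invariant

variable {S : Sgn} {X : Sys S} {N : Ann S}

/-- With values of size at most `V`, each expression evaluated within the instant costs less
than `c`. -/
def Prog.CostLt (q : Assign X N) (V c : ℕ) : ∀ {Γ : List S.T}, Prog S Γ → Prop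
  | _, .zero => True
  | Γ, .call _ e => ∀ f : Sub S.D Γ [], (∀ ⦃t⦄ (x : PV S.D Γ t), q.qv (f x) ≤ V) →
      1 + ∑ i, q.closedCost ((e i).bind fun _ x => (f x).toExp) ≤ c
  | _, .env _ => True
  | Γ, .emit _ e => ∀ f : Sub S.D Γ [], (∀ ⦃t⦄ (x : PV S.D Γ t), q.qv (f x) ≤ V) →
      1 + q.closedCost (e.bind fun _ x => (f x).toExp) ≤ c
  | _, .present _ _ P _ _ => P.CostLt q V c
  | _, .matchs _ _ P₁ P₂ => P₁.CostLt q V c ∧ P₂.CostLt q V c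
  | _, .matchv _ _ P₁ P₂ => P₁.CostLt q V c ∧ P₂.CostLt q V c
  | _, .nu _ _ P => P.CostLt q V c
  | _, .par P₁ P₂ => P₁.CostLt q V c ∧ P₂.CostLt q V c

/-- Values for the labels. -/
abbrev LabVal (S : Sgn) : Type := ∀ y : Lab S, Val S.D y.ty

open Classical in
/-- The auxiliary arguments of `A⁺` that remain in `A⁺(…)_{↓ρ}`. -/
noncomputable def Assign.auxBelow (q : Assign X N) (A : S.Id) (ρ : WithTop S.D.Reg) (l : LabVal S) :
    {y // y ∈ readSet X N A} → ℕ :=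
  fun y => if y.1.reg ∈ below ρ then q.qv (l y.1) else 0

open Classical in
/-- The proper arguments of `A⁺` that remain in `A⁺(…)_{I_A}`. -/
noncomputable def properIn (N : Ann S) (A : S.Id) (x : S.Pos A → ℕ) : S.Pos A → ℕ :=
  fun i => if i ∈ N.mask A then x i else 0

variable (X N) in
/-- The numerical bounds for a computation: `reset` for the arguments at the start of a cycle,
`arg ρ` for the arguments of identifiers that emit on the region `ρ`, `emit ρ` for the values
emitted on `ρ`, `read ρ` for the values and lists of values read on `ρ`, `val` for all values,
`cost` for the time of a step. -/
structure Bounds (q : Assign X N) where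
  reset : ℕ
  arg : WithTop S.D.Reg → ℕ
  emit : S.D.Reg → ℕ
  read : S.D.Reg → ℕ
  val : ℕ
  cost : ℕ
  size : ℕ
  arity : ℕ
  base : ℕ
  arity_le : ∀ A, (S.params A).length ≤ arity
  base_gt : arity + X.labels.length < base
  nodes_le : ∀ A, (X.body A).nodes ≤ size
  start : ∀ A ρ (x : S.Pos A → ℕ) (l : LabVal S), (∀ i, x i ≤ reset) →
    (∀ y ∈ X.labels, q.qv (l y) ≤ read y.reg) → q.qA A x (q.auxBelow A ρ l) ≤ arg ρ
  top : ∀ A (ρ : S.D.Reg) (x : S.Pos A → ℕ) (l : LabVal S), (∀ i, x i ≤ arg ρ) →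
    (∀ y ∈ X.labels, q.qv (l y) ≤ read y.reg) → q.qA A x (q.auxBelow A ⊤ l) ≤ arg ⊤
  arg_le_top : ∀ ρ, arg ρ ≤ arg ⊤
  top_le_val : arg ⊤ ≤ val
  arg_le_emit : ∀ ρ : S.D.Reg, arg ρ ≤ emit ρ
  emit_le_read : ∀ ρ, emit ρ ≤ read ρ
  read_le_val : ∀ ρ : S.D.Reg, read ρ ≤ val
  default : ∃ l : LabVal S, ∀ y ∈ X.labels, q.qv (l y) ≤ read y.reg
  costLt : ∀ A, (X.body A).CostLt q val cost
  valCost : ∀ A (v : ∀ i : S.Pos A, Val S.D ((S.params A).get i)), (∀ i, q.qv (v i) ≤ val) →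
    1 + ∑ i, q.closedCost (v i).toExp ≤ cost

variable {q : Assign X N} (bd : Bounds X N q)

/-- The vector of the values of the arguments of a call. -/
abbrev Args (S : Sgn) (A : S.Id) : Type := ∀ i : S.Pos A, Val S.D ((S.params A).get i)

/-- The bounds that hold during a cycle for the arguments `v` of the current identifier `A`. The
values of the labels in `F` are not determined yet. -/
structure CycleInv (A : S.Id) (v : Args S A) (l : LabVal S) (F : Set (Lab S)) : Prop where
  reset : q.qA A (properIn N A fun i => q.qv (v i)) (fun _ => 0) ≤ bd.reset
  region : ∀ ρ ∈ emitSet X N A, ∀ l' : LabVal S, (∀ y ∉ F, l' y = l y) →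
    (∀ y ∈ X.labels, q.qv (l' y) ≤ bd.read y.reg) →
    q.qA A (fun i => q.qv (v i)) (q.auxBelow A ρ l') ≤ bd.arg ρ
  lab_le : ∀ y ∈ X.labels, q.qv (l y) ≤ bd.read y.reg

variable {bd}

/-- The clause `region` ranges over all admissible values of the labels in `F`; fixing some of them
only specializes it. -/
theorem CycleInv.update {A : S.Id} {v : Args S A} {l l' : LabVal S} {F F' : Set (Lab S)}
    (h : CycleInv bd A v l F) (hF : F' ⊆ F) (hl : ∀ y ∉ F, l' y = l y)
    (hb : ∀ y ∈ X.labels, q.qv (l' y) ≤ bd.read y.reg) : CycleInv bd A v l' F' :=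
  ⟨h.reset, fun ρ hρ l'' h'' hb' =>
    h.region ρ hρ l'' (fun y hy => (h'' y fun hy' => hy (hF hy')).trans (hl y hy)) hb', hb⟩

theorem CycleInv.mono {A : S.Id} {v : Args S A} {l : LabVal S} {F F' : Set (Lab S)}
    (h : CycleInv bd A v l F) (hF : F' ⊆ F) : CycleInv bd A v l F' :=
  h.update hF (fun _ _ => rfl) h.lab_le

theorem Assign.Valid.arg_le (hq : q.Valid) {A : S.Id} (v : Args S A) (ρ : WithTop S.D.Reg)
    (l : LabVal S) (i : S.Pos A) :
    q.qv (v i) ≤ q.qA A (fun i => q.qv (v i)) (q.auxBelow A ρ l) := by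
  refine (hq.subA A _ _ (fun i => .inr ⟨v i, rfl⟩) fun y => ?_).1 i
  unfold Assign.auxBelow
  split_ifs
  · exact .inr ⟨_, rfl⟩
  · exact .inl rfl

theorem CycleInv.arg_le (hq : q.Valid) {A : S.Id} {v : Args S A} {l : LabVal S} {F : Set (Lab S)}
    (h : CycleInv bd A v l F) {ρ : WithTop S.D.Reg} (hρ : ρ ∈ emitSet X N A) (i : S.Pos A) :
    q.qv (v i) ≤ bd.arg ρ :=
  (hq.arg_le v ρ l i).trans (h.region ρ hρ l (fun _ _ => rfl) h.lab_le)

theorem CycleInv.arg_le_top (hq : q.Valid) {A : S.Id} {v : Args S A} {l : LabVal S}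
    {F : Set (Lab S)} (h : CycleInv bd A v l F) (i : S.Pos A) : q.qv (v i) ≤ bd.arg ⊤ := by
  obtain ⟨ρ, hρ⟩ := emitSet_nonempty X N A
  exact (h.arg_le hq hρ i).trans (bd.arg_le_top ρ)

/-- With all arguments below `reset`, the field `Bounds.start` gives the bound for every region and
every admissible choice of labels, so nothing has to be known about the past. -/
theorem CycleInv.start {A : S.Id} {v : Args S A}
    (h : q.qA A (properIn N A fun i => q.qv (v i)) (fun _ => 0) ≤ bd.reset)
    (hv : ∀ i, q.qv (v i) ≤ bd.reset) (F : Set (Lab S)) : ∃ l, CycleInv bd A v l F := by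
  obtain ⟨l, hl⟩ := bd.default
  exact ⟨l, h, fun ρ _ l' _ hl' => bd.start A ρ _ l' hv hl', hl⟩

/-- The bounds are preserved by calls, within or at the end of the instant. The interpretations
`x l` of the arguments of the call may depend on the labels. -/
theorem CycleInv.next (hq : q.Valid) (hann : N.Valid X) {A B : S.Id} {v : Args S A}
    {l l' : LabVal S}
    {F : Set (Lab S)} (h : CycleInv bd A v l F) (hreach : B ∉ N.reset → CycReach X N A B)
    (hF : B ∉ N.reset → readSet X N B ⊆ F) (hl : ∀ y ∉ F, l' y = l y)
    (hb : ∀ y ∈ X.labels, q.qv (l' y) ≤ bd.read y.reg) (v' : Args S B)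
    (x : LabVal S → S.Pos B → ℕ)
    (hx : ∀ l'' : LabVal S, (∀ y ∉ readSet X N B, l'' y = l' y) → B ∉ N.reset →
      ∀ i, q.qv (v' i) ≤ x l'' i)
    (hx' : ∀ i, q.qv (v' i) ≤ x l' i)
    (h1 : q.qA B (properIn N B (x l')) (fun _ => 0) ≤
      q.qA A (properIn N A fun i => q.qv (v i)) (fun _ => 0))
    (h2 : B ∉ N.reset → ∀ ρ ∈ emitSet X N B, ∀ l'' : LabVal S, (∀ y ∉ F, l'' y = l y) →
      q.qA B (x l'') (q.auxBelow B ρ l'') ≤ q.qA A (fun i => q.qv (v i)) (q.auxBelow A ρ l'')) :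
    ∃ l₀, CycleInv bd B v' l₀ (readSet X N B) := by
  -- The inequality of index `1` propagates the bound `reset`, independently of the labels.
  have hr : q.qA B (properIn N B fun i => q.qv (v' i)) (fun _ => 0) ≤ bd.reset := by
    refine (hq.monoA B _ _ _ _ (fun i => ?_) le_rfl).trans (h1.trans h.reset)
    unfold properIn
    split_ifs
    · exact hx' i
    · exact le_rfl
  by_cases hB : B ∈ N.reset
  · refine CycleInv.start hr (fun i => le_trans ?_ hr) _
    -- At a reset the mask is everything, so each argument is bounded by the whole formula, and a
    -- new cycle can start.
    have := (hq.subA B (properIn N B fun i => q.qv (v' i)) (fun _ => 0) (fun i => ?_)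
      fun _ => .inl rfl).1 i
    · rwa [properIn, if_pos (by rw [hann.mask B hB]; trivial)] at this
    · unfold properIn
      split_ifs
      · exact .inr ⟨_, rfl⟩
      · exact .inl rfl
  · refine ⟨l', hr, fun ρ hρ l'' hl'' hb'' => ?_, hb⟩
    have hl2 : ∀ y ∉ F, l'' y = l y := fun y hy =>
      (hl'' y fun hy' => hy (hF hB hy')).trans (hl y hy)
    refine (hq.monoA B _ _ _ _ (hx l'' hl'' hB) le_rfl).trans ((h2 hB ρ hρ l'' hl2).trans ?_)
    -- If `B` can still emit, then so can `A`, on the same region, and the bound is inherited. If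
    -- not, the bound for `⊤` is needed. When `A` can still emit, only bounds for regions are
    -- available, and `Bounds.top` converts one of them. This happens at most once per cycle, as the
    -- set of possible emissions shrinks along it; so the extra composition of polynomials is
    -- harmless.
    by_cases he : emitSet' X N B = ∅
    · have hρ' : ρ = ⊤ := by simpa [emitSet, he] using hρ
      subst hρ'
      by_cases he' : emitSet' X N A = ∅
      · exact h.region ⊤ (top_mem_emitSet he') l'' hl2 hb''
      · obtain ⟨ρ, hρ⟩ := Set.nonempty_iff_ne_empty.2 he'
        exact bd.top A ρ _ l'' (fun i => h.arg_le hq (mem_emitSet hρ) i) hb''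
    · rw [emitSet, if_neg he] at hρ
      obtain ⟨ρ', hρ', rfl⟩ := hρ
      exact h.region ρ' (mem_emitSet (emitSet'_subset (hreach hB) hρ')) l'' hl2 hb''

/-! ### Fragments of bodies -/

/-- The label that a symbolic variable stands for, if any. -/
def SV.labs {Δ : List S.T} : ∀ ⦃t : S.T⦄, SV S Δ t → Set (Lab S)
  | _, .name _ _ _ => ∅
  | _, .bv _ => ∅
  | _, .lab y => {y}

theorem SV.labs_weaken {Δ : List S.T} (Ψ : List S.T) {t : S.T} (w : SV S Δ t) :
    (w.weaken Ψ).labs = w.labs := by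
  cases w <;> rfl

theorem GSub.app_congr {Δ : List S.T} (σ : GSub S Δ) {l : LabVal S} {t : S.T} (w : SV S Δ t)
    (h : ∀ y ∈ w.labs, l y = σ.lab y) : GSub.app ⟨σ.bv, l⟩ w = σ.app w := by
  cases w with
  | name => rfl
  | bv => rfl
  | lab y => exact h y rfl

/-- The substitution for the variables of a fragment; names are erased. -/
def fragSub {Γ Δ : List S.T} (θ : ∀ ⦃t⦄, Mem Γ t → SV S Δ t) (σ : GSub S Δ) : Sub S.D Γ []
  | _, .name ρ t _ => .var (.name ρ t 0)
  | _, .bv x => σ.app (θ x)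

variable (bd) in
/-- The invariant of a fragment `P` of the body of `A`, called with the arguments `v`, that has
been reached with the values `σ`. -/
structure Frag {Γ Δ : List S.T} (A : S.Id) (v : Args S A) (P : Prog S Γ)
    (θ : ∀ ⦃t⦄, Mem Γ t → SV S Δ t) (h : Hat S A Δ) (σ : GSub S Δ) : Prop where
  within : ∃ L, Within X N A L P
  sat : ∀ i, ∀ c ∈ ineqs X N i P θ h, q.Sat c
  -- The symbolic arguments keep the numbers of the actual ones under every choice of the labels not
  -- read yet. This allows an inequality to be used before those labels have values.
  proper : ∀ l : LabVal S, (∀ y ∉ P.future X N, l y = σ.lab y) →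
    ∀ i, q.qσ ⟨σ.bv, l⟩ (h.proper i) = q.qv (v i)
  aux : ∀ l : LabVal S, (∀ y ∉ P.future X N, l y = σ.lab y) →
    ∀ y, q.qσ ⟨σ.bv, l⟩ (h.aux y) = q.qv (l y)
  -- A variable in scope stands only for labels that have already been read, so its value is stable.
  fresh : ∀ ⦃t⦄ (x : Mem Γ t), ∀ y ∈ (θ x).labs, y ∉ P.future X N
  cycle : CycleInv bd A v σ.lab (P.future X N)
  val_le : ∀ ⦃t⦄ (x : Mem Γ t), q.qv (σ.app (θ x)) ≤ bd.val
  cost : P.CostLt q bd.val bd.cost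

/-- Extension of a ground substitution. -/
def GSub.ext {Δ : List S.T} (Ψ : List S.T) (τ : ∀ ⦃t⦄, Mem Ψ t → Val S.D t) (σ : GSub S Δ) :
    GSub S (Ψ ++ Δ) where
  bv _ x := match x.split Ψ with
    | .inl y => τ y
    | .inr y => σ.bv y
  lab := σ.lab

theorem GSub.ext_left {Δ : List S.T} (Ψ : List S.T) (τ : ∀ ⦃t⦄, Mem Ψ t → Val S.D t)
    (σ : GSub S Δ) {t : S.T} (x : Mem Ψ t) : (σ.ext Ψ τ).bv (x.left Δ) = τ x := by
  simp only [GSub.ext, Mem.split_left]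

theorem GSub.ext_weaken {Δ : List S.T} (Ψ : List S.T) (τ : ∀ ⦃t⦄, Mem Ψ t → Val S.D t)
    (σ : GSub S Δ) {t : S.T} (w : SV S Δ t) : (σ.ext Ψ τ).app (w.weaken Ψ) = σ.app w := by
  cases w with
  | name => rfl
  | lab => rfl
  | bv x => simp only [SV.weaken, GSub.app, GSub.ext, Mem.split_right]

theorem GSub.ext_extSym {Γ Δ : List S.T} (Ψ : List S.T) (τ : ∀ ⦃t⦄, Mem Ψ t → Val S.D t)
    (σ : GSub S Δ) (θ : ∀ ⦃t⦄, Mem Γ t → SV S Δ t) {t : S.T} (x : Mem (Ψ ++ Γ) t) :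
    (∃ y, x = y.left Γ ∧ extSym Ψ θ x = .bv (y.left Δ) ∧ (σ.ext Ψ τ).app (extSym Ψ θ x) = τ y) ∨
    ∃ y, x = y.right Ψ ∧ extSym Ψ θ x = (θ y).weaken Ψ ∧
      (σ.ext Ψ τ).app (extSym Ψ θ x) = σ.app (θ y) := by
  rcases Mem.left_or_right Ψ x with ⟨y, rfl⟩ | ⟨y, rfl⟩
  · have h : extSym Ψ θ (y.left Γ) = .bv (y.left Δ) := by simp only [extSym, Mem.split_left]
    exact .inl ⟨y, rfl, h, by rw [h]; exact σ.ext_left Ψ τ y⟩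
  · have h : extSym Ψ θ (y.right Ψ) = (θ y).weaken Ψ := by simp only [extSym, Mem.split_right]
    exact .inr ⟨y, rfl, h, by rw [h]; exact σ.ext_weaken Ψ τ (θ y)⟩

theorem Assign.qσ_bind {V : S.T → Type} {Δ : List S.T} (σ : GSub S Δ) {t : S.T} (e : Exp S V t)
    (f : ∀ ⦃t⦄, V t → Exp S (SV S Δ) t) :
    q.qσ σ (e.bind f) = q.qe (fun _ z => q.qσ σ (f z)) e :=
  q.qe_bind _ e f

theorem Assign.qσ_weaken {Δ : List S.T} (Ψ : List S.T) (τ : ∀ ⦃t⦄, Mem Ψ t → Val S.D t)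
    (σ : GSub S Δ) {t : S.T} (e : Exp S (SV S Δ) t) :
    q.qσ (σ.ext Ψ τ) (e.bind fun _ x => .var (x.weaken Ψ)) = q.qσ σ e := by
  rw [Assign.qσ_bind, Assign.qσ]
  congr 1
  funext t w
  exact congrArg _ (σ.ext_weaken Ψ τ w)

/-! ### From a fragment of a body to its subprograms. -/

section FragLemmas

variable {Γ Δ : List S.T} {A : S.Id} {v : Args S A} {θ : ∀ ⦃t⦄, Mem Γ t → SV S Δ t} {h : Hat S A Δ}
  {σ : GSub S Δ}

theorem Frag.qv_fragSub_le {P : Prog S Γ} (hf : Frag bd A v P θ h σ) {t : S.T}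
    (x : PV S.D Γ t) : q.qv (fragSub θ σ x) ≤ bd.val := by
  cases x with
  | name => exact Nat.zero_le _
  | bv x => exact hf.val_le x

/-- A subprogram in the same context. -/
theorem Frag.sub {P P' : Prog S Γ} (hf : Frag bd A v P θ h σ)
    (hw : ∀ L, Within X N A L P → Within X N A L P')
    (hs : ∀ i, ineqs X N i P' θ h ⊆ ineqs X N i P θ h)
    (hF : P'.future X N ⊆ P.future X N)
    (hc : P.CostLt q bd.val bd.cost → P'.CostLt q bd.val bd.cost) : Frag bd A v P' θ h σ :=
  ⟨hf.within.imp hw, fun i c hc => hf.sat i c (hs i hc),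
    fun l hl => hf.proper l fun y hy => hl y fun hy' => hy (hF hy'),
    fun l hl => hf.aux l fun y hy => hl y fun hy' => hy (hF hy'),
    fun _ x y hy hy' => hf.fresh x y hy (hF hy'), hf.cycle.mono hF, hf.val_le, hc hf.cost⟩

theorem Frag.par_left {P₁ P₂ : Prog S Γ} (hf : Frag bd A v (.par P₁ P₂) θ h σ) :
    Frag bd A v P₁ θ h σ :=
  hf.sub (fun _ => Within.par_left)
    (fun i => by rw [ineqs]; exact Set.subset_union_left) Set.subset_union_left And.left

theorem Frag.par_right {P₁ P₂ : Prog S Γ} (hf : Frag bd A v (.par P₁ P₂) θ h σ) :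
    Frag bd A v P₂ θ h σ :=
  hf.sub (fun _ => Within.par_right)
    (fun i => by rw [ineqs]; exact Set.subset_union_right) Set.subset_union_right And.right

theorem Frag.matchs_left {ρ : S.D.Reg} {t : S.T} {s₁ s₂ : PV S.D Γ (.sig ρ t)} {P₁ P₂ : Prog S Γ}
    (hf : Frag bd A v (.matchs s₁ s₂ P₁ P₂) θ h σ) : Frag bd A v P₁ θ h σ :=
  hf.sub (fun _ => Within.matchs_left)
    (fun i => by rw [ineqs]; exact Set.subset_union_left) Set.subset_union_left And.left

theorem Frag.matchs_right {ρ : S.D.Reg} {t : S.T} {s₁ s₂ : PV S.D Γ (.sig ρ t)} {P₁ P₂ : Prog S Γ}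
    (hf : Frag bd A v (.matchs s₁ s₂ P₁ P₂) θ h σ) : Frag bd A v P₂ θ h σ :=
  hf.sub (fun _ => Within.matchs_right)
    (fun i => by rw [ineqs]; exact Set.subset_union_right) Set.subset_union_right And.right

theorem Frag.matchv_right {t : S.T} {u : CTm S.D (PV S.D Γ) t} {p : Pattern S.D t}
    {P₁ : Prog S (p.vars ++ Γ)} {P₂ : Prog S Γ} (hf : Frag bd A v (.matchv u p P₁ P₂) θ h σ) :
    Frag bd A v P₂ θ h σ :=
  hf.sub (fun _ => Within.matchv_right)
    (fun i => by cases u <;> rw [ineqs] <;> exact Set.subset_union_right)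
    Set.subset_union_right And.right

theorem Assign.qσ_patSub {t : S.T} (x : SV S Δ t) (p : Pattern S.D t) (σ : GSub S Δ)
    (τ : ∀ ⦃u⦄, Mem p.vars u → Val S.D u) (hτ : p.toCTm.bind τ = σ.app x) {u : S.T}
    (w : SV S Δ u) : q.qσ (σ.ext p.vars τ) (patSub x p w) = q.qv (σ.app w) := by
  unfold patSub
  split_ifs with hx
  · cases hx
    simp only [Assign.qσ_bind]
    rw [← hτ, Assign.qv_bind]
    congr 1
    funext t z
    exact congrArg _ (σ.ext_left p.vars τ z)
  · exact congrArg _ (σ.ext_weaken p.vars τ w)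

/-- Refining `x` to the pattern in the symbolic arguments changes no number, because the value of
`x` is the instance of `p` under `τ`. This stays true for later choices of labels by `fresh`. -/
theorem Frag.matchv_left {t : S.T} {x : Mem Γ t} {p : Pattern S.D t}
    {P₁ : Prog S (p.vars ++ Γ)} {P₂ : Prog S Γ}
    (hf : Frag bd A v (.matchv (.var (.bv x)) p P₁ P₂) θ h σ)
    (τ : ∀ ⦃u⦄, Mem p.vars u → Val S.D u) (hτ : p.toCTm.bind τ = σ.app (θ x)) :
    Frag bd A v P₁ (extSym p.vars θ) (h.bind (patSub (θ x) p)) (σ.ext p.vars τ) := by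
  have hF : P₁.future X N ⊆ (Prog.matchv (.var (.bv x)) p P₁ P₂).future X N :=
    Set.subset_union_left
  obtain ⟨L, hw⟩ := hf.within
  have key : ∀ l : LabVal S, (∀ y ∉ P₁.future X N, l y = σ.lab y) → ∀ (u : S.T)
      (e : Exp S (SV S Δ) u), q.qσ ⟨(σ.ext p.vars τ).bv, l⟩ (e.bind (patSub (θ x) p)) =
        q.qσ ⟨σ.bv, l⟩ e := by
    intro l hl u e
    have hx : p.toCTm.bind τ = GSub.app ⟨σ.bv, l⟩ (θ x) := by
      rw [hτ]
      refine (GSub.app_congr σ (θ x) ?_).symm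
      exact fun y hy => hl y fun hy' => hf.fresh x y hy (hF hy')
    rw [Assign.qσ_bind, Assign.qσ]
    congr 1
    funext u w
    exact q.qσ_patSub (θ x) p ⟨σ.bv, l⟩ τ hx w
  refine ⟨⟨L, hw.matchv_left⟩, fun i c hc => hf.sat i c (by rw [ineqs]; exact .inl hc),
    fun l hl i => ?_, fun l hl y => ?_, fun t z y hy hy' => ?_, hf.cycle.mono hF, fun t z => ?_,
    hf.cost.1⟩
  · exact (key l hl _ _).trans (hf.proper l (fun y hy => hl y fun hy' => hy (hF hy')) i)
  · exact (key l hl _ _).trans (hf.aux l (fun y hy => hl y fun hy' => hy (hF hy')) y)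
  · rcases σ.ext_extSym p.vars τ θ z with ⟨z', -, h1, -⟩ | ⟨z', -, h1, -⟩
    · rw [h1] at hy
      exact hy
    · rw [h1, SV.labs_weaken] at hy
      exact hf.fresh z' y hy (hF hy')
  · rcases σ.ext_extSym p.vars τ θ z with ⟨z', -, -, h1⟩ | ⟨z', -, -, h1⟩
    · rw [h1]
      refine le_trans ?_ (hf.val_le x)
      rw [← hτ]
      -- Each pattern variable occurs in `p`, so its value is bounded by the matched one.
      exact q.le_qv_of_mem_leaves p.toCTm τ z' (hw.source.2.1 _ z')
    · rw [h1]
      exact hf.val_le z'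

/-- The value of a bound signal name. -/
def nuVal {D : DataSig} (ρ : D.Reg) (t : D.T) : ∀ ⦃u : D.T⦄, Mem [Ty.sig ρ t] u → Val D u
  | _, .z => .var (.name ρ t 0)

theorem Frag.nu {ρ : S.D.Reg} {t : S.T} {P : Prog S (.sig ρ t :: Γ)}
    (hf : Frag bd A v (.nu ρ t P) θ h σ) :
    Frag bd A v P (extSym [.sig ρ t] θ) (h.weaken [.sig ρ t]) (σ.ext [.sig ρ t] (nuVal ρ t)) := by
  obtain ⟨L, hw⟩ := hf.within
  refine ⟨⟨L, hw.nu⟩, fun i c hc => hf.sat i c (by rw [ineqs]; exact hc),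
    fun l hl i => ?_, fun l hl y => ?_, fun u z y hy hy' => ?_, hf.cycle, fun u z => ?_, hf.cost⟩
  · exact (q.qσ_weaken _ _ ⟨σ.bv, l⟩ _).trans (hf.proper l hl i)
  · exact (q.qσ_weaken _ _ ⟨σ.bv, l⟩ _).trans (hf.aux l hl y)
  · rcases σ.ext_extSym [.sig ρ t] (nuVal ρ t) θ z with ⟨z', -, h1, -⟩ | ⟨z', -, h1, -⟩
    · rw [h1] at hy
      exact hy
    · rw [h1, SV.labs_weaken] at hy
      exact hf.fresh z' y hy hy'
  · rcases σ.ext_extSym [.sig ρ t] (nuVal ρ t) θ z with ⟨z', -, -, h1⟩ | ⟨z', -, -, h1⟩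
    · rw [h1]
      cases z' with
      | z => exact Nat.zero_le _
      | s z' => cases z'
    · rw [h1]
      exact hf.val_le z'

theorem fragSub_nu (ρ : S.D.Reg) (t : S.T) :
    fragSub (extSym [.sig ρ t] θ) (σ.ext [.sig ρ t] (nuVal ρ t)) =
      (fragSub θ σ).extNu ρ t := by
  funext u x
  match x with
  | .name ρ t k => rfl
  | .bv .z => rfl
  | .bv (.s x) =>
    simp only [fragSub, Sub.extNu]
    exact σ.ext_weaken [.sig ρ t] (nuVal ρ t) (θ x)

/-- The interpretation of a symbolic expression. -/
theorem Assign.qσ_symVar {t : S.T} (e : Exp S (PV S.D Γ) t) :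
    q.qσ σ (e.bind fun _ x => .var (symVar θ x)) =
      q.qe (fun _ _ => 0) (e.bind fun _ x => (fragSub θ σ x).toExp) := by
  rw [Assign.qσ_bind, Assign.qe_bind]
  congr 1
  funext t x
  rw [Assign.qe_toExp]
  cases x <;> rfl

theorem Assign.qσ_symVar_congr {P : Prog S Γ} (hf : Frag bd A v P θ h σ) {l : LabVal S}
    (hl : ∀ y ∉ P.future X N, l y = σ.lab y) {t : S.T} (e : Exp S (PV S.D Γ) t) :
    q.qσ ⟨σ.bv, l⟩ (e.bind fun _ x => .var (symVar θ x)) =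
      q.qσ σ (e.bind fun _ x => .var (symVar θ x)) := by
  rw [Assign.qσ_bind, Assign.qσ_bind]
  congr 1
  funext t x
  cases x with
  | name => rfl
  | bv x => exact congrArg q.qv (σ.app_congr (θ x) fun y hy => hl y (hf.fresh x y hy))

theorem Frag.qh_maskR {P : Prog S Γ} (hf : Frag bd A v P θ h σ) {l : LabVal S}
    (hl : ∀ y ∉ P.future X N, l y = σ.lab y) (ρ : WithTop S.D.Reg) :
    q.qh ⟨σ.bv, l⟩ (h.maskR ρ) = q.qA A (fun i => q.qv (v i)) (q.auxBelow A ρ l) := by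
  simp only [Assign.qh, Hat.maskR, hf.proper l hl, hf.aux l hl, Set.mem_univ, if_true]
  rfl

theorem Frag.qh_maskI {P : Prog S Γ} (hf : Frag bd A v P θ h σ) {l : LabVal S}
    (hl : ∀ y ∉ P.future X N, l y = σ.lab y) :
    q.qh ⟨σ.bv, l⟩ (h.maskI N) = q.qA A (properIn N A fun i => q.qv (v i)) fun _ => 0 := by
  simp only [Assign.qh, Hat.maskI, hf.proper l hl, Set.mem_empty_iff_false, if_false]
  rfl

end FragLemmas

end Invariant

/-! ### Threads with potentials, and entry into a body. -/

section States

variable {S : Sgn} {X : Sys S} {N : Ann S} {q : Assign X N} (bd : Bounds X N q)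

/-! ### Potentials of states -/

/-- The first component bounds the number of threads that survive the instant, the component `⊤`
the number of steps, the component `ρ` the number of emissions on `ρ`. -/
abbrev Pot (S : Sgn) : Type := ℕ × (WithTop S.D.Reg → ℕ)

open Classical in
noncomputable def emitPot (ρ : S.D.Reg) : Pot S := (0, fun ρ' => if ρ' = ρ then 1 else 0)

noncomputable def stepPot (S : Sgn) : Pot S := (0, tick)

noncomputable def envPot (E : Input S) : Pot S := stepPot S + (E.map fun m => emitPot m.reg).sum

noncomputable def Bounds.startPot : Pot S :=
  (1, fun ρ => (S.N + 1) * ((bd.arg ρ + 1) ^ bd.arity + 1) * bd.size + bd.size + tick ρ)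

/-- The potential of a call of `A` with the arguments `v`. -/
noncomputable def Bounds.call (A : S.Id) (v : Args S A) (ρ : WithTop S.D.Reg) : ℕ :=
  callPot X N bd.base (bd.arg ρ) A (pad bd.arity fun i => q.qv (v i))

open Classical in
noncomputable def Bounds.fragPot (A : S.Id) (v : Args S A) {Γ : List S.T} (P : Prog S Γ) : Pot S :=
  (if P.HasCall then 1 else 0, fun ρ => P.pot X ρ (bd.call A v ρ * bd.size))

/-- Fragments that are neither emissions nor compositions. -/
def Prog.Active : ∀ {Γ : List S.T}, Prog S Γ → Prop
  | _, .call _ _ => True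
  | _, .present _ _ _ _ _ => True
  | _, .matchs _ _ _ _ => True
  | _, .matchv _ _ _ _ => True
  | _, _ => False

/-- Threads that satisfy the invariant, with their potential. -/
inductive Good : Prog S [] → Pot S → Prop
  | emit {ρ : S.D.Reg} {t : S.T} (s : PV S.D [] (.sig ρ t)) (e : Exp S (PV S.D []) t) :
      q.qe (fun _ _ => 0) e ≤ bd.emit ρ → 1 + q.closedCost e ≤ bd.cost →
      Good (.emit s e) (emitPot ρ)
  | env (E : Input S) : (∀ m ∈ E, q.qv m.val ≤ bd.emit m.reg ∧
      1 + q.closedCost m.val.toExp ≤ bd.cost) → 1 ≤ bd.cost → Good (.env E) (envPot E)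
  | start (B : S.Id) (v : Args S B) (l : LabVal S) : CycleInv bd B v l (readSet X N B) →
      Good (.call B fun i => (v i).toExp) bd.startPot
  | frag {Γ Δ : List S.T} {A : S.Id} {v : Args S A} {P : Prog S Γ}
      {θ : ∀ ⦃t⦄, Mem Γ t → SV S Δ t} {h : Hat S A Δ} {σ : GSub S Δ} : P.Active →
      Frag bd A v P θ h σ → Good (P.bind (fragSub θ σ)) (bd.fragPot A v P)

/-- The invariant of states, with a bound of the total potential. -/
def Inv (M : Multiset (Prog S [])) (κ : Pot S) : Prop :=
  ∃ G : Multiset (Pot S), Multiset.Rel (Good bd) M G ∧ G.sum ≤ κ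

variable {bd}

theorem Inv.zero (κ : Pot S) : Inv bd 0 κ :=
  ⟨0, .zero, by simp⟩

theorem Inv.single {T : Prog S []} {κ : Pot S} (h : Good bd T κ) : Inv bd {T} κ :=
  ⟨{κ}, Multiset.Rel.cons h .zero, by simp⟩

theorem Inv.add {M M' : Multiset (Prog S [])} {κ κ' : Pot S} (h : Inv bd M κ) (h' : Inv bd M' κ') :
    Inv bd (M + M') (κ + κ') := by
  obtain ⟨G, h, hs⟩ := h
  obtain ⟨G', h', hs'⟩ := h'
  exact ⟨G + G', h.add h', by rw [Multiset.sum_add]; exact add_le_add hs hs'⟩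

theorem Inv.mono {M : Multiset (Prog S [])} {κ κ' : Pot S} (h : Inv bd M κ) (hκ : κ ≤ κ') :
    Inv bd M κ' := by
  obtain ⟨G, h, hs⟩ := h
  exact ⟨G, h, hs.trans hκ⟩

theorem Inv.split {M M' : Multiset (Prog S [])} {κ : Pot S} (h : Inv bd (M + M') κ) :
    ∃ κ₁ κ₂, Inv bd M κ₁ ∧ Inv bd M' κ₂ ∧ κ₁ + κ₂ ≤ κ := by
  obtain ⟨G, h, hs⟩ := h
  obtain ⟨G₁, G₂, h₁, h₂, rfl⟩ := Multiset.rel_add_left.1 h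
  exact ⟨_, _, ⟨G₁, h₁, le_rfl⟩, ⟨G₂, h₂, le_rfl⟩, by rwa [← Multiset.sum_add]⟩

theorem Inv.good {T : Prog S []} {κ : Pot S} (h : Inv bd {T} κ) : ∃ κ' ≤ κ, Good bd T κ' := by
  obtain ⟨G, h, hs⟩ := h
  obtain ⟨κ', G', hg, h0, rfl⟩ := Multiset.rel_cons_left.1 h
  rw [Multiset.rel_zero_left] at h0
  subst h0
  exact ⟨κ', by simpa using hs, hg⟩

/-- A function of threads that is bounded by a function of the potential of good threads. -/
theorem Inv.sum_le {M : Multiset (Prog S [])} {κ : Pot S} (h : Inv bd M κ) (w : Prog S [] → ℕ)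
    (f : Pot S →+ ℕ) (hf : Monotone f) (hw : ∀ T κ, Good bd T κ → w T ≤ f κ) :
    (M.map w).sum ≤ f κ := by
  obtain ⟨G, h, hs⟩ := h
  refine le_trans ?_ (hf hs)
  rw [map_multiset_sum]
  clear hs
  induction h with
  | zero => exact le_rfl
  | cons hg _ ih => simpa using add_le_add (hw _ _ hg) ih

/-! ### Spreading a fragment into threads -/

/-- The inequality of index `2` for an emission bounds the value by `A⁺(v, y)_{↓ρ}`, and the region
`ρ` belongs to the emission set of `A` since the fragment emits on it. -/
theorem Frag.emit_le {Γ Δ : List S.T} {A : S.Id} {v : Args S A}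
    {θ : ∀ ⦃t⦄, Mem Γ t → SV S Δ t} {h : Hat S A Δ} {σ : GSub S Δ} {ρ : S.D.Reg} {t : S.T}
    {s : PV S.D Γ (.sig ρ t)} {e : Exp S (PV S.D Γ) t} (hf : Frag bd A v (.emit s e) θ h σ) :
    q.qe (fun _ _ => 0) (e.bind fun _ x => (fragSub θ σ x).toExp) ≤ bd.emit ρ := by
  rw [← Assign.qσ_symVar]
  have h1 := hf.sat 2 (.geExp (h.maskR (ρ : WithTop S.D.Reg)) (e.bind fun _ x => .var (symVar θ x)))
    (by rw [ineqs]; rfl)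
  obtain ⟨L, hw⟩ := hf.within
  have h2 : (ρ : WithTop S.D.Reg) ∈ emitSet X N A := mem_emitSet ⟨A, .refl, hw.emits rfl⟩
  refine (h1 σ).trans (le_trans ?_ (bd.arg_le_emit ρ))
  have h3 := hf.qh_maskR (l := σ.lab) (fun _ _ => rfl) ρ
  exact h3.le.trans (hf.cycle.region ρ h2 _ (fun _ _ => rfl) hf.cycle.lab_le)

open Classical in
theorem Prog.ctl_par {Γ : List S.T} {P₁ P₂ : Prog S Γ} (h : (Prog.par P₁ P₂).FiniteControl) :
    (if P₁.HasCall then 1 else 0) + (if P₂.HasCall then 1 else 0) ≤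
      if (Prog.par P₁ P₂).HasCall then 1 else 0 := by
  have h1 := h.2.2
  have h2 : P₁.HasCall → (Prog.par P₁ P₂).HasCall := .inl
  have h3 : P₂.HasCall → (Prog.par P₁ P₂).HasCall := .inr
  split_ifs <;> first | omega | tauto

/-- A fragment splits at once into its threads, whose potentials add up to at most its own. The only
case with content is parallel composition, where finite control prevents both the surviving thread
and the call potential from being counted twice. -/
theorem Frag.inv {Γ : List S.T} {P : Prog S Γ} : ∀ {Δ : List S.T} {A : S.Id}
    {v : Args S A} {θ : ∀ ⦃t⦄, Mem Γ t → SV S Δ t} {h : Hat S A Δ} {σ : GSub S Δ},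
    Frag bd A v P θ h σ → Inv bd (P.threads (fragSub θ σ)) (bd.fragPot A v P) := by
  induction P with
  | zero => exact fun _ => .zero _
  | call B e => exact fun hf => .single (.frag trivial hf)
  | present k s P B r => exact fun hf => .single (.frag trivial hf)
  | matchs s₁ s₂ P₁ P₂ => exact fun hf => .single (.frag trivial hf)
  | matchv u p P₁ P₂ => exact fun hf => .single (.frag trivial hf)
  | env E => exact fun hf => (hf.within.choose_spec.source).elim
  | emit s e =>
    intro Δ A v θ h σ hf
    refine (Inv.single (Good.emit _ _ hf.emit_le
      (hf.cost _ fun _ x => hf.qv_fragSub_le x))).mono ⟨Nat.zero_le _, fun ρ => ?_⟩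
    exact Nat.le_add_left _ _
  | nu ρ t P ih =>
    intro Δ A v θ h σ hf
    have := ih hf.nu
    rwa [fragSub_nu] at this
  | par P₁ P₂ ih₁ ih₂ =>
    intro Δ A v θ h σ hf
    obtain ⟨L, hw⟩ := hf.within
    refine ((ih₁ hf.par_left).add (ih₂ hf.par_right)).mono ⟨?_, fun ρ => ?_⟩
    · exact Prog.ctl_par hw.fin
    · exact Prog.pot_par hw.fin

/-! ### Entering a body -/

theorem valSub_ctxVec : ∀ {Γ : List S.T} (v : ∀ i : Fin Γ.length, Val S.D (Γ.get i))
    (i : Fin Γ.length), valSub v (ctxVec Γ i) = v i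
  | _ :: _, _, ⟨0, _⟩ => rfl
  | _ :: Γ, v, ⟨i + 1, h⟩ =>
    valSub_ctxVec (Γ := Γ) (fun i => v i.succ) ⟨i, Nat.lt_of_succ_lt_succ h⟩

theorem exists_valSub : ∀ {Γ : List S.T} (v : ∀ i : Fin Γ.length, Val S.D (Γ.get i)) {t : S.T}
    (x : Mem Γ t) {p : ∀ t, Val S.D t → Prop}, (∀ i, p _ (v i)) → p t (valSub v x)
  | _ :: _, _, _, .z, _, h => h ⟨0, Nat.succ_pos _⟩
  | _ :: _, v, _, .s x, _, h => exists_valSub (fun i => v i.succ) x fun i => h i.succ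

theorem valSub_bind : ∀ {Γ : List S.T} (v : ∀ i : Fin Γ.length, Val S.D (Γ.get i))
    (f : Sub S.D [] []) {t : S.T} (x : Mem Γ t), (valSub v x).bind f = valSub (fun i => (v i).bind f) x
  | _ :: _, _, _, _, .z => rfl
  | _ :: _, v, f, _, .s x => valSub_bind (fun i => v i.succ) f x

/-- On entry the symbolic arguments are the parameters themselves, and no label is in scope. -/
theorem CycleInv.frag (hq : q.Valid) (hsat : ∀ i : Fin 3, ∀ c ∈ sysIneqs X N i, q.Sat c)
    (hfin : X.FiniteControl) {B : S.Id} {v : Args S B} {l : LabVal S}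
    (h : CycleInv bd B v l (readSet X N B)) :
    Frag bd B v (X.body B) (fun _ x => .bv x) (Hat.init B) ⟨valSub v, l⟩ where
  within := ⟨∅, .body hfin B⟩
  sat i c hc := hsat i c ⟨B, hc⟩
  proper _ _ i := congrArg q.qv (valSub_ctxVec v i)
  aux _ _ _ := rfl
  fresh _ _ _ hy := hy.elim
  cycle := h.mono (Within.body hfin B).future_subset
  val_le _ x := exists_valSub (p := fun _ w => q.qv w ≤ bd.val) v x fun i =>
    (h.arg_le_top hq i).trans bd.top_le_val
  cost := bd.costLt B

/-- Instantiation of the variables; names are left unchanged. -/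
def instSub {D : DataSig} {Γ : List D.T} (τ : ∀ ⦃t⦄, Mem Γ t → Val D t) : Sub D Γ []
  | _, .name ρ t k => .var (.name ρ t k)
  | _, .bv x => τ x

theorem Prog.inst_eq {Γ : List S.T} (P : Prog S Γ) (τ : ∀ ⦃t⦄, Mem Γ t → Val S.D t) :
    P.inst τ = P.bind (instSub τ) := by
  unfold Prog.inst
  congr 1
  funext t x
  cases x <;> rfl

theorem thr_body_inst {B : S.Id} (v : Args S B) (l : LabVal S) :
    ((X.body B).inst (valSub v)).thr =
      (X.body B).threads (fragSub (fun _ x => .bv x)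
        ⟨valSub fun i => (v i).bind Sub.erase, l⟩) := by
  rw [Prog.inst_eq, Prog.thr, Prog.threads_bind]
  congr 1
  funext t x
  cases x with
  | name => rfl
  | bv x => exact valSub_bind v _ x

/-- The hypothesis `heq` relates the program that is executed, with its true names, to a fragment of
a body only after erasure. The lemma transfers this relation to the instances, the bound variables
receiving the erased values. -/
theorem thr_inst {Ψ Γ : List S.T} (P : Prog S (Ψ ++ [])) (P' : Prog S (Ψ ++ Γ)) {f : Sub S.D Γ []}
    (heq : P.bind (liftSub Ψ Sub.erase) = P'.bind (liftSub Ψ f))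
    (τ : ∀ ⦃t⦄, Mem (Ψ ++ []) t → Val S.D t) (g : Sub S.D (Ψ ++ Γ) [])
    (hname : ∀ ρ t k, g (.name ρ t k) = f (.name ρ t k))
    (hleft : ∀ ⦃t⦄ (y : Mem Ψ t), g (.bv (y.left Γ)) = (τ (y.left [])).bind Sub.erase)
    (hright : ∀ ⦃t⦄ (y : Mem Γ t), g (.bv (y.right Ψ)) = f (.bv y)) :
    (P.inst τ).thr = P'.threads g := by
  let τ' : ∀ ⦃t⦄, Mem (Ψ ++ []) t → Val S.D t := fun _ x => (τ x).bind Sub.erase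
  have h0 : ∀ {t : S.T} (w : Val S.D t),
      (w.bind fun _ y => .var (y.weaken Ψ)).bind (instSub τ') = w := by
    intro t w
    rw [CTm.bind_bind]
    refine Eq.trans ?_ w.bind_var
    congr 1
    funext u y
    cases y with
    | name => rfl
    | bv y => cases y
  have h1 : (instSub τ).comp Sub.erase = Sub.comp (liftSub Ψ Sub.erase) (instSub τ') := by
    funext t x
    cases x with
    | name => rfl
    | bv x =>
      rcases Mem.left_or_right Ψ x with ⟨y, rfl⟩ | ⟨y, rfl⟩
      · rw [Sub.comp, Sub.comp, liftSub_left]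
        rfl
      · cases y
  have h2 : Sub.comp (liftSub Ψ f) (instSub τ') = g := by
    funext t x
    cases x with
    | name ρ t k => exact (h0 _).trans (hname ρ t k).symm
    | bv x =>
      rcases Mem.left_or_right Ψ x with ⟨y, rfl⟩ | ⟨y, rfl⟩
      · rw [Sub.comp, liftSub_left, hleft]
        rfl
      · rw [Sub.comp, liftSub_right, hright, h0]
  rw [Prog.inst_eq, Prog.thr, Prog.threads_bind, h1, ← Prog.threads_bind, heq,
    Prog.threads_bind, h2]

end States

/-! ## Preservation of the invariant by reductions -/

section Preservation

variable {S : Sgn} {X : Sys S} {N : Ann S} {q : Assign X N} {bd : Bounds X N q}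

section Fragments

variable {Γ Δ : List S.T} {A : S.Id} {v : Args S A} {θ : ∀ ⦃t⦄, Mem Γ t → SV S Δ t} {h : Hat S A Δ}
  {σ : GSub S Δ}

theorem Assign.qh_call_maskR {B : S.Id} (σ : GSub S Δ)
    (e : ∀ i : S.Pos B, Exp S (SV S Δ) ((S.params B).get i)) (ρ : WithTop S.D.Reg) :
    q.qh σ ((Hat.call e).maskR ρ) = q.qA B (fun i => q.qσ σ (e i)) (q.auxBelow B ρ σ.lab) := by
  simp only [Assign.qh, Hat.maskR, Hat.call, Set.mem_univ, if_true]
  rfl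

theorem Assign.qh_call_maskI {B : S.Id} (σ : GSub S Δ)
    (e : ∀ i : S.Pos B, Exp S (SV S Δ) ((S.params B).get i)) :
    q.qh σ ((Hat.call e).maskI N) = q.qA B (properIn N B fun i => q.qσ σ (e i)) fun _ => 0 := by
  simp only [Assign.qh, Hat.maskI, Hat.call, Set.mem_empty_iff_false, if_false]
  rfl

/-- The invariant of the identifier that is called from a fragment. -/
theorem Frag.next (hq : q.Valid) (hann : N.Valid X) {P : Prog S Γ} (hf : Frag bd A v P θ h σ)
    {B : S.Id} (e : ∀ i : S.Pos B, Exp S (SV S Δ) ((S.params B).get i))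
    (h1 : ∀ c ∈ callIneqs1 N h (Hat.call e), q.Sat c)
    (h2 : ∀ c ∈ callIneqs2 X N h (Hat.call e), q.Sat c)
    (hreach : B ∉ N.reset → CycReach X N A B)
    (hF : B ∉ N.reset → readSet X N B ⊆ P.future X N) {l' : LabVal S}
    (hl : ∀ y ∉ P.future X N, l' y = σ.lab y)
    (hb : ∀ y ∈ X.labels, q.qv (l' y) ≤ bd.read y.reg) (v' : Args S B)
    (hx : ∀ l'' : LabVal S, (∀ y ∉ readSet X N B, l'' y = l' y) → B ∉ N.reset →
      ∀ i, q.qv (v' i) ≤ q.qσ ⟨σ.bv, l''⟩ (e i))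
    (hx' : ∀ i, q.qv (v' i) ≤ q.qσ ⟨σ.bv, l'⟩ (e i)) :
    ∃ l₀, CycleInv bd B v' l₀ (readSet X N B) := by
  refine hf.cycle.next hq hann hreach hF hl hb v' (fun l'' i => q.qσ ⟨σ.bv, l''⟩ (e i)) hx hx' ?_ ?_
  · have := h1 _ rfl ⟨σ.bv, l'⟩
    rwa [Assign.qh_call_maskI, hf.qh_maskI hl] at this
  · intro hB ρ hρ l'' hl''
    have := h2 _ ⟨hB, ρ, hρ, rfl⟩ ⟨σ.bv, l''⟩
    rwa [Assign.qh_call_maskR, hf.qh_maskR hl''] at this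

variable {B : S.Id} {e : ∀ i : S.Pos B, Exp S (PV S.D Γ) ((S.params B).get i)}

theorem Frag.call_next (hq : q.Valid) (hann : N.Valid X) (hf : Frag bd A v (.call B e) θ h σ)
    (v' : Args S B)
    (hv : ∀ i, q.qv (v' i) ≤ q.qe (fun _ _ => 0) ((e i).bind fun _ x => (fragSub θ σ x).toExp)) :
    ∃ l₀, CycleInv bd B v' l₀ (readSet X N B) := by
  obtain ⟨L, hw⟩ := hf.within
  refine hf.next hq hann (fun j => (e j).bind fun _ x => .var (symVar θ x))
    (fun c hc => hf.sat 1 c (by rw [ineqs]; exact hc))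
    (fun c hc => hf.sat 2 c (by rw [ineqs]; exact hc))
    (fun hB => CycReach.single (L := L) (hw.calls (by simp [Prog.calls, hB])))
    (fun hB y hy => ⟨hB, hy⟩) (l' := σ.lab) (fun _ _ => rfl) hf.cycle.lab_le v'
    (fun l'' hl'' hB i => ?_) (fun i => ?_)
  · rw [Assign.qσ_symVar_congr hf, Assign.qσ_symVar]
    · exact hv i
    · exact fun y hy => hl'' y fun hy' => hy ⟨hB, hy'⟩
  · exact (hv i).trans_eq (Assign.qσ_symVar _).symm

theorem readSeq_congr {A B : S.Id} (h : readSet X N A = readSet X N B) :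
    readSeq X N A = readSeq X N B := by
  unfold readSeq
  rw [h]

/-- For equivalent identifiers the inequality of index `0` applies; its auxiliary parts agree by
`readSeq_congr`. Only the new arguments need the bound `bd.arg ρ`. -/
theorem Frag.callPot_lt (hann : N.Valid X) (hf : Frag bd A v (.call B e) θ h σ) (v' : Args S B)
    (hv : ∀ i, q.qv (v' i) ≤ q.qe (fun _ _ => 0) ((e i).bind fun _ x => (fragSub θ σ x).toExp))
    (ρ : WithTop S.D.Reg) (hρ : ∀ i, q.qv (v' i) ≤ bd.arg ρ) :
    bd.call B v' ρ < bd.call A v ρ := by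
  obtain ⟨L, hw⟩ := hf.within
  have hB : B ∈ (X.body A).instCalls := hw.inst rfl
  refine SPi.callPot_lt (.single hB) (fun he => ?_) fun i => ?_
  · obtain ⟨hlen, hst⟩ := hann.status A B he
    refine ⟨hst, ?_⟩
    have h0 := hf.sat 0 (.gt h (Hat.call fun j => (e j).bind fun _ x => .var (symVar θ x)))
      (by rw [ineqs]; exact ⟨fun hg => hg.2 he, rfl⟩)
    have h1 := VecGt.listGt h0 σ
    have h2 : ∀ i, q.qσ σ (h.proper i) = q.qv (v i) := hf.proper σ.lab fun _ _ => rfl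
    have h3 : ∀ y, q.qσ σ (h.aux y) = q.qv (σ.lab y) := hf.aux σ.lab fun _ _ => rfl
    have h4 : ∀ y, q.qσ σ (.var (.lab y)) = q.qv (σ.lab y) := fun _ => rfl
    simp only [Assign.vec, h2, h3, Hat.call, h4, readSeq_congr (hann.readSet_eq hB he)] at h1
    refine ListGt.statusLt hlen h1 (fun i => ?_) (bd.arity_le A) ?_
    · exact (hv i).trans_eq (Assign.qσ_symVar _).symm
    · have h5 : (readSeq X N B).length ≤ X.labels.length := List.length_filter_le _ _
      have := bd.arity_le A
      have := bd.base_gt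
      simp only [List.length_map]
      omega
  · unfold pad
    split_ifs
    · exact hρ _
    · exact Nat.zero_le _

theorem fragPot_body_le (B : S.Id) (v' : Args S B) (ρ : WithTop S.D.Reg) :
    (bd.fragPot B v' (X.body B)).2 ρ ≤ bd.call B v' ρ * bd.size + bd.size := by
  have h1 := (X.body B).weight_le_nodes ρ
  have h2 := bd.nodes_le B
  simp only [Bounds.fragPot, Prog.pot]
  split_ifs <;> omega

theorem fragPot_start (B : S.Id) (v' : Args S B) :
    bd.fragPot B v' (X.body B) + stepPot S ≤ bd.startPot := by
  refine ⟨?_, fun ρ => ?_⟩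
  · simp only [Bounds.fragPot, stepPot, Bounds.startPot, Prod.mk_add_mk]
    split_ifs <;> simp
  · have h1 := fragPot_body_le (bd := bd) B v' ρ
    have h2 : bd.call B v' ρ * bd.size ≤ _ := Nat.mul_le_mul_right bd.size (callPot_le X N _ _ _ _)
    simp only [stepPot, Bounds.startPot, Prod.snd_add, Pi.add_apply]
    omega

/-- Each unit of `bd.call` is worth `bd.size`, more than any body emits or steps outside its calls.
The drop by one unit therefore pays for the whole body of `B`, and `tick` for the call. -/
theorem Frag.fragPot_call (hq : q.Valid) (hann : N.Valid X) (hf : Frag bd A v (.call B e) θ h σ)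
    (v' : Args S B)
    (hv : ∀ i, q.qv (v' i) ≤ q.qe (fun _ _ => 0) ((e i).bind fun _ x => (fragSub θ σ x).toExp)) :
    bd.fragPot B v' (X.body B) + stepPot S ≤ bd.fragPot A v (.call B e) := by
  obtain ⟨L, hw⟩ := hf.within
  have hB : B ∈ (X.body A).instCalls := hw.inst rfl
  obtain ⟨l₀, hc⟩ := hf.call_next hq hann v' hv
  refine ⟨?_, fun ρ => ?_⟩
  · simp only [Bounds.fragPot, stepPot, Prod.mk_add_mk, Prog.HasCall]
    split_ifs <;> simp
  · simp only [stepPot, Prod.snd_add, Pi.add_apply]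
    -- If `B` cannot lead to an emission on `ρ`, no bound on its arguments in terms of `ρ` is
    -- available, but its body has potential `0` at `ρ`. For `⊤` the condition `Emits` is vacuous.
    by_cases hE : Emits X ρ B
    · have hρ : ∀ i, q.qv (v' i) ≤ bd.arg ρ := by
        cases ρ with
        | top => exact hc.arg_le_top hq
        | coe ρ => exact hc.arg_le hq (hann.emits hB hE).2
      have h1 := hf.callPot_lt hann v' hv ρ hρ
      have h2 := fragPot_body_le (bd := bd) B v' ρ
      have h3 := Nat.mul_le_mul_right bd.size (Nat.succ_le_of_lt h1)
      rw [Nat.succ_mul] at h3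
      have h4 : (bd.fragPot A v (Prog.call B e)).2 ρ = bd.call A v ρ * bd.size + tick ρ := by
        simp only [Bounds.fragPot, Prog.pot, Prog.weight]
        rw [if_pos ⟨B, rfl, hE⟩]
      omega
    · cases ρ with
      | top => exact (hE fun ρ' h => absurd h (by simp)).elim
      | coe ρ =>
        have h1 : (bd.fragPot B v' (X.body B)).2 ρ = 0 := Prog.pot_body_eq_zero hE
        rw [h1]
        simp [tick]

open Classical in
/-- The value of a label is fixed when it is read. -/
noncomputable def LabVal.set (l : LabVal S) (y : Lab S) (w : Val S.D y.ty) : LabVal S :=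
  Function.update l y w

theorem LabVal.set_self (l : LabVal S) (y : Lab S) (w : Val S.D y.ty) : LabVal.set l y w y = w := by
  classical
  exact Function.update_self _ _ _

theorem LabVal.set_ne (l : LabVal S) {y y' : Lab S} (w : Val S.D y.ty) (h : y' ≠ y) :
    LabVal.set l y w y' = l y' := by
  classical
  exact Function.update_of_ne h _ _

theorem ineqs_present_subset (i : Fin 3) {ρ : S.D.Reg} {t : S.T} {k : ℕ}
    {s : PV S.D Γ (.sig ρ t)} {P : Prog S (t :: Γ)} {B : S.Id}
    {r : ∀ i : S.Pos B, Exp S (RLeaf S Γ) ((S.params B).get i)} :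
    ineqs X N i P (labSym k ρ t θ) h ⊆ ineqs X N i (.present k s P B r) θ h := by
  intro c hc
  match i with
  | 0 => rw [ineqs]; exact .inl hc
  | 1 => rw [ineqs]; exact .inl hc
  | 2 => rw [ineqs]; exact .inl hc

/-- The label leaves the set of undetermined labels and takes the value `w`; the invariant of the
`present` statement already held for that choice. By the read once condition the label is not in the
future of the continuation. -/
theorem Frag.present_read (hread : ReadOnce X N) {ρ : S.D.Reg} {t : S.T} {k : ℕ}
    {s : PV S.D Γ (.sig ρ t)} {P : Prog S (t :: Γ)} {B : S.Id}
    {r : ∀ i : S.Pos B, Exp S (RLeaf S Γ) ((S.params B).get i)}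
    (hf : Frag bd A v (.present k s P B r) θ h σ) (w : Val S.D t) (hw : q.qv w ≤ bd.read ρ) :
    Frag bd A v P (labSym k ρ t θ) h ⟨σ.bv, LabVal.set σ.lab (.read k ρ t) w⟩ := by
  obtain ⟨L, hL⟩ := hf.within
  have hF : P.future X N ⊆ (Prog.present k s P B r).future X N :=
    fun y hy => .inl (.inl (.inr hy))
  have hy : Lab.read k ρ t ∈ (Prog.present k s P B r).future X N := .inl (.inl (.inl rfl))
  have hl : ∀ y ∉ (Prog.present k s P B r).future X N,
      LabVal.set σ.lab (.read k ρ t) w y = σ.lab y := fun y hy' =>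
    LabVal.set_ne _ _ fun e => hy' (e ▸ hy)
  have hset : LabVal.set σ.lab (.read k ρ t) w (.read k ρ t) = w := LabVal.set_self _ _ _
  have hl' : ∀ l : LabVal S, (∀ y ∉ P.future X N, l y = LabVal.set σ.lab (.read k ρ t) w y) →
      ∀ y ∉ (Prog.present k s P B r).future X N, l y = σ.lab y := fun l h y hy =>
    (h y fun hy' => hy (hF hy')).trans (hl y hy)
  refine ⟨⟨_, hL.present⟩, fun i c hc => hf.sat i c (ineqs_present_subset i hc),
    fun l hl i => hf.proper l (hl' l hl) i, fun l hl y => hf.aux l (hl' l hl) y, ?_, ?_, ?_,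
    hf.cost⟩
  · intro u x y hy hy'
    cases x with
    | z => cases hy; exact hL.read_not_mem_future hread hy'
    | s x => exact hf.fresh x y hy (hF hy')
  · refine hf.cycle.update hF hl fun y hy => ?_
    by_cases e : y = .read k ρ t
    · subst e
      exact (congrArg q.qv hset).le.trans hw
    · exact (congrArg q.qv (LabVal.set_ne _ _ e)).le.trans (hf.cycle.lab_le y hy)
  · intro u x
    cases x with
    | z => exact (congrArg q.qv hset).le.trans (hw.trans (bd.read_le_val ρ))
    | s x =>
      refine (congrArg q.qv (σ.app_congr (θ x) fun y hy => hl y (hf.fresh x y hy))).le.trans ?_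
      exact hf.val_le x

end Fragments

/-! ### Threads of a given form -/

theorem Good.call_inv {B : S.Id} {e : ∀ i : S.Pos B, Exp S (PV S.D []) ((S.params B).get i)}
    {κ : Pot S} (hg : Good bd (.call B e) κ) :
    (∃ (v : Args S B) (l : LabVal S), CycleInv bd B v l (readSet X N B) ∧
      e = (fun i => (v i).toExp) ∧ κ = bd.startPot) ∨
    ∃ (Γ Δ : List S.T) (A : S.Id) (v : Args S A) (θ : ∀ ⦃t⦄, Mem Γ t → SV S Δ t) (h : Hat S A Δ)
      (σ : GSub S Δ) (e' : ∀ i : S.Pos B, Exp S (PV S.D Γ) ((S.params B).get i)),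
      Frag bd A v (.call B e') θ h σ ∧
      e = (fun i => (e' i).bind fun _ x => (fragSub θ σ x).toExp) ∧
      κ = bd.fragPot A v (.call B e') := by
  -- The thread index of `Good.frag` is a substituted program; it becomes a constructor only after a
  -- case distinction on the fragment.
  generalize hT : Prog.call B e = T at hg
  cases hg with
  | emit => cases hT
  | env => cases hT
  | start B' v l hc => cases hT; exact .inl ⟨v, l, hc, rfl, rfl⟩
  | frag ha hf =>
    rename_i Γ Δ A v P θ h σ
    cases P with
    | call B' e' => cases hT; exact .inr ⟨Γ, Δ, A, v, θ, h, σ, e', hf, rfl, rfl⟩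
    | zero => cases ha
    | env => cases ha
    | emit => cases ha
    | nu => cases ha
    | par => cases ha
    | present => cases hT
    | matchs => cases hT
    | matchv => cases hT

theorem Good.emit_inv {ρ : S.D.Reg} {t : S.T} {s : PV S.D [] (.sig ρ t)}
    {e : Exp S (PV S.D []) t} {κ : Pot S} (hg : Good bd (.emit s e) κ) :
    q.qe (fun _ _ => 0) e ≤ bd.emit ρ ∧ 1 + q.closedCost e ≤ bd.cost ∧ κ = emitPot ρ := by
  generalize hT : Prog.emit s e = T at hg
  cases hg with
  | emit s' e' h1 h2 => cases hT; exact ⟨h1, h2, rfl⟩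
  | env => cases hT
  | start => cases hT
  | frag ha hf =>
    rename_i P _ _ _
    cases P <;> first | (cases ha; done) | cases hT

theorem Good.env_inv {E : Input S} {κ : Pot S} (hg : Good bd (.env E) κ) :
    (∀ m ∈ E, q.qv m.val ≤ bd.emit m.reg ∧ 1 + q.closedCost m.val.toExp ≤ bd.cost) ∧
      1 ≤ bd.cost ∧ κ = envPot E := by
  generalize hT : Prog.env E = T at hg
  cases hg with
  | emit => cases hT
  | env E h1 h2 => cases hT; exact ⟨h1, h2, rfl⟩
  | start => cases hT
  | frag ha hf =>
    rename_i P _ _ _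
    cases P <;> first | (cases ha; done) | cases hT

theorem Good.present_inv {ρ : S.D.Reg} {t : S.T} {k : ℕ} {s : PV S.D [] (.sig ρ t)} {P : Prog S [t]}
    {B : S.Id} {r : ∀ i : S.Pos B, Exp S (RLeaf S []) ((S.params B).get i)} {κ : Pot S}
    (hg : Good bd (.present k s P B r) κ) :
    ∃ (Γ Δ : List S.T) (A : S.Id) (v : Args S A) (θ : ∀ ⦃t⦄, Mem Γ t → SV S Δ t) (h : Hat S A Δ)
      (σ : GSub S Δ) (s' : PV S.D Γ (.sig ρ t)) (P' : Prog S (t :: Γ))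
      (r' : ∀ i : S.Pos B, Exp S (RLeaf S Γ) ((S.params B).get i)),
      Frag bd A v (.present k s' P' B r') θ h σ ∧ P = P'.bind (liftSub [t] (fragSub θ σ)) ∧
      r = (fun i => (r' i).bind (RLeaf.bind (fragSub θ σ))) ∧
      κ = bd.fragPot A v (.present k s' P' B r') := by
  generalize hT : Prog.present k s P B r = T at hg
  cases hg with
  | emit => cases hT
  | env => cases hT
  | start => cases hT
  | frag ha hf =>
    rename_i Γ Δ A v P θ h σ
    cases P with
    | call => cases hT
    | zero => cases ha
    | env => cases ha
    | emit => cases ha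
    | nu => cases ha
    | par => cases ha
    | present k' s' P' B' r' =>
      cases hT
      exact ⟨Γ, Δ, A, v, θ, h, σ, s', P', r', hf, rfl, rfl, rfl⟩
    | matchs => cases hT
    | matchv => cases hT

theorem Good.matchs_inv {ρ : S.D.Reg} {t : S.T} {s₁ s₂ : PV S.D [] (.sig ρ t)} {P₁ P₂ : Prog S []}
    {κ : Pot S} (hg : Good bd (.matchs s₁ s₂ P₁ P₂) κ) :
    ∃ (Γ Δ : List S.T) (A : S.Id) (v : Args S A) (θ : ∀ ⦃t⦄, Mem Γ t → SV S Δ t) (h : Hat S A Δ)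
      (σ : GSub S Δ) (s₁' s₂' : PV S.D Γ (.sig ρ t)) (P₁' P₂' : Prog S Γ),
      Frag bd A v (.matchs s₁' s₂' P₁' P₂') θ h σ ∧ P₁ = P₁'.bind (fragSub θ σ) ∧
      P₂ = P₂'.bind (fragSub θ σ) ∧ κ = bd.fragPot A v (.matchs s₁' s₂' P₁' P₂') := by
  generalize hT : Prog.matchs s₁ s₂ P₁ P₂ = T at hg
  cases hg with
  | emit => cases hT
  | env => cases hT
  | start => cases hT
  | frag ha hf =>
    rename_i Γ Δ A v P θ h σ
    cases P with
    | call => cases hT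
    | zero => cases ha
    | env => cases ha
    | emit => cases ha
    | nu => cases ha
    | par => cases ha
    | present => cases hT
    | matchs s₁' s₂' P₁' P₂' =>
      cases hT
      exact ⟨Γ, Δ, A, v, θ, h, σ, s₁', s₂', P₁', P₂', hf, rfl, rfl, rfl⟩
    | matchv => cases hT

theorem Good.matchv_inv {t : S.T} {u : Val S.D t} {p : Pattern S.D t} {P₁ : Prog S (p.vars ++ [])}
    {P₂ : Prog S []} {κ : Pot S} (hg : Good bd (.matchv u p P₁ P₂) κ) :
    ∃ (Γ Δ : List S.T) (A : S.Id) (v : Args S A) (θ : ∀ ⦃t⦄, Mem Γ t → SV S Δ t) (h : Hat S A Δ)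
      (σ : GSub S Δ) (x : Mem Γ t) (P₁' : Prog S (p.vars ++ Γ)) (P₂' : Prog S Γ),
      Frag bd A v (.matchv (.var (.bv x)) p P₁' P₂') θ h σ ∧ u = σ.app (θ x) ∧
      P₁ = P₁'.bind (liftSub p.vars (fragSub θ σ)) ∧
      P₂ = P₂'.bind (fragSub θ σ) ∧ κ = bd.fragPot A v (.matchv (.var (.bv x)) p P₁' P₂') := by
  generalize hT : Prog.matchv u p P₁ P₂ = T at hg
  cases hg with
  | emit => cases hT
  | env => cases hT
  | start => cases hT
  | frag ha hf =>
    rename_i Γ Δ A v P θ h σ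
    cases P with
    | call => cases hT
    | zero => cases ha
    | env => cases ha
    | emit => cases ha
    | nu => cases ha
    | par => cases ha
    | present => cases hT
    | matchs => cases hT
    | matchv u' p' P₁' P₂' =>
      obtain ⟨L, hw⟩ := hf.within
      obtain ⟨x, rfl⟩ := hw.source.1
      cases hT
      exact ⟨Γ, Δ, A, v, θ, h, σ, x, P₁', P₂', hf, rfl, rfl, rfl, rfl⟩

end Preservation

/-! ### Each reduction rule preserves the invariant and consumes a step. -/

section Reduction

variable {S : Sgn} {X : Sys S} {N : Ann S} {q : Assign X N} {bd : Bounds X N q}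

theorem fragPot_sub {A : S.Id} {v : Args S A} {Γ Γ' : List S.T} {P : Prog S Γ} {P' : Prog S Γ'}
    (h : P'.instCalls ⊆ P.instCalls) (hc : P'.HasCall → P.HasCall)
    (hw : ∀ ρ, P'.weight ρ + tick ρ ≤ P.weight ρ) :
    bd.fragPot A v P' + stepPot S ≤ bd.fragPot A v P := by
  refine ⟨?_, fun ρ => Prog.pot_le_of_subset h (hw ρ)⟩
  simp only [Bounds.fragPot, stepPot, Prod.mk_add_mk]
  split_ifs <;> simp_all

theorem Inv.read (hread : ReadOnce X N) (hq : q.Valid) {ρ : S.D.Reg} {t : S.T} {k : ℕ}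
    {s : PV S.D [] (.sig ρ t)} {e : Exp S (PV S.D []) t} {P : Prog S [t]} {B : S.Id}
    {r : ∀ i : S.Pos B, Exp S (RLeaf S []) ((S.params B).get i)} {κ : Pot S}
    (h : Inv bd (Prog.par (.emit s e) (.present k s P B r)).thr κ)
    (τ : ∀ ⦃u⦄, Mem [t] u → Val S.D u) (hτ : τ .z = e.eval) :
    ∃ κ', Inv bd (Prog.par (.emit s e) (P.inst τ)).thr κ' ∧ κ' + stepPot S ≤ κ ∧
      1 + e.cost ≤ bd.cost := by
  obtain ⟨κ₁, κ₂, h₁, h₂, hκ⟩ := h.split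
  obtain ⟨κ₁', hκ₁, hg₁⟩ := Inv.good h₁
  obtain ⟨κ₂', hκ₂, hg₂⟩ := Inv.good h₂
  obtain ⟨he, hc, -⟩ := Good.emit_inv hg₁
  rw [Assign.qe_erase] at he
  rw [Assign.closedCost_erase] at hc
  obtain ⟨Γ, Δ, A, v, θ, hh, σ, s', P', r', hf, hP, -, rfl⟩ := Good.present_inv hg₂
  have hw : q.qv (e.eval.bind Sub.erase) ≤ bd.read ρ := by
    rw [Assign.qv_erase]
    exact ((q.qv_eval_le hq e).trans he).trans (bd.emit_le_read ρ)
  have hf' := hf.present_read hread _ hw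
  have hthr : (P.inst τ).thr = P'.threads (fragSub (labSym k ρ t θ)
      ⟨σ.bv, LabVal.set σ.lab (.read k ρ t) (e.eval.bind Sub.erase)⟩) := by
    refine thr_inst (Ψ := [t]) P P' hP τ _ (fun _ _ _ => rfl) ?_ ?_
    · intro u y
      cases y with
      | z => exact (LabVal.set_self _ _ _).trans (congrArg (fun w => w.bind Sub.erase) hτ.symm)
      | s y => cases y
    · intro u y
      refine σ.app_congr (θ y) fun y' hy' => LabVal.set_ne _ _ ?_
      rintro rfl
      exact hf.fresh y _ hy' (.inl (.inl (.inl rfl)))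
  -- The emission persists and keeps its potential `κ₁`; the step is paid by the `present`
  -- statement.
  refine ⟨κ₁ + bd.fragPot A v P', ?_, ?_, ?_⟩
  · rw [thr_par, hthr]
    exact h₁.add hf'.inv
  · have h3 := fragPot_sub (bd := bd) (A := A) (v := v) (P := .present k s' P' B r') (P' := P')
      subset_rfl (fun _ => trivial) fun ρ => by rw [Prog.weight, add_comm]
    refine le_trans ?_ hκ
    rw [add_assoc]
    exact add_le_add le_rfl (h3.trans hκ₂)
  · have := e.cost_le hq
    omega

theorem Inv.call (hq : q.IsQuasi) (hann : N.Valid X) (hfin : X.FiniteControl) {A : S.Id}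
    {e : ∀ i : S.Pos A, Exp S (PV S.D []) ((S.params A).get i)} {κ : Pot S}
    (h : Inv bd (Prog.call A e).thr κ) :
    ∃ κ', Inv bd ((X.body A).inst (valSub fun i => (e i).eval)).thr κ' ∧ κ' + stepPot S ≤ κ ∧
      1 + ∑ i, (e i).cost ≤ bd.cost := by
  obtain ⟨κ', hκ, hg⟩ := Inv.good h
  let v' : Args S A := fun i => (e i).eval.bind Sub.erase
  have hv' : ∀ i, q.qv (v' i) ≤
      q.qe (fun _ _ => 0) ((e i).bind fun _ x => (Sub.erase x).toExp) := fun i => by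
    rw [Assign.qv_erase, Assign.qe_erase]
    exact q.qv_eval_le hq.valid _
  have hcost : ∑ i, (e i).cost ≤
      ∑ i, q.closedCost ((e i).bind fun _ x => (Sub.erase x).toExp) := by
    refine Finset.sum_le_sum fun i _ => ?_
    rw [Assign.closedCost_erase]
    exact (e i).cost_le hq.valid
  have key : ∀ l, CycleInv bd A v' l (readSet X N A) →
      Inv bd ((X.body A).inst (valSub fun i => (e i).eval)).thr (bd.fragPot A v' (X.body A)) := by
    intro l hl
    rw [thr_body_inst _ l]
    exact (hl.frag hq.valid hq.sat hfin).inv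
  rcases Good.call_inv hg with ⟨v, l, hc, he, rfl⟩ | ⟨Γ, Δ, A', v, θ, hh, σ, e', hf, he, rfl⟩
  · have hv : ∀ i, q.qv (v' i) ≤ q.qv (v i) := fun i => by
      have := congrFun he i
      have h1 := hv' i
      rwa [this, Assign.qe_toExp] at h1
    -- The bounds pass to arguments of smaller interpretation, so an inequality suffices here,
    -- without identifying `v'` with `v`.
    have hc' : CycleInv bd A v' l (readSet X N A) :=
      ⟨(hq.valid.monoA A _ _ _ _ (fun i => by
          unfold properIn
          split_ifs
          · exact hv i
          · exact le_rfl) le_rfl).trans hc.reset,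
        fun ρ hρ l' h1 h2 => (hq.valid.monoA A _ _ _ _ hv le_rfl).trans (hc.region ρ hρ l' h1 h2),
        hc.lab_le⟩
    refine ⟨_, key l hc', (fragPot_start A v').trans hκ, ?_⟩
    have h1 := bd.valCost A v fun i => (hc.arg_le_top hq.valid i).trans bd.top_le_val
    have h2 : ∑ i, q.closedCost ((e i).bind fun _ x => (Sub.erase x).toExp) =
        ∑ i, q.closedCost (v i).toExp := Finset.sum_congr rfl fun i _ => by rw [congrFun he i]
    omega
  · have hv : ∀ i, q.qv (v' i) ≤
        q.qe (fun _ _ => 0) ((e' i).bind fun _ x => (fragSub θ σ x).toExp) := fun i => by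
      have h1 := hv' i
      rwa [congrFun he i] at h1
    obtain ⟨l₀, hc⟩ := hf.call_next hq.valid hann v' hv
    refine ⟨_, key l₀ hc, (hf.fragPot_call hq.valid hann v' hv).trans hκ, ?_⟩
    have h1 := hf.cost (fragSub θ σ) fun _ x => hf.qv_fragSub_le x
    have h2 : ∑ i, q.closedCost ((e i).bind fun _ x => (Sub.erase x).toExp) =
        ∑ i, q.closedCost ((e' i).bind fun _ x => (fragSub θ σ x).toExp) :=
      Finset.sum_congr rfl fun i _ => by rw [congrFun he i]
    omega

theorem Inv.env {E : Input S} {κ : Pot S} (h : Inv bd (Prog.env E).thr κ) :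
    ∃ κ', Inv bd (pars (E.map fun m => Prog.emit m.sg m.val.toExp)).thr κ' ∧
      κ' + stepPot S ≤ κ ∧ 1 ≤ bd.cost := by
  obtain ⟨κ', hκ, hg⟩ := Inv.good h
  obtain ⟨h1, h2, rfl⟩ := Good.env_inv hg
  refine ⟨(E.map fun m => emitPot m.reg).sum, ?_, ?_, h2⟩
  · clear hg hκ h
    rw [List.forall_mem_map] at h1
    induction E with
    | nil => exact .zero _
    | cons m E ih =>
      obtain ⟨h3, h4⟩ := h1 m List.mem_cons_self
      have h5 := ih fun m' hm' => h1 m' (List.mem_cons_of_mem _ hm')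
      refine Inv.add (Inv.single ?_) h5
      refine Good.emit _ _ ?_ ?_
      · rw [Assign.qe_erase, Assign.qe_toExp]
        rwa [EmV.bind, Assign.qv_erase] at h3
      · rw [Assign.closedCost_erase]
        rwa [EmV.bind, CTm.toExp_bind, Assign.closedCost_erase] at h4
  · refine le_trans (le_of_eq ?_) hκ
    rw [envPot, add_comm, List.map_map]
    rfl

theorem thr_of_bind_eq {Γ : List S.T} {P : Prog S []} {P' : Prog S Γ} {f : Sub S.D Γ []}
    (h : P.bind Sub.erase = P'.bind f) : P.thr = P'.threads f := by
  have h1 : ∀ {Γ : List S.T} (g : Sub S.D Γ []), g.comp (fun _ x => .var x) = g := fun g => by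
    funext t x
    exact CTm.bind_var _
  have h2 := congrArg (fun Q : Prog S [] => Q.threads fun _ x => .var x) h
  simpa only [Prog.threads_bind, h1, Prog.thr] using h2

/-- Erased names do not decide the comparison, so both branches are shown to satisfy the invariant.
-/
theorem Inv.matchs {ρ : S.D.Reg} {t : S.T} {s₁ s₂ : PV S.D [] (.sig ρ t)} {P₁ P₂ : Prog S []}
    {κ : Pot S} (h : Inv bd (Prog.matchs s₁ s₂ P₁ P₂).thr κ) :
    (∃ κ', Inv bd P₁.thr κ' ∧ κ' + stepPot S ≤ κ) ∧
      ∃ κ', Inv bd P₂.thr κ' ∧ κ' + stepPot S ≤ κ := by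
  obtain ⟨κ', hκ, hg⟩ := Inv.good h
  obtain ⟨Γ, Δ, A, v, θ, hh, σ, s₁', s₂', P₁', P₂', hf, h1, h2, rfl⟩ := Good.matchs_inv hg
  refine ⟨⟨bd.fragPot A v P₁', ?_,
      le_trans (fragPot_sub (P := .matchs s₁' s₂' P₁' P₂') Set.subset_union_left
        (fun h => Or.inl h) fun ρ => ?_) hκ⟩,
    ⟨bd.fragPot A v P₂', ?_,
      le_trans (fragPot_sub (P := .matchs s₁' s₂' P₁' P₂') Set.subset_union_right
        (fun h => Or.inr h) fun ρ => ?_) hκ⟩⟩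
  · rw [thr_of_bind_eq h1]
    exact hf.matchs_left.inv
  · rw [Prog.weight]
    omega
  · rw [thr_of_bind_eq h2]
    exact hf.matchs_right.inv
  · rw [Prog.weight]
    omega

theorem Inv.matchv_no {t : S.T} {u : Val S.D t} {p : Pattern S.D t} {P₁ : Prog S (p.vars ++ [])}
    {P₂ : Prog S []} {κ : Pot S} (h : Inv bd (Prog.matchv u p P₁ P₂).thr κ) :
    ∃ κ', Inv bd P₂.thr κ' ∧ κ' + stepPot S ≤ κ := by
  obtain ⟨κ', hκ, hg⟩ := Inv.good h
  obtain ⟨Γ, Δ, A, v, θ, hh, σ, x, P₁', P₂', hf, hu, h1, h2, rfl⟩ := Good.matchv_inv hg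
  refine ⟨bd.fragPot A v P₂', ?_,
    le_trans (fragPot_sub (P := .matchv (.var (.bv x)) p P₁' P₂') Set.subset_union_right
        (fun h => Or.inr h) fun ρ => ?_) hκ⟩
  · rw [thr_of_bind_eq h2]
    exact hf.matchv_right.inv
  · rw [Prog.weight]
    omega

theorem Inv.matchv_yes {t : S.T} {u : Val S.D t} {p : Pattern S.D t} {P₁ : Prog S (p.vars ++ [])}
    {P₂ : Prog S []} {κ : Pot S} (h : Inv bd (Prog.matchv u p P₁ P₂).thr κ)
    (τ : ∀ ⦃u⦄, Mem p.vars u → Val S.D u) (hτ : Matches u p τ)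
    (τ' : ∀ ⦃u⦄, Mem (p.vars ++ []) u → Val S.D u)
    (hτ' : ∀ ⦃u⦄ (y : Mem p.vars u), τ' (y.left []) = τ y) :
    ∃ κ', Inv bd (P₁.inst τ').thr κ' ∧ κ' + stepPot S ≤ κ := by
  obtain ⟨κ', hκ, hg⟩ := Inv.good h
  obtain ⟨Γ, Δ, A, v, θ, hh, σ, x, P₁', P₂', hf, hu, h1, h2, rfl⟩ := Good.matchv_inv hg
  have hu' : p.toCTm.bind (fun _ y => (τ y).bind Sub.erase) = σ.app (θ x) := by
    rw [← hu, ← hτ, CTm.bind_bind]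
  refine ⟨bd.fragPot A v P₁', ?_,
    le_trans (fragPot_sub (P := .matchv (.var (.bv x)) p P₁' P₂') Set.subset_union_left
        (fun h => Or.inl h) fun ρ => ?_) hκ⟩
  · rw [thr_inst P₁ P₁' h1 τ' (fragSub (extSym p.vars θ)
      (σ.ext p.vars fun _ y => (τ y).bind Sub.erase)) (fun _ _ _ => rfl) ?_ ?_]
    · exact (hf.matchv_left _ hu').inv
    · intro u y
      rw [hτ']
      simp only [fragSub, extSym, Mem.split_left]
      exact σ.ext_left _ _ y
    · intro u y
      simp only [fragSub, extSym, Mem.split_right]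
      exact σ.ext_weaken _ _ _
  · rw [Prog.weight]
    omega

theorem Inv.red (hq : q.IsQuasi) (hann : N.Valid X) (hfin : X.FiniteControl) (hread : ReadOnce X N)
    (hcost : 1 ≤ bd.cost) {P Q : Prog S []} {c : ℕ} (hr : Red X.body P c Q) {κ : Pot S}
    (h : Inv bd P.thr κ) : ∃ κ', Inv bd Q.thr κ' ∧ κ' + stepPot S ≤ κ ∧ c ≤ bd.cost := by
  cases hr with
  | read k s e P B r => exact h.read hread hq.valid _ rfl
  | call A e => exact h.call hq hann hfin
  | env E => exact h.env
  | matchs_eq s P₁ P₂ =>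
    obtain ⟨κ', h1, h2⟩ := h.matchs.1
    exact ⟨κ', h1, h2, hcost⟩
  | matchs_ne s₁ s₂ P₁ P₂ =>
    obtain ⟨κ', h1, h2⟩ := h.matchs.2
    exact ⟨κ', h1, h2, hcost⟩
  | matchv_yes v p P₁ P₂ τ hτ =>
    obtain ⟨κ', h1, h2⟩ := h.matchv_yes τ hτ (fun _ x =>
      match x.split p.vars with
      | .inl y => τ y
      | .inr y => nomatch y) fun u y => by simp only [Mem.split_left]
    exact ⟨κ', h1, h2, hcost⟩
  | matchv_no v p P₁ P₂ hno =>
    obtain ⟨κ', h1, h2⟩ := h.matchv_no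
    exact ⟨κ', h1, h2, hcost⟩

theorem Inv.step (hq : q.IsQuasi) (hann : N.Valid X) (hfin : X.FiniteControl)
    (hread : ReadOnce X N) (hcost : 1 ≤ bd.cost) {P Q : Prog S []} {c : ℕ}
    (hs : Step X.body P c Q) {κ : Pot S} (h : Inv bd P.thr κ) :
    ∃ κ', Inv bd Q.thr κ' ∧ κ' + stepPot S ≤ κ ∧ c ≤ bd.cost := by
  obtain ⟨C, P', Q', hP, hr, hQ⟩ := hs
  obtain ⟨M, hM⟩ := C.thr_plug
  rw [hP.thr_eq, hM] at h
  obtain ⟨κ₁, κ₂, h₁, h₂, hκ⟩ := h.split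
  obtain ⟨κ', h3, h4, h5⟩ := h₁.red hq hann hfin hread hcost hr
  refine ⟨κ' + κ₂, ?_, ?_, h5⟩
  · rw [← hQ.thr_eq, hM]
    exact h3.add h₂
  · refine le_trans ?_ hκ
    rw [add_right_comm]
    exact add_le_add h4 le_rfl

/-- Amortized accounting: each step takes time at most `bd.cost` and lowers the component `⊤` by at
least one. -/
theorem Inv.steps (hq : q.IsQuasi) (hann : N.Valid X) (hfin : X.FiniteControl)
    (hread : ReadOnce X N) (hcost : 1 ≤ bd.cost) {P Q : Prog S []} {c : ℕ}
    (hs : Steps X.body P c Q) {κ : Pot S} (h : Inv bd P.thr κ) :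
    ∃ κ' ≤ κ, Inv bd Q.thr κ' ∧ c + bd.cost * κ'.2 ⊤ ≤ bd.cost * κ.2 ⊤ := by
  induction hs with
  | refl => exact ⟨κ, le_rfl, h, by omega⟩
  | tail _ hs ih =>
    obtain ⟨κ₁, hκ, h₁, hc⟩ := ih
    obtain ⟨κ₂, h₂, hκ₂, hc₂⟩ := h₁.step hq hann hfin hread hcost hs
    refine ⟨κ₂, le_trans (le_trans ?_ hκ₂) hκ, h₂, ?_⟩
    · exact ⟨Nat.le_add_right _ _, fun ρ => Nat.le_add_right _ _⟩
    · have h3 : κ₂.2 ⊤ + 1 ≤ κ₁.2 ⊤ := by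
        have := hκ₂.2 ⊤
        simpa [stepPot, tick] using this
      have h4 := Nat.mul_le_mul_left bd.cost h3
      rw [mul_add, mul_one] at h4
      omega

end Reduction

/-! ## The end of the instant -/

section EndOfInstant

variable {S : Sgn} {X : Sys S} {N : Ann S} {q : Assign X N} {bd : Bounds X N q}

theorem Exp.mem_leafList {V : S.T → Type} {α : Type} {g : ∀ ⦃u⦄, V u → List α} {t : S.T}
    {e : Exp S V t} {u : S.T} {z : V u}
    (hz : (⟨u, z⟩ : Σ u, V u) ∈ e.leaves fun _ w => {⟨_, w⟩}) {a : α} (ha : a ∈ g z) :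
    a ∈ e.leafList g := by
  induction e with
  | var w => cases hz; exact ha
  | con c b ih =>
    obtain ⟨i, hi⟩ := hz
    exact mem_flatten_ofFn.2 ⟨i, ih i hi⟩
  | app f b ih =>
    obtain ⟨i, hi⟩ := hz
    exact mem_flatten_ofFn.2 ⟨i, ih i hi⟩

/-- The number of a leaf, given those of the variables and of the lists that are read. -/
def RLeaf.num {Γ : List S.T} (x : ∀ ⦃t⦄, PV S.D Γ t → ℕ) (w : S.D.Reg → S.T → ℕ) :
    ∀ ⦃t : S.T⦄, RLeaf S Γ t → ℕ
  | _, .var z => x z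
  | _, .deref (ρ := ρ) (t := t) _ _ => w ρ t

theorem Assign.qe_num_bind {Γ : List S.T} (f : Sub S.D Γ []) (w : S.D.Reg → S.T → ℕ) {t : S.T}
    (e : Exp S (RLeaf S Γ) t) :
    q.qe (RLeaf.num (fun _ _ => 0) w) (e.bind (RLeaf.bind f)) =
      q.qe (RLeaf.num (fun _ x => q.qv (f x)) w) e := by
  rw [Assign.qe_bind]
  congr 1
  funext t z
  cases z with
  | var x => exact (q.qe_bind _ _ _).trans (q.qe_toExp (f x))
  | deref k s => rfl

theorem eq_deref_of_mem_leafList {Γ : List S.T} {t : S.T} (e : Exp S (RLeaf S Γ) t) {y : Lab S}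
    (hy : y ∈ e.leafList RLeaf.labels) : ∃ k ρ t, y = .deref k ρ t := by
  induction e with
  | var z =>
    cases z with
    | var x => cases hy
    | deref k s => exact ⟨_, _, _, List.mem_singleton.1 hy⟩
  | con c a ih =>
    obtain ⟨i, hi⟩ := mem_flatten_ofFn.1 hy
    exact ih i hi
  | app f a ih =>
    obtain ⟨i, hi⟩ := mem_flatten_ofFn.1 hy
    exact ih i hi

open Classical in
/-- The values of the labels when the lists `w` are read at the labels in `L`. -/
noncomputable def LabVal.deref (l : LabVal S) (L : Set (Lab S))
    (w : S.D.Reg → ∀ t : S.T, Val S.D (.list t)) : LabVal S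
  | .read k ρ t => l (.read k ρ t)
  | .deref k ρ t => if .deref k ρ t ∈ L then w ρ t else l (.deref k ρ t)

theorem LabVal.deref_of_mem (l : LabVal S) {L : Set (Lab S)}
    {w : S.D.Reg → ∀ t : S.T, Val S.D (.list t)} {k : ℕ} {ρ : S.D.Reg} {t : S.T}
    (h : Lab.deref k ρ t ∈ L) : l.deref L w (.deref k ρ t) = w ρ t :=
  if_pos h

theorem LabVal.deref_of_notMem (l : LabVal S) {L : Set (Lab S)}
    {w : S.D.Reg → ∀ t : S.T, Val S.D (.list t)} {y : Lab S} (h : y ∉ L) :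
    l.deref L w y = l y := by
  cases y with
  | read => rfl
  | deref => exact if_neg h

/-- The thread that replaces a `present` statement at the end of the instant. -/
theorem Good.evalCont (hq : q.Valid) (hann : N.Valid X) (hread : ReadOnce X N) {V : SigVal S}
    {w : S.D.Reg → ∀ t : S.T, Val S.D (.list t)}
    (hV : ∀ ⦃ρ t⦄ (s : PV S.D [] (.sig ρ t)), q.qv (listVal (V s)) ≤ q.qv (w ρ t))
    (hw : ∀ ρ t, q.qv (w ρ t) ≤ bd.read ρ) (m : Inp S) {κ : Pot S}
    (hg : Good bd (m.prog.bind Sub.erase) κ) :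
    Good bd ((m.evalCont V).prog.bind Sub.erase) bd.startPot := by
  obtain ⟨Γ, Δ, A, v, θ, h, σ, s, P, r, hf, -, hr, -⟩ := Good.present_inv hg
  obtain ⟨L, hL⟩ := hf.within
  let v' : Args S m.id := fun i => ((m.evalCont V).args i).bind Sub.erase
  have hthr : (m.evalCont V).prog.bind Sub.erase = .call m.id fun i => (v' i).toExp := by
    refine congrArg (Prog.call m.id) (funext fun i => ?_)
    exact (CTm.toExp_bind _ _).symm
  rw [hthr]
  have hlab : ∀ {y}, y ∈ argLabels r → y ∈ (Prog.present m.lab s P m.id r).future X N :=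
    fun hy => .inl (.inr hy)
  -- The evaluated arguments are controlled by any `l` that gives the dereferenced labels their
  -- lists and keeps the labels already read. The labels that `B` may read later remain free, as the
  -- next cycle bound requires.
  have key : ∀ l : LabVal S, (∀ y ∈ argLabels r, l y = LabVal.deref σ.lab (argLabels r) w y) →
      (∀ y ∉ (Prog.present m.lab s P m.id r).future X N, l y = σ.lab y) →
      ∀ i, q.qv (v' i) ≤ q.qσ ⟨σ.bv, l⟩ ((r i).bind fun _ x => .var (symLeaf θ x)) := by
    intro l h1 h2 i
    -- The arguments with true names and those of the fragment agree only up to erasure. Giving each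
    -- leaf a number that depends only on its region and type makes the two comparable.
    have e1 : q.qv (v' i) ≤ q.qe (RLeaf.num (fun _ _ => 0) fun ρ t => q.qv (w ρ t)) (m.args i) := by
      refine (q.qv_erase _).le.trans ((q.qv_eval_le hq _).trans ?_)
      rw [Assign.qe_bind]
      refine q.qe_mono hq _ fun t z => ?_
      cases z with
      | var x => exact le_rfl
      | deref k s => exact (q.qe_toExp _).le.trans (hV s)
    have e2 : q.qe (RLeaf.num (fun _ _ => 0) fun ρ t => q.qv (w ρ t)) (m.args i) =
        q.qe (RLeaf.num (fun _ x => q.qv (fragSub θ σ x)) fun ρ t => q.qv (w ρ t)) (r i) := by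
      rw [← Assign.qe_num_bind, ← congrFun hr i, Assign.qe_num_bind]
      congr 2
      funext t x
      cases x with
      | name => rfl
      | bv x => cases x
    rw [Assign.qσ_bind]
    refine e1.trans (e2.le.trans (le_of_eq ?_))
    refine q.qe_congr_leaves _ fun u z hz => ?_
    cases z with
    | var x =>
      cases x with
      | name => rfl
      | bv x => exact congrArg q.qv (σ.app_congr (θ x) fun y hy => h2 y (hf.fresh x y hy)).symm
    | deref k s =>
      have hy : Lab.deref k _ _ ∈ argLabels r := ⟨i, Exp.mem_leafList hz (List.mem_singleton.2 rfl)⟩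
      exact congrArg q.qv ((h1 _ hy).trans (LabVal.deref_of_mem σ.lab hy)).symm
  have hl : ∀ y ∉ (Prog.present m.lab s P m.id r).future X N,
      LabVal.deref σ.lab (argLabels r) w y = σ.lab y := fun y hy =>
    LabVal.deref_of_notMem _ fun hy' => hy (hlab hy')
  have hb : ∀ y ∈ X.labels, q.qv (LabVal.deref σ.lab (argLabels r) w y) ≤ bd.read y.reg := by
    intro y hy
    by_cases hy' : y ∈ argLabels r
    · obtain ⟨i, hi⟩ := id hy'
      obtain ⟨k, ρ, t, rfl⟩ := eq_deref_of_mem_leafList _ hi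
      exact (congrArg q.qv (LabVal.deref_of_mem σ.lab hy')).le.trans (hw ρ t)
    · exact (congrArg q.qv (LabVal.deref_of_notMem σ.lab hy')).le.trans (hf.cycle.lab_le y hy)
  obtain ⟨l₀, hc⟩ := hf.next hq hann (B := m.id)
    (fun j => (r j).bind fun _ x => .var (symLeaf θ x))
    (fun c hc => hf.sat 1 c (by rw [ineqs]; exact .inr hc))
    (fun c hc => hf.sat 2 c (by rw [ineqs]; exact .inr hc))
    (fun hB => CycReach.single (hL.else_mem_calls hB)) (fun hB y hy => .inr ⟨hB, hy⟩)
    hl hb v' (fun l'' h'' hB => key l''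
      (fun y hy => h'' y (hL.argLabels_not_mem hread hB hy)) fun y hy =>
        (h'' y fun hy' => hy (.inr ⟨hB, hy'⟩)).trans (hl y hy))
    (key _ (fun _ _ => rfl) hl)
  exact .start _ v' l₀ hc

theorem Inv.exists_good {M : Multiset (Prog S [])} {κ : Pot S} (h : Inv bd M κ) {T : Prog S []}
    (hT : T ∈ M) : ∃ κ', Good bd T κ' := by
  obtain ⟨G, h, -⟩ := h
  obtain ⟨κ', -, hg⟩ := Multiset.exists_mem_of_rel_of_mem h hT
  exact ⟨κ', hg⟩

theorem Inv.of_list {α : Type} (l : List α) (g : α → Prog S []) {κ : Pot S}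
    (h : ∀ a ∈ l, Good bd (g a) κ) : Inv bd ↑(l.map g) (l.length • κ) := by
  induction l with
  | nil => exact .zero _
  | cons a l ih =>
    rw [List.map_cons, ← Multiset.cons_coe, ← Multiset.singleton_add, List.length_cons, add_smul,
      one_smul, add_comm (_ • κ)]
    exact (Inv.single (h a List.mem_cons_self)).add (ih fun b hb => h b (List.mem_cons_of_mem _ hb))

/-! ### Counting threads -/

open Classical in
/-- `1` for emissions on the region `ρ`. -/
noncomputable def Prog.emitCount (ρ : S.D.Reg) {Γ : List S.T} : Prog S Γ → ℕ
  | .emit (ρ := ρ') _ _ => if ρ' = ρ then 1 else 0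
  | _ => 0

/-- `1` for `present` statements. -/
def Prog.presentCount {Γ : List S.T} : Prog S Γ → ℕ
  | .present _ _ _ _ _ => 1
  | _ => 0

theorem Good.emitCount_le {T : Prog S []} {κ : Pot S} (h : Good bd T κ) (ρ : S.D.Reg) :
    T.emitCount ρ ≤ κ.2 ρ := by
  cases h with
  | emit s e =>
    simp only [Prog.emitCount, emitPot, WithTop.coe_inj]
    split_ifs <;> simp_all
  | env => exact Nat.zero_le _
  | start => exact Nat.zero_le _
  | frag ha hf =>
    rename_i P _ _ _
    cases P <;> first | (cases ha; done) | exact Nat.zero_le _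

theorem Good.presentCount_le {T : Prog S []} {κ : Pot S} (h : Good bd T κ) :
    T.presentCount ≤ κ.1 := by
  cases h with
  | emit => exact Nat.zero_le _
  | env => exact Nat.zero_le _
  | start => exact Nat.zero_le _
  | frag ha hf =>
    rename_i P _ _ _
    cases P with
    | present => simp [Prog.bind, Prog.presentCount, Bounds.fragPot, Prog.HasCall]
    | call => exact Nat.zero_le _
    | matchs => exact Nat.zero_le _
    | matchv => exact Nat.zero_le _
    | _ => cases ha

/-- The component of a potential at a region. -/
def Pot.at (S : Sgn) (ρ : WithTop S.D.Reg) : Pot S →+ ℕ :=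
  (Pi.evalAddMonoidHom _ ρ).comp (AddMonoidHom.snd _ _)

open Classical in
-- Distinct values come from distinct emissions, so the length of each list is paid by the potential
-- at `ρ`.
theorem Represents.length_le {V : SigVal S} {E : List (Emi S)} (h : Represents V E)
    {ρ : S.D.Reg} {t : S.T} (s : PV S.D [] (.sig ρ t)) :
    (V s).length ≤ (E.map fun m => m.prog.emitCount ρ).sum := by
  have hE : (E.map fun m => m.prog.emitCount ρ).sum = (E.filter fun m => m.reg = ρ).length := by
    clear h
    induction E with
    | nil => rfl
    | cons m E ih =>
      rw [List.map_cons, List.sum_cons, ih]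
      by_cases hm : m.reg = ρ
      · simp [Emi.prog, Prog.emitCount, hm, add_comm]
      · simp [Emi.prog, Prog.emitCount, hm]
  obtain ⟨hn, hm⟩ := h s
  have h1 : ∀ v : {v // v ∈ V s}, ∃ e : Exp S (PV S.D []) t, ⟨s, e⟩ ∈ E ∧ e.eval = v :=
    fun v => (hm v.1).1 v.2
  choose e he hv using h1
  have h2 : ((V s).attach.map fun v => (⟨s, e v⟩ : Emi S)).Nodup := by
    refine (List.nodup_attach.2 hn).map fun a b hab => ?_
    have : e a = e b := by injection hab
    exact Subtype.ext ((hv a).symm.trans ((congrArg Exp.eval this).trans (hv b)))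
  have h3 := (h2.subperm (l₂ := E.filter fun m => m.reg = ρ) fun m hm => by
    obtain ⟨v, -, rfl⟩ := List.mem_map.1 hm
    exact List.mem_filter.2 ⟨he v, by simp⟩).length_le
  rwa [List.length_map, List.length_attach, ← hE] at h3

/-- After erasure it is no longer known which signal a label reads, so one list per region and type
has to dominate all of them. It must be an actual value, because ground substitutions range over
values; the maximum is attained since the interpretations are bounded natural numbers. -/
theorem exists_max_list (V : SigVal S) (b : S.D.Reg → ℕ)
    (h : ∀ ⦃ρ t⦄ (s : PV S.D [] (.sig ρ t)), q.qv (listVal (V s)) ≤ b ρ) :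
    ∃ w : S.D.Reg → ∀ t : S.T, Val S.D (.list t),
      (∀ ⦃ρ t⦄ (s : PV S.D [] (.sig ρ t)), q.qv (listVal (V s)) ≤ q.qv (w ρ t)) ∧
      ∀ ρ t, q.qv (w ρ t) ≤ b ρ := by
  have h1 : ∀ (ρ : S.D.Reg) (t : S.T), ∃ s : PV S.D [] (.sig ρ t),
      ∀ s' : PV S.D [] (.sig ρ t), q.qv (listVal (V s')) ≤ q.qv (listVal (V s)) := by
    intro ρ t
    let R : Set ℕ := Set.range fun s : PV S.D [] (.sig ρ t) => q.qv (listVal (V s))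
    have hb : BddAbove R := ⟨b ρ, by rintro _ ⟨s, rfl⟩; exact h s⟩
    obtain ⟨s, hs⟩ := Nat.sSup_mem (s := R) ⟨_, ⟨.name ρ t 0, rfl⟩⟩ hb
    exact ⟨s, fun s' => (le_csSup hb ⟨s', rfl⟩).trans hs.ge⟩
  choose s hs using h1
  exact ⟨fun ρ t => listVal (V (s ρ t)), fun ρ t => hs ρ t, fun ρ t => h _⟩

/-- The remaining potential at `ρ` bounds the number of emissions on `ρ`, hence the lists read
there. What survives is one call per `present` statement, and each restarts with `startPot` whatever
its history. -/
theorem Inv.endInstant (hq : q.Valid) (hann : N.Valid X) (hread : ReadOnce X N) {U : Polynomial ℕ}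
    (hU : q.BoundedBy U) {P P' : Prog S []} (hP : EndInstant X.body P P') {κ : Pot S}
    (h : Inv bd P.thr κ) (hκ : ∀ ρ : S.D.Reg, κ.2 ρ * (U.eval 0 + bd.emit ρ) ≤ bd.read ρ) :
    Inv bd P'.thr (κ.1 • bd.startPot) := by
  obtain ⟨-, ns, ns', E, I, V, -, hPE, hV, -, -, hP'⟩ := hP
  have hE : (pars (E.map Emi.prog)).thr = ↑(E.map fun m => m.prog.bind Sub.erase) :=
    thr_pars_map E _ _ fun _ => rfl
  have hI : (pars (I.map Inp.prog)).thr = ↑(I.map fun m => m.prog.bind Sub.erase) :=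
    thr_pars_map I _ _ fun _ => rfl
  rw [hPE.thr_eq, thr_newNames, thr_par, hE, hI] at h
  obtain ⟨κ₁, κ₂, h₁, h₂, hle⟩ := h.split
  have hlist : ∀ ⦃ρ t⦄ (s : PV S.D [] (.sig ρ t)), q.qv (listVal (V s)) ≤ bd.read ρ := by
    intro ρ t s
    refine (q.qv_listVal_le hU (V s) (b := bd.emit ρ) fun v hv => ?_).trans (le_trans ?_ (hκ ρ))
    · obtain ⟨e, he, rfl⟩ := ((hV s).2 v).1 hv
      obtain ⟨κ', hg⟩ := h₁.exists_good (List.mem_map.2 ⟨_, he, rfl⟩)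
      have := (Good.emit_inv hg).1
      rw [Assign.qe_erase] at this
      exact (q.qv_eval_le hq e).trans this
    · refine Nat.mul_le_mul_right _ ((hV.length_le s).trans ?_)
      have h3 := h₁.sum_le (Prog.emitCount ρ) (Pot.at S ρ) (fun a b hab => hab.2 ρ)
        fun T κ' hg => hg.emitCount_le ρ
      rw [Multiset.map_coe, Multiset.sum_coe, List.map_map] at h3
      exact h3.trans ((Nat.le_add_right _ _).trans (hle.2 ρ))
  obtain ⟨w, hw, hw'⟩ := exists_max_list V bd.read hlist
  -- Each `present` statement carries one unit of the first component.
  have hnum : I.length ≤ κ.1 := by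
    have h3 := h₂.sum_le Prog.presentCount (AddMonoidHom.fst _ _) (fun a b hab => hab.1)
      fun T κ' hg => hg.presentCount_le
    rw [Multiset.map_coe, Multiset.sum_coe, List.map_map] at h3
    have h4 : (I.map (Prog.presentCount ∘ fun m => m.prog.bind Sub.erase)).sum = I.length := by
      simp [Function.comp_def, Inp.prog, Prog.bind, Prog.presentCount]
    rw [h4] at h3
    exact h3.trans ((Nat.le_add_left _ _).trans hle.1)
  have hI' : (pars (I.map fun m => (m.evalCont V).prog)).thr =
      ↑(I.map fun m => (m.evalCont V).prog.bind Sub.erase) :=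
    thr_pars_map I _ _ fun _ => rfl
  rw [hP'.thr_eq, thr_newNames, hI']
  refine (Inv.of_list I _ fun m hm => ?_).mono (nsmul_le_nsmul_left ?_ hnum)
  · obtain ⟨κ', hg⟩ := h₂.exists_good (List.mem_map.2 ⟨m, hm, rfl⟩)
    exact Good.evalCont hq hann hread hw hw' m hg
  · exact ⟨Nat.zero_le _, fun _ => Nat.zero_le _⟩

end EndOfInstant

/-! ## Renaming of bound names -/

section Renaming

variable {S : Sgn}

theorem CTm.bind_congr {D : DataSig} {V W : D.T → Type} {α : Type} (G : ∀ ⦃u⦄, V u → Set α)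
    {f g : ∀ ⦃u⦄, V u → CTm D W u} {t : D.T} (e : CTm D V t)
    (h : ∀ ⦃u⦄ (z : V u), G z ⊆ e.leaves G → f z = g z) : e.bind f = e.bind g := by
  induction e with
  | var z => exact h z subset_rfl
  | con c a ih =>
    simp only [CTm.bind]
    congr 1
    funext i
    exact ih i fun u z hz => h z fun y hy => ⟨i, hz hy⟩

theorem Exp.bind_congr {V W : S.T → Type} {α : Type} (G : ∀ ⦃u⦄, V u → Set α)
    {f g : ∀ ⦃u⦄, V u → Exp S W u} {t : S.T} (e : Exp S V t)
    (h : ∀ ⦃u⦄ (z : V u), G z ⊆ e.leaves G → f z = g z) : e.bind f = e.bind g := by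
  induction e with
  | var z => exact h z subset_rfl
  | con c a ih =>
    simp only [Exp.bind]
    congr 1
    funext i
    exact ih i fun u z hz => h z fun y hy => ⟨i, hz hy⟩
  | app c a ih =>
    simp only [Exp.bind]
    congr 1
    funext i
    exact ih i fun u z hz => h z fun y hy => ⟨i, hz hy⟩

/-- The substitutions agree on the names in `F`, and on all variables. -/
def Sub.AgreeOn {D : DataSig} {Γ Δ : List D.T} (F : Set (Name D)) (f g : Sub D Γ Δ) : Prop :=
  ∀ ⦃t : D.T⦄ (x : PV D Γ t), x.names ⊆ F → f x = g x

theorem Sub.AgreeOn.lift {D : DataSig} {Γ Δ : List D.T} {F : Set (Name D)} {f g : Sub D Γ Δ}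
    (h : Sub.AgreeOn F f g) (Ψ : List D.T) : Sub.AgreeOn F (liftSub Ψ f) (liftSub Ψ g) := by
  intro t x hx
  cases x with
  | name ρ t k => exact congrArg (fun v => CTm.bind v _) (h (.name ρ t k) hx)
  | bv x =>
    rcases Mem.left_or_right Ψ x with ⟨y, rfl⟩ | ⟨y, rfl⟩
    · rw [liftSub_left, liftSub_left]
    · rw [liftSub_right, liftSub_right, h (.bv y) (Set.empty_subset _)]

theorem Sub.AgreeOn.mono {D : DataSig} {Γ Δ : List D.T} {F F' : Set (Name D)} {f g : Sub D Γ Δ}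
    (h : Sub.AgreeOn F f g) (hF : F' ⊆ F) : Sub.AgreeOn F' f g :=
  fun _ x hx => h x (hx.trans hF)

theorem Sub.AgreeOn.exp {Γ Δ : List S.T} {F : Set (Name S.D)} {f g : Sub S.D Γ Δ}
    (h : Sub.AgreeOn F f g) {t : S.T} (e : Exp S (PV S.D Γ) t) (hF : e.leaves PV.names ⊆ F) :
    e.bind (fun _ x => (f x).toExp) = e.bind fun _ x => (g x).toExp :=
  e.bind_congr PV.names fun _ z hz => by rw [h z (hz.trans hF)]

theorem Sub.AgreeOn.rexp {Γ Δ : List S.T} {F : Set (Name S.D)} {f g : Sub S.D Γ Δ}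
    (h : Sub.AgreeOn F f g) {t : S.T} (e : Exp S (RLeaf S Γ) t) (hF : e.leaves RLeaf.names ⊆ F) :
    e.bind (RLeaf.bind f) = e.bind (RLeaf.bind g) :=
  e.bind_congr RLeaf.names fun _ z hz => by
    cases z with
    | var x => simp only [RLeaf.bind, h x (hz.trans hF)]
    | deref k s => simp only [RLeaf.bind, h s (hz.trans hF)]

theorem Prog.bind_congr {Γ : List S.T} (P : Prog S Γ) : ∀ {Δ : List S.T} {f g : Sub S.D Γ Δ},
    Sub.AgreeOn P.fn f g → P.bind f = P.bind g := by
  induction P with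
  | zero => exact fun _ => rfl
  | call A e =>
    intro Δ f g h
    simp only [Prog.bind]
    congr 1
    funext i
    exact h.exp (e i) fun n hn => ⟨i, hn⟩
  | env E =>
    intro Δ f g h
    simp only [Prog.bind]
    congr 1
    refine List.map_congr_left fun m hm => ?_
    simp only [EmV.bind, h m.sg fun n hn => ⟨m, hm, .inl hn⟩]
    congr 1
    exact m.val.bind_congr PV.names fun u z hz => h z fun n hn => ⟨m, hm, .inr (hz hn)⟩
  | emit s e =>
    intro Δ f g h
    simp only [Prog.bind, h s fun n hn => .inl hn, h.exp e fun n hn => .inr hn]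
  | @present _ ρ t k s P B r ih =>
    intro Δ f g h
    have h1 : (fun i => (r i).bind (RLeaf.bind f)) = fun i => (r i).bind (RLeaf.bind g) :=
      funext fun i => h.rexp (r i) fun n hn => .inr ⟨i, hn⟩
    simp only [Prog.bind, h s fun n hn => .inl (.inl hn), h1,
      ih (Sub.AgreeOn.lift (h.mono fun n hn => .inl (.inr hn)) [t])]
  | matchs s₁ s₂ P₁ P₂ ih₁ ih₂ =>
    intro Δ f g h
    simp only [Prog.bind, h s₁ fun n hn => .inl (.inl (.inl hn)),
      h s₂ fun n hn => .inl (.inl (.inr hn)), ih₁ (h.mono fun n hn => .inl (.inr hn)),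
      ih₂ (h.mono fun n hn => .inr hn)]
  | matchv u p P₁ P₂ ih₁ ih₂ =>
    intro Δ f g h
    have h1 : u.bind f = u.bind g :=
      u.bind_congr PV.names fun _ z hz => h z fun n hn => .inl (.inl (hz hn))
    simp only [Prog.bind, h1, ih₁ ((h.mono fun n hn => .inl (.inr hn)).lift _),
      ih₂ (h.mono fun n hn => .inr hn)]
  | nu ρ t P ih =>
    intro Δ f g h
    exact congrArg (Prog.nu ρ t) (ih (Sub.AgreeOn.lift h [.sig ρ t]))
  | par P₁ P₂ ih₁ ih₂ =>
    intro Δ f g h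
    simp only [Prog.bind, ih₁ (h.mono fun n hn => .inl hn), ih₂ (h.mono fun n hn => .inr hn)]

/-- The indices of the names in `F` are bounded. -/
def BddIdx {D : DataSig} (F : Set (Name D)) : Prop := ∃ K, ∀ n ∈ F, n.idx < K

theorem BddIdx.union {D : DataSig} {F F' : Set (Name D)} (h : BddIdx F) (h' : BddIdx F') :
    BddIdx (F ∪ F') := by
  obtain ⟨K, h⟩ := h
  obtain ⟨K', h'⟩ := h'
  refine ⟨max K K', fun n hn => ?_⟩
  rcases hn with hn | hn
  · exact lt_max_of_lt_left (h n hn)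
  · exact lt_max_of_lt_right (h' n hn)

theorem BddIdx.iUnion {D : DataSig} {k : ℕ} {F : Fin k → Set (Name D)} (h : ∀ i, BddIdx (F i)) :
    BddIdx {n | ∃ i, n ∈ F i} := by
  choose K hK using h
  refine ⟨∑ i, K i, fun n ⟨i, hn⟩ => (hK i n hn).trans_le ?_⟩
  exact Finset.single_le_sum (f := K) (fun _ _ => Nat.zero_le _) (Finset.mem_univ i)

theorem PV.bddIdx {D : DataSig} {Γ : List D.T} {t : D.T} (x : PV D Γ t) : BddIdx x.names := by
  cases x with
  | name ρ t k => exact ⟨k + 1, fun n hn => by cases hn; exact Nat.lt_succ_self k⟩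
  | bv x => exact ⟨0, fun n hn => hn.elim⟩

theorem CTm.bddIdx {D : DataSig} {Γ : List D.T} {t : D.T} (v : CTm D (PV D Γ) t) :
    BddIdx v.fn := by
  induction v with
  | var x => exact x.bddIdx
  | con c a ih => exact .iUnion ih

theorem Exp.bddIdx {V : S.T → Type} {G : ∀ ⦃u⦄, V u → Set (Name S.D)}
    (hG : ∀ ⦃u⦄ (x : V u), BddIdx (G x)) {t : S.T} (e : Exp S V t) : BddIdx (e.leaves G) := by
  induction e with
  | var x => exact hG x
  | con c a ih => exact .iUnion ih
  | app f a ih => exact .iUnion ih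

theorem RLeaf.bddIdx {Γ : List S.T} {t : S.T} (x : RLeaf S Γ t) : BddIdx x.names := by
  cases x with
  | var x => exact x.bddIdx
  | deref k s => exact s.bddIdx

theorem Prog.bddIdx {Γ : List S.T} (P : Prog S Γ) : BddIdx P.fn := by
  induction P with
  | zero => exact ⟨0, fun n hn => hn.elim⟩
  | call A e => exact .iUnion fun i => (e i).bddIdx fun _ x => x.bddIdx
  | env E =>
    refine Exists.imp (fun K hK n hn => ?_) (BddIdx.iUnion (k := E.length)
      (F := fun i => {n | n ∈ (E.get i).sg.names ∨ n ∈ (E.get i).val.fn})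
      fun i => (E.get i).sg.bddIdx.union (E.get i).val.bddIdx)
    obtain ⟨m, hm, hn⟩ := hn
    obtain ⟨i, rfl⟩ := List.get_of_mem hm
    exact hK n ⟨i, hn⟩
  | emit s e => exact s.bddIdx.union (e.bddIdx fun _ x => x.bddIdx)
  | present k s P B r ih =>
    exact (s.bddIdx.union ih).union (.iUnion fun i => (r i).bddIdx fun _ x => x.bddIdx)
  | matchs s₁ s₂ P₁ P₂ ih₁ ih₂ => exact ((s₁.bddIdx.union s₂.bddIdx).union ih₁).union ih₂
  | matchv u p P₁ P₂ ih₁ ih₂ => exact (u.bddIdx.union ih₁).union ih₂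
  | nu ρ t P ih => exact ih
  | par P₁ P₂ ih₁ ih₂ => exact ih₁.union ih₂

open Classical in
/-- The substitution that turns the name `n` into a bound variable. -/
noncomputable def closeName {D : DataSig} (n : Name D) : Sub D [] [.sig n.reg n.ty]
  | _, .name ρ t k =>
    if h : n = ⟨ρ, t, k⟩ then
      .var (.bv (show Mem [Ty.sig n.reg n.ty] (Ty.sig ρ t) by subst h; exact .z))
    else .var (.name ρ t k)

theorem newName_eq (n : Name S.D) (P : Prog S []) :
    newName n P = .nu n.reg n.ty (P.bind (closeName n)) := by
  unfold newName
  congr 2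
  funext t x
  cases x with
  | name => rfl
  | bv x => cases x

theorem closeName_self {D : DataSig} (ρ : D.Reg) (t : D.T) (k : ℕ) :
    closeName ⟨ρ, t, k⟩ (.name ρ t k) = .var (.bv .z) := by
  simp only [closeName, dite_true]

theorem closeName_ne {D : DataSig} {n : Name D} {ρ : D.Reg} {t : D.T} {k : ℕ}
    (h : n ≠ ⟨ρ, t, k⟩) : closeName n (.name ρ t k) = .var (.name ρ t k) := by
  simp only [closeName, h, dite_false]

open Classical in
/-- The substitution that gives the name `n` the new index `k`. -/
noncomputable def renName {D : DataSig} (n : Name D) (k : ℕ) : Sub D [] []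
  | _, .name ρ t j => .var (.name ρ t (if n = ⟨ρ, t, j⟩ then k else j))

/-- Bound names are nameless in the syntax, so a change of bound name is an equality. Freshness of
the new name prevents capture. -/
theorem newName_ren (n : Name S.D) (k : ℕ) (P : Prog S []) (h : ⟨n.reg, n.ty, k⟩ ∉ P.fn) :
    newName ⟨n.reg, n.ty, k⟩ (P.bind (renName n k)) = newName n P := by
  rw [newName_eq, newName_eq, Prog.bind_comp]
  congr 1
  refine P.bind_congr fun t x hx => ?_
  cases x with
  | bv x => cases x
  | name ρ t j =>
    simp only [Sub.comp, renName, CTm.bind]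
    by_cases hn : n = ⟨ρ, t, j⟩
    · subst hn
      simp only [if_true]
      exact (closeName_self ρ t k).trans (closeName_self ρ t j).symm
    · simp only [hn, if_false]
      rw [closeName_ne hn, closeName_ne]
      intro he
      exact h (he ▸ hx rfl)

theorem newName_bind_ren {n m : Name S.D} {k : ℕ} (P : Prog S []) (h : m ≠ n)
    (h' : m ≠ ⟨n.reg, n.ty, k⟩) :
    (newName m P).bind (renName n k) = newName m (P.bind (renName n k)) := by
  rw [newName_eq, newName_eq, Prog.bind, Prog.bind_comp, Prog.bind_comp]
  congr 2
  funext t x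
  cases x with
  | bv x => cases x
  | name ρ t j =>
    simp only [Sub.comp, renName, CTm.bind]
    by_cases hm : m = ⟨ρ, t, j⟩
    · subst hm
      rw [if_neg h.symm, closeName_self]
      rfl
    · rw [closeName_ne hm]
      by_cases hn : n = ⟨ρ, t, j⟩
      · subst hn
        rw [if_pos rfl, closeName_ne h']
        simp only [CTm.bind, liftSub, renName, if_true]
        rfl
      · rw [if_neg hn, closeName_ne hm]
        simp only [CTm.bind, liftSub, renName, hn, if_false]
        rfl

theorem newNames_bind_ren {n : Name S.D} {k : ℕ} (P : Prog S []) :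
    ∀ ns : List (Name S.D), (∀ m ∈ ns, m ≠ n ∧ m ≠ ⟨n.reg, n.ty, k⟩) →
      (newNames ns P).bind (renName n k) = newNames ns (P.bind (renName n k))
  | [], _ => rfl
  | m :: ns, h => by
    have ih := newNames_bind_ren P ns fun m' hm' => h m' (List.mem_cons_of_mem _ hm')
    have hm := h m List.mem_cons_self
    exact (newName_bind_ren _ hm.1 hm.2).trans (congrArg (newName m) ih)

theorem pars_vcall_bind (f : Sub S.D [] []) (l : List (VCall S)) :
    (pars (l.map VCall.prog)).bind f =
      pars ((l.map fun m => (⟨m.id, fun i => (m.args i).bind f⟩ : VCall S)).map VCall.prog) := by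
  induction l with
  | nil => rfl
  | cons m l ih =>
    refine congrArg₂ Prog.par ?_ ih
    simp only [VCall.prog, Prog.bind, CTm.toExp_bind]

/-- The bound names can be chosen with large indices. -/
theorem exists_newNames_eq (l : List (VCall S)) : ∀ (ns : List (Name S.D)) (K : ℕ),
    ∃ (ns' : List (Name S.D)) (l' : List (VCall S)), (∀ n ∈ ns', K ≤ n.idx) ∧
      newNames ns (pars (l.map VCall.prog)) = newNames ns' (pars (l'.map VCall.prog))
  | [], _ => ⟨[], l, by simp, rfl⟩
  | n :: ns, K => by
    -- The inner names receive indices above that of `n`, so that they differ from `n` and the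
    -- renaming of `n` passes under their binders. The new index `k` exceeds those of the inner
    -- names and of the free names.
    obtain ⟨ns', l', h, he⟩ := exists_newNames_eq l ns (max K (n.idx + 1))
    obtain ⟨K₁, h₁⟩ := (newNames ns' (pars (l'.map VCall.prog))).bddIdx
    obtain ⟨K₂, h₂⟩ : BddIdx {n | n ∈ ns'} := by
      refine ⟨(ns'.map fun n => n.idx + 1).sum, fun n hn => ?_⟩
      exact List.single_le_sum (fun _ _ => Nat.zero_le _) _ (List.mem_map.2 ⟨n, hn, rfl⟩)
    let k := max K (max K₁ K₂)
    have hfresh : ⟨n.reg, n.ty, k⟩ ∉ (newNames ns' (pars (l'.map VCall.prog))).fn := fun hn => by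
      have : k < K₁ := h₁ _ hn
      omega
    refine ⟨⟨n.reg, n.ty, k⟩ :: ns', l'.map fun m => ⟨m.id, fun i => (m.args i).bind (renName n k)⟩,
      ?_, ?_⟩
    · intro m hm
      rcases List.mem_cons.1 hm with rfl | hm
      · exact le_max_left _ _
      · exact (le_max_left _ _).trans (h m hm)
    · rw [← pars_vcall_bind]
      refine (congrArg (newName n) he).trans ((newName_ren n k _ hfresh).symm.trans ?_)
      refine congrArg (newName _) (newNames_bind_ren _ ns' fun m hm => ⟨?_, ?_⟩)
      · rintro rfl
        have := h m hm
        omega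
      · rintro rfl
        have : k < K₂ := h₂ _ hm
        omega

theorem newNames_par (Q : Prog S []) (P : Prog S []) : ∀ ns : List (Name S.D),
    (∀ n ∈ ns, n ∉ Q.fn) → Equ (.par (newNames ns P) Q) (newNames ns (.par P Q))
  | [], _ => .refl _
  | n :: ns, h => (Equ.new_par n _ Q (h n List.mem_cons_self)).trans
      (.cong_new n (newNames_par Q P ns fun m hm => h m (List.mem_cons_of_mem _ hm)))

theorem Equ.newNames {P Q : Prog S []} (h : Equ P Q) :
    ∀ ns : List (Name S.D), Equ (newNames ns P) (newNames ns Q)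
  | [] => h
  | n :: ns => .cong_new n (Equ.newNames h ns)

theorem pars_append_singleton (Q : Prog S []) :
    ∀ l : List (Prog S []), Equ (.par (pars l) Q) (pars (l ++ [Q]))
  | [] => (Equ.par_comm _ _).trans (.refl _)
  | P :: l => (Equ.par_assoc _ _ _).trans ((Equ.par_comm _ _).trans
      ((Equ.cong_par P (pars_append_singleton Q l)).trans (.par_comm _ _)))

theorem HasSize.of_init {P R : Prog S []} {m : ℕ} (h : HasInitSize P m) (hR : Equ P R) :
    HasSize R m := by
  obtain ⟨ns, l, hP, hm⟩ := h
  exact ⟨ns, l, [], by simpa using hR.symm.trans hP, by simpa using hm⟩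

/-- The call of the input has to be moved under the restrictions, which requires bound names that
are not free in it; they are chosen with indices above those of the names in `E`. -/
theorem EndInstant.hasSize {body : ∀ A : S.Id, Prog S (S.params A)} {P P' R : Prog S []}
    (h : EndInstant body P P') {E : Input S} (hR : Equ R (.par P' (.env E))) :
    ∃ m, HasSize R m := by
  obtain ⟨-, -, ns, -, I, V, -, -, -, -, -, hP'⟩ := h
  obtain ⟨K, hK⟩ := (Prog.env E : Prog S []).bddIdx
  obtain ⟨ns', l, hns, he⟩ := exists_newNames_eq (I.map (Inp.evalCont V)) ns K
  rw [List.map_map] at he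
  have h1 : Equ P' (newNames ns' (pars (l.map VCall.prog))) := he ▸ hP'
  refine ⟨_, ns', l, [E], ?_, rfl⟩
  refine hR.trans ((h1.cong_par _).trans ((newNames_par _ _ ns' fun n hn hn' => ?_).trans ?_))
  · have := hK n hn'
    have := hns n hn
    omega
  · exact (pars_append_singleton _ _).newNames ns'

end Renaming

/-! ## The size of a state -/

section Size

variable {S : Sgn} {X : Sys S} {N : Ann S} {q : Assign X N} {bd : Bounds X N q}

variable (q) in
/-- A bound of the contribution of a thread to the size of a program. -/
noncomputable def Assign.threadSize : Prog S [] → ℕ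
  | .call _ e => 1 + ∑ i, q.closedCost (e i)
  | .env _ => 1
  | _ => 0

theorem CTm.size_le_closedCost {t : S.T} (v : Val S.D t) : v.size ≤ q.closedCost v.toExp := by
  induction v with
  | var x => exact Nat.zero_le _
  | con c a ih =>
    simp only [CTm.size, CTm.toExp, Assign.closedCost, Assign.costBound]
    split_ifs
    · exact Nat.zero_le _
    · exact Nat.add_le_add_left (Finset.sum_le_sum fun i _ => ih i) 1

theorem Good.threadSize_le (hq : q.Valid) {T : Prog S []} {κ : Pot S} (h : Good bd T κ) :
    q.threadSize T ≤ bd.cost * κ.1 + κ.2 ⊤ := by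
  cases h with
  | emit => exact Nat.zero_le _
  | env E =>
    simp only [Assign.threadSize, envPot, stepPot, tick, Prod.snd_add, Pi.add_apply, if_true]
    omega
  | start B v l hc =>
    have := bd.valCost B v fun i => (hc.arg_le_top hq i).trans bd.top_le_val
    exact this.trans (Nat.le_add_right_of_le (by simp [Bounds.startPot]))
  | frag ha hf =>
    rename_i P _ _ _
    cases P with
    | call B e =>
      have := hf.cost _ fun _ x => hf.qv_fragSub_le x
      exact this.trans (Nat.le_add_right_of_le (by simp [Bounds.fragPot, Prog.HasCall]))
    | present => exact Nat.zero_le _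
    | matchs => exact Nat.zero_le _
    | matchv => exact Nat.zero_le _
    | _ => cases ha

/-- All presentations of `R` have the same threads, so the bound holds for the size read off any of
them. A call counts through the first component, an input through the component `⊤`. -/
theorem HasSize.le (hq : q.Valid) {R : Prog S []} {m : ℕ} (h : HasSize R m) {κ : Pot S}
    (hR : Inv bd R.thr κ) : m ≤ bd.cost * κ.1 + κ.2 ⊤ := by
  obtain ⟨ns, l, l', hE, rfl⟩ := h
  have h1 := hR.sum_le q.threadSize
    ((AddMonoidHom.mulLeft bd.cost).comp (AddMonoidHom.fst _ _) + Pot.at S ⊤)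
    (fun a b hab => add_le_add (Nat.mul_le_mul_left _ hab.1) (hab.2 ⊤)) fun T κ hg =>
      hg.threadSize_le hq
  refine le_trans ?_ h1
  rw [hE.thr_eq, thr_newNames, thr_pars, List.map_append, List.sum_append, Multiset.map_add,
    Multiset.sum_add]
  refine add_le_add ?_ ?_
  · clear hE
    induction l with
    | nil => exact le_rfl
    | cons a l ih =>
      simp only [List.map_cons, List.sum_cons, Multiset.map_add, Multiset.sum_add]
      refine add_le_add ?_ ih
      have h2 : a.prog.thr = {a.prog.bind Sub.erase} := rfl
      rw [h2, Multiset.map_singleton, Multiset.sum_singleton]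
      simp only [VCall.prog, Prog.bind, Assign.threadSize, Assign.closedCost_erase, VCall.size]
      exact Nat.add_le_add_left (Finset.sum_le_sum fun i _ => (a.args i).size_le_closedCost) 1
  · clear hE
    induction l' with
    | nil => exact le_rfl
    | cons a l ih =>
      simp only [List.map_cons, List.sum_cons, Multiset.map_add, Multiset.sum_add, List.length_cons]
      rw [add_comm]
      exact add_le_add le_rfl ih

end Size

/-! ## Polynomial bounds -/

section Polynomials

open Polynomial

variable {S : Sgn} {X : Sys S} {N : Ann S} {q : Assign X N}

theorem Prog.CostLt.mono {V c c' : ℕ} (hc : c ≤ c') {Γ : List S.T} {P : Prog S Γ}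
    (h : P.CostLt q V c) : P.CostLt q V c' := by
  induction P with
  | zero => trivial
  | call A e => exact fun f hf => (h f hf).trans hc
  | env E => trivial
  | emit s e => exact fun f hf => (h f hf).trans hc
  | present k s P B r ih => exact ih h
  | matchs s₁ s₂ P₁ P₂ ih₁ ih₂ => exact ⟨ih₁ h.1, ih₂ h.2⟩
  | matchv u p P₁ P₂ ih₁ ih₂ => exact ⟨ih₁ h.1, ih₂ h.2⟩
  | nu ρ t P ih => exact ih h
  | par P₁ P₂ ih₁ ih₂ => exact ⟨ih₁ h.1, ih₂ h.2⟩

theorem Assign.exists_closedCost_bind_le (hq : q.Valid) {U : ℕ[X]} (hU : q.BoundedBy U)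
    {Γ : List S.T} {t : S.T} (e : Exp S (PV S.D Γ) t) :
    ∃ p : ℕ[X], ∀ (V : ℕ) (f : Sub S.D Γ []), (∀ ⦃t⦄ (x : PV S.D Γ t), q.qv (f x) ≤ V) →
      q.closedCost (e.bind fun _ x => (f x).toExp) ≤ p.eval V := by
  obtain ⟨p, hp⟩ := q.exists_poly hq hU e
  -- This argument of `p` bounds both the interpretation of a substituted value, by `V`, and its
  -- cost, by `1 + (U(1) + 1) * V`.
  refine ⟨p.comp (1 + C (U.eval 1 + 2) * .X), fun V f hf => ?_⟩
  rw [Assign.closedCost, Assign.costBound_bind]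
  simp only [eval_comp, eval_add, eval_mul, eval_C, eval_X, eval_one]
  refine (hp _ _ _ (fun t z => ?_) fun t z => ?_).2
  · rw [Assign.qe_toExp]
    have := hf z
    nlinarith
  · have h1 := q.closedCost_toExp_le hq hU (f z)
    have h2 := Nat.mul_le_mul_left (U.eval 1 + 1) (hf z)
    refine h1.trans ?_
    nlinarith

theorem Prog.exists_costLt (hq : q.Valid) {U : ℕ[X]} (hU : q.BoundedBy U) {Γ : List S.T}
    (P : Prog S Γ) : ∃ p : ℕ[X], ∀ V, P.CostLt q V (p.eval V) := by
  induction P with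
  | zero => exact ⟨0, fun _ => trivial⟩
  | call A e =>
    choose p hp using fun i => q.exists_closedCost_bind_le hq hU (e i)
    refine ⟨1 + ∑ i, p i, fun V f hf => ?_⟩
    rw [eval_add, eval_one, eval_finsetSum]
    exact Nat.add_le_add_left (Finset.sum_le_sum fun i _ => hp i V f hf) 1
  | env E => exact ⟨0, fun _ => trivial⟩
  | emit s e =>
    obtain ⟨p, hp⟩ := q.exists_closedCost_bind_le hq hU e
    refine ⟨1 + p, fun V f hf => ?_⟩
    rw [eval_add, eval_one]
    exact Nat.add_le_add_left (hp V f hf) 1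
  | present k s P B r ih => exact ih
  | nu ρ t P ih => exact ih
  | matchs s₁ s₂ P₁ P₂ ih₁ ih₂ =>
    obtain ⟨p₁, h₁⟩ := ih₁
    obtain ⟨p₂, h₂⟩ := ih₂
    exact ⟨p₁ + p₂, fun V => ⟨(h₁ V).mono (by simp), (h₂ V).mono (by simp)⟩⟩
  | matchv u p P₁ P₂ ih₁ ih₂ =>
    obtain ⟨p₁, h₁⟩ := ih₁
    obtain ⟨p₂, h₂⟩ := ih₂
    exact ⟨p₁ + p₂, fun V => ⟨(h₁ V).mono (by simp), (h₂ V).mono (by simp)⟩⟩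
  | par P₁ P₂ ih₁ ih₂ =>
    obtain ⟨p₁, h₁⟩ := ih₁
    obtain ⟨p₂, h₂⟩ := ih₂
    exact ⟨p₁ + p₂, fun V => ⟨(h₁ V).mono (by simp), (h₂ V).mono (by simp)⟩⟩

theorem exists_body_costLt (hq : q.Valid) {U : ℕ[X]} (hU : q.BoundedBy U) :
    ∃ p : ℕ[X], ∀ V A, (X.body A).CostLt q V (p.eval V) := by
  choose p hp using fun A => (X.body A).exists_costLt hq hU
  refine ⟨∑ A, p A, fun V A => (hp A V).mono ?_⟩
  rw [eval_finsetSum]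
  exact Finset.single_le_sum (f := fun A => (p A).eval V) (fun _ _ => Nat.zero_le _)
    (Finset.mem_univ A)

theorem Val.nonempty (S : Sgn) : ∀ t : S.T, Nonempty (Val S.D t)
  | .unit => ⟨.con .star fun i => nomatch i⟩
  | .list t => ⟨.con (.nil t) fun i => nomatch i⟩
  | .ind i => S.inhabited i
  | .sig ρ t => ⟨.var (.name ρ t 0)⟩

variable (q) in
theorem exists_labVal : ∃ (l : LabVal S) (δ : ℕ), ∀ y ∈ X.labels, q.qv (l y) ≤ δ := by
  let l : LabVal S := fun y => (Val.nonempty S y.ty).some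
  exact ⟨l, (X.labels.map fun y => q.qv (l y)).sum, fun y hy =>
    List.single_le_sum (fun _ _ => Nat.zero_le _) _ (List.mem_map.2 ⟨y, hy, rfl⟩)⟩

/-! ### The bounds for the regions -/

/-- A number attached to the rank of a region. -/
noncomputable def regRank {D : DataSig} (ρ : D.Reg) : ℕ := (below (D := D) ρ).ncard

/-- The inclusion of lower sets is strict, since `ρ'` lies below `ρ` and not below itself. Hence
`regRank` is bounded by the number of regions and strictly increases with the height. -/
theorem regRank_lt {D : DataSig} {ρ ρ' : D.Reg} (h : ρ' ∈ below (D := D) ρ) :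
    regRank ρ' < regRank ρ := by
  refine Set.ncard_lt_ncard ⟨fun ρ'' h'' => lt_trans (b := Order.height ρ') h'' h, fun hs => ?_⟩
    (Set.toFinite _)
  exact lt_irrefl (Order.height ρ') (hs h)

theorem regRank_le {D : DataSig} (ρ : D.Reg) : regRank ρ ≤ Nat.card D.Reg :=
  Set.ncard_le_card _

/-- A bound of the values emitted on a region, if `p` bounds the values of smaller rank. -/
noncomputable def emitPoly (U p : ℕ[X]) : ℕ[X] := U.comp p + C (U.eval 0) * .X

/-- The potential of a call, if `p` bounds its arguments. -/
noncomputable def startPoly (n k s : ℕ) (p : ℕ[X]) : ℕ[X] :=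
  C (n + 1) * ((p + 1) ^ k + 1) * C s + C s

/-- Bounds of the values of rank smaller than `r`. -/
noncomputable def levelPoly (U p₀ : ℕ[X]) (n k s : ℕ) : ℕ → ℕ[X]
  | 0 => p₀
  | r + 1 =>
    let p := levelPoly U p₀ n k s r
    -- The summand `p` makes the sequence increasing, and `emitPoly U p` bounds single values. The
    -- product bounds lists: at most `d` threads with their start potential and at most `d`
    -- emissions of the input, each adding the value and the constant of `cons`.
    p + emitPoly U p +
      (.X * startPoly n k s (U.comp p) + .X) * (C (U.eval 0) + emitPoly U p)

theorem levelPoly_mono (U p₀ : ℕ[X]) (n k s d : ℕ) :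
    Monotone fun r => (levelPoly U p₀ n k s r).eval d := by
  refine monotone_nat_of_le_succ fun r => ?_
  simp only [levelPoly, eval_add]
  omega

end Polynomials

/-! ### Choice of the bounds, and the invariant along computations. -/

section Main

open Polynomial

variable {S : Sgn} {X : Sys S} {N : Ann S} {q : Assign X N}

theorem Assign.BoundedBy.qA_le {U : ℕ[X]} (hU : q.BoundedBy U) (hq : q.Valid) {A : S.Id}
    {x : S.Pos A → ℕ} {y : {y // y ∈ readSet X N A} → ℕ} {b : ℕ} (hx : ∀ i, x i ≤ b)
    (hy : ∀ i, y i ≤ b) : q.qA A x y ≤ U.eval b :=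
  (hq.monoA A _ _ _ _ hx hy).trans ((hU b).2.2 A)

theorem auxBelow_le {A : S.Id} {ρ : WithTop S.D.Reg} {l : LabVal S} {b : ℕ}
    (h : ∀ y ∈ X.labels, y.reg ∈ below ρ → q.qv (l y) ≤ b) (y : {y // y ∈ readSet X N A}) :
    q.auxBelow A ρ l y ≤ b := by
  unfold Assign.auxBelow
  split_ifs with hy
  · exact h y.1 (mem_labels_of_mem_readSet y.2) hy
  · exact Nat.zero_le _

/-- Bounds that hold for all computations with programs and inputs of size at most `d`. -/
structure Bounds.Suits (bd : Bounds X N q) (U : ℕ[X]) (d : ℕ) : Prop where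
  reset : U.eval (U.eval 0 * d) ≤ bd.reset
  emit : ∀ ρ, U.eval 0 * d ≤ bd.emit ρ
  read : ∀ ρ : S.D.Reg, (d * bd.startPot.2 ρ + d) * (U.eval 0 + bd.emit ρ) ≤ bd.read ρ
  cost : ∀ {t : S.T} (v : Val S.D t), q.qv v ≤ U.eval 0 * d → 1 + q.closedCost v.toExp ≤ bd.cost
  one_le : 1 ≤ bd.cost

/-- There is no circularity: the bounds for `ρ` use only `levelPoly` at `regRank ρ`, and labels in
`↓ρ` are bounded at that level by `regRank_lt`. The polynomials `pc` and `ps` do not depend on `d`.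
-/
theorem exists_bounds (hq : q.Valid) {U : ℕ[X]} (hU : q.BoundedBy U)
    (hid : ∀ n : ℕ, n ≤ U.eval n) :
    ∃ pc ps : ℕ[X], ∀ d : ℕ, ∃ bd : Bounds X N q, bd.Suits U d ∧ bd.cost = pc.eval d ∧
      bd.startPot.2 ⊤ = ps.eval d := by
  obtain ⟨l, δ, hl⟩ := exists_labVal q
  obtain ⟨pb, hpb⟩ := exists_body_costLt hq hU
  let k := ∑ A, (S.params A).length
  let s := ∑ A, (X.body A).nodes
  -- The first summand bounds `A⁺` on values of size at most `d`; `δ` bounds the default values of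
  -- the labels.
  let p₀ : ℕ[X] := U.comp (C (U.eval 0) * .X) + C δ
  let b : ℕ → ℕ[X] := levelPoly U p₀ S.N k s
  let top : ℕ[X] := b (Nat.card S.D.Reg + 1)
  -- Identifiers that no longer emit take arguments bounded by `U(top)` from the regions, together
  -- with auxiliary values bounded by `top`.
  let argTop : ℕ[X] := U.comp (top + U.comp top)
  let pv : ℕ[X] := argTop + top
  -- The three summands pay for expressions in bodies, for calls with values as arguments, and for
  -- the emissions of the input.
  let pc : ℕ[X] := pb.comp pv + (1 + C k * (1 + C (U.eval 1 + 1) * pv)) +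
    (1 + (1 + C (U.eval 1 + 1) * (C (U.eval 0) * .X)))
  have hk : ∀ A, (S.params A).length ≤ k := fun A =>
    Finset.single_le_sum (f := fun A => (S.params A).length) (fun _ _ => Nat.zero_le _)
      (Finset.mem_univ A)
  refine ⟨pc, startPoly S.N k s argTop + 1, fun d => ?_⟩
  have hmono : ∀ {r r' : ℕ}, r ≤ r' → (b r).eval d ≤ (b r').eval d :=
    fun h => levelPoly_mono U p₀ S.N k s d h
  have hsucc : ∀ r, (b (r + 1)).eval d = (b r).eval d + (emitPoly U (b r)).eval d +
      (d * (startPoly S.N k s (U.comp (b r))).eval d + d) *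
        (U.eval 0 + (emitPoly U (b r)).eval d) := fun r => by
    simp only [b, levelPoly, eval_add, eval_mul, eval_X, eval_C]
  have hp₀ : p₀.eval d = U.eval (U.eval 0 * d) + δ := by
    simp only [p₀, eval_add, eval_comp, eval_mul, eval_C, eval_X]
  have hemit : ∀ r, (emitPoly U (b r)).eval d = U.eval ((b r).eval d) + U.eval 0 * d := fun r => by
    simp only [emitPoly, eval_add, eval_comp, eval_mul, eval_C, eval_X]
  have hargTop : argTop.eval d = U.eval (top.eval d + U.eval (top.eval d)) := by
    simp only [argTop, eval_add, eval_comp]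
  have hb₀ : ∀ r, p₀.eval d ≤ (b r).eval d := fun r => hmono (Nat.zero_le r)
  have hrank : ∀ ρ : S.D.Reg, (b (regRank ρ + 1)).eval d ≤ top.eval d := fun ρ =>
    hmono (Nat.succ_le_succ (regRank_le ρ))
  have hrank' : ∀ ρ : S.D.Reg, (b (regRank ρ)).eval d ≤ top.eval d := fun ρ =>
    (hmono (Nat.le_succ _)).trans (hrank ρ)
  have hpc : pc.eval d = pb.eval (pv.eval d) + (1 + k * (1 + (U.eval 1 + 1) * pv.eval d)) +
      (1 + (1 + (U.eval 1 + 1) * (U.eval 0 * d))) := by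
    simp only [pc, eval_add, eval_mul, eval_comp, eval_C, eval_X, eval_one]
  let arg : WithTop S.D.Reg → ℕ := fun ρ =>
    WithTop.recTopCoe (argTop.eval d) (fun ρ => U.eval ((b (regRank ρ)).eval d)) ρ
  have harg_top : arg ⊤ = argTop.eval d := rfl
  have harg_coe : ∀ ρ : S.D.Reg, arg ρ = U.eval ((b (regRank ρ)).eval d) := fun _ => rfl
  have hcoe_top : ∀ ρ : S.D.Reg, arg ρ ≤ U.eval (top.eval d) := fun ρ => evalMono U (hrank' ρ)
  have htop : top.eval d + U.eval (top.eval d) ≤ arg ⊤ := by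
    rw [harg_top, hargTop]
    exact hid _
  have hpv : pv.eval d = arg ⊤ + top.eval d := by
    simp only [pv, eval_add, harg_top]
  let bd : Bounds X N q :=
    { reset := U.eval (U.eval 0 * d)
      arg := arg
      emit := fun ρ => (emitPoly U (b (regRank ρ))).eval d
      read := fun ρ => (b (regRank ρ + 1)).eval d
      val := pv.eval d
      cost := pc.eval d
      size := s
      arity := k
      base := k + X.labels.length + 1
      arity_le := hk
      base_gt := Nat.lt_succ_self _
      nodes_le := fun A => Finset.single_le_sum (f := fun A => (X.body A).nodes)
        (fun _ _ => Nat.zero_le _) (Finset.mem_univ A)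
      start := by
        intro A ρ x l hx hl
        cases ρ with
        | top =>
          refine (hU.qA_le hq (b := top.eval d) (fun i => (hx i).trans ?_)
            (auxBelow_le fun y hy _ => (hl y hy).trans (hrank _))).trans ?_
          · have : p₀.eval d ≤ top.eval d := hb₀ _
            omega
          · omega
        | coe ρ =>
          refine hU.qA_le hq (fun i => (hx i).trans ?_)
            (auxBelow_le fun y hy hρ => (hl y hy).trans (hmono (regRank_lt hρ)))
          have := hb₀ (regRank ρ)
          omega
      top := by
        intro A ρ x l hx hl
        refine (hU.qA_le hq (fun i => (hx i).trans ((hcoe_top ρ).trans (Nat.le_add_left _ _)))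
          (auxBelow_le fun y hy _ => ((hl y hy).trans (hrank _)).trans
            (Nat.le_add_right _ _))).trans hargTop.ge
      arg_le_top := by
        intro ρ
        cases ρ with
        | top => exact le_rfl
        | coe ρ =>
          have := hcoe_top ρ
          omega
      top_le_val := by omega
      arg_le_emit := by
        intro ρ
        rw [hemit, harg_coe]
        omega
      emit_le_read := by
        intro ρ
        rw [hsucc]
        omega
      read_le_val := by
        intro ρ
        have := hrank ρ
        omega
      default := ⟨l, fun y hy => (hl y hy).trans (by
        have := hb₀ (regRank y.reg + 1)
        omega)⟩
      costLt := fun A => (hpb _ A).mono (by rw [hpc]; omega)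
      valCost := by
        intro A v hv
        have h1 : ∑ i, q.closedCost (v i).toExp ≤
            ∑ _i : S.Pos A, (1 + (U.eval 1 + 1) * pv.eval d) :=
          Finset.sum_le_sum fun i _ => (q.closedCost_toExp_le hq hU (v i)).trans
            (Nat.add_le_add_left (Nat.mul_le_mul_left _ (hv i)) 1)
        rw [Finset.sum_const, Finset.card_univ, Fintype.card_fin, smul_eq_mul] at h1
        have h2 := Nat.mul_le_mul_right (1 + (U.eval 1 + 1) * pv.eval d) (hk A)
        rw [hpc]
        omega }
  have hstart : ∀ ρ : S.D.Reg, bd.startPot.2 ρ =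
      (startPoly S.N k s (U.comp (b (regRank ρ)))).eval d := fun ρ => by
    simp only [Bounds.startPot, tick, WithTop.coe_ne_top, if_false, startPoly, eval_add, eval_mul,
      eval_C, eval_pow, eval_comp, eval_one, add_zero]
    rfl
  refine ⟨bd, ⟨le_rfl, fun ρ => ?_, fun ρ => ?_, fun v hv => ?_, ?_⟩, rfl, ?_⟩
  · exact (Nat.le_add_left _ _).trans (hemit _).ge
  · rw [hstart]
    exact (Nat.le_add_left _ _).trans (hsucc _).ge
  · refine le_trans (Nat.add_le_add_left ((q.closedCost_toExp_le hq hU v).trans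
      (Nat.add_le_add_left (Nat.mul_le_mul_left _ hv) 1)) 1) ?_
    exact (Nat.le_add_left _ _).trans hpc.ge
  · change 1 ≤ pc.eval d
    omega
  · simp only [Bounds.startPot, tick, if_true, startPoly, eval_add, eval_mul,
      eval_C, eval_pow, eval_one]
    rfl

/-! ### Computations -/

/-- The potential of the states of a computation with programs and inputs of size at most `d`. -/
noncomputable def Bounds.instantPot (bd : Bounds X N q) (d : ℕ) : Pot S :=
  -- At most `d` threads start the instant; `tick` pays for the call of the input, and the last `d`
  -- for its emissions.
  (d, fun ρ => d * bd.startPot.2 ρ + (tick ρ + d))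

theorem envPot_le {E : Input S} {d : ℕ} (h : inputSize E ≤ d) :
    envPot E ≤ (0, fun ρ => tick ρ + d) := by
  have h1 : (E.map fun m => emitPot (S := S) m.reg).sum ≤ (0, fun _ => E.length) := by
    clear h
    induction E with
    | nil => exact ⟨le_rfl, fun _ => le_rfl⟩
    | cons m E ih =>
      refine ⟨(add_le_add le_rfl ih.1).trans (by simp [emitPot]), fun ρ => ?_⟩
      have h2 := ih.2 ρ
      simp only [List.map_cons, List.sum_cons, Prod.snd_add, Pi.add_apply, emitPot,
        List.length_cons] at h2 ⊢
      split_ifs <;> omega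
  have h2 : E.length ≤ inputSize E := by
    clear h h1
    induction E with
    | nil => exact le_rfl
    | cons m E ih =>
      simp only [inputSize, List.map_cons, List.sum_cons, List.length_cons] at ih ⊢
      omega
  exact ⟨Nat.add_le_add_left h1.1 0, fun ρ =>
    Nat.add_le_add_left ((h1.2 ρ).trans (h2.trans h)) _⟩

theorem size_le_inputSize {E : Input S} {m : EmV S []} (hm : m ∈ E) :
    m.val.size ≤ inputSize E :=
  (Nat.le_add_left _ 1).trans (List.single_le_sum (fun _ _ => Nat.zero_le _) _
    (List.mem_map.2 ⟨m, hm, rfl⟩))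

theorem Inv.env_of_size {bd : Bounds X N q} {U : ℕ[X]} (hU : q.BoundedBy U) {d : ℕ}
    (hbd : bd.Suits U d) {E : Input S} (hE : inputSize E ≤ d) :
    Inv bd (Prog.env E : Prog S []).thr (0, fun ρ => tick ρ + d) := by
  have h1 : ∀ m ∈ E.map fun m => m.bind Sub.erase, q.qv m.val ≤ U.eval 0 * d := by
    rw [List.forall_mem_map]
    intro m hm
    refine (q.qv_erase _).le.trans ((hU.qv_le m.val).trans ?_)
    exact Nat.mul_le_mul_left _ ((size_le_inputSize hm).trans hE)
  have h2 : envPot (E.map fun m => m.bind Sub.erase) = envPot E := by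
    rw [envPot, List.map_map]
    rfl
  refine (Inv.single (Good.env (bd := bd) (E.map fun m => m.bind Sub.erase) (fun m hm =>
    ⟨(h1 m hm).trans (hbd.emit _), hbd.cost _ (h1 m hm)⟩) hbd.one_le)).mono ?_
  exact h2.le.trans (envPot_le hE)

theorem Inv.of_initSize {bd : Bounds X N q} (hq : q.Valid) {U : ℕ[X]} (hU : q.BoundedBy U)
    (hid : ∀ n : ℕ, n ≤ U.eval n) {d m : ℕ} (hbd : bd.Suits U d) {P : Prog S []}
    (h : HasInitSize P m) (hm : m ≤ d) : Inv bd P.thr (d • bd.startPot) := by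
  obtain ⟨ns, l, hP, rfl⟩ := h
  have h1 : ∀ a ∈ l, a.size ≤ d := fun a ha =>
    (List.single_le_sum (fun _ _ => Nat.zero_le _) _ (List.mem_map.2 ⟨a, ha, rfl⟩)).trans hm
  have h2 : l.length ≤ (l.map VCall.size).sum := by
    clear hm h1 hP
    induction l with
    | nil => exact le_rfl
    | cons a l ih =>
      simp only [List.map_cons, List.sum_cons, List.length_cons, VCall.size] at ih ⊢
      omega
  rw [hP.thr_eq, thr_newNames, thr_pars_map l _ (fun m => m.prog.bind Sub.erase) fun _ => rfl]
  refine (Inv.of_list l _ (κ := bd.startPot) fun a ha => ?_).mono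
    (nsmul_le_nsmul_left ⟨Nat.zero_le _, fun _ => Nat.zero_le _⟩ (h2.trans hm))
  let v : Args S a.id := fun i => (a.args i).bind Sub.erase
  have h3 : a.prog.bind Sub.erase = .call a.id fun i => (v i).toExp :=
    congrArg (Prog.call a.id) (funext fun i => (CTm.toExp_bind _ _).symm)
  have hv : ∀ i, q.qv (v i) ≤ U.eval 0 * d := fun i => by
    refine (q.qv_erase _).le.trans ((hU.qv_le _).trans (Nat.mul_le_mul_left _ ?_))
    refine le_trans ?_ (h1 a ha)
    exact (Finset.single_le_sum (f := fun i => (a.args i).size) (fun _ _ => Nat.zero_le _)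
      (Finset.mem_univ i)).trans (Nat.le_add_left _ _)
  have h4 : q.qA a.id (properIn N a.id fun i => q.qv (v i)) (fun _ => 0) ≤ bd.reset := by
    refine (hU.qA_le hq (fun i => ?_) fun _ => Nat.zero_le _).trans hbd.reset
    unfold properIn
    split_ifs
    · exact hv i
    · exact Nat.zero_le _
  obtain ⟨l₀, hc⟩ := CycleInv.start h4 (fun i => ((hv i).trans (hid _)).trans hbd.reset)
    (readSet X N a.id)
  rw [h3]
  exact .start _ v l₀ hc

/-- The bound does not deteriorate with the number of instants: the first component stays at most
`d`, and at the end of an instant it is all that determines the next potential, apart from the new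
input. -/
theorem Inv.of_reaches {bd : Bounds X N q} (hq : q.IsQuasi) (hann : N.Valid X)
    (hfin : X.FiniteControl) (hread : ReadOnce X N) {U : ℕ[X]} (hU : q.BoundedBy U)
    (hid : ∀ n : ℕ, n ≤ U.eval n) {d m : ℕ} (hbd : bd.Suits U d) {P R : Prog S []}
    {Es : List (Input S)} (hR : Reaches X.body P Es R) (hP : HasInitSize P m) (hm : m ≤ d)
    (hEs : ∀ E ∈ Es, inputSize E ≤ d) : Inv bd R.thr (bd.instantPot d) := by
  have hpot : d • bd.startPot + (0, fun ρ => tick ρ + d) ≤ bd.instantPot d := by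
    refine ⟨?_, fun ρ => ?_⟩
    · simp [Bounds.instantPot, Bounds.startPot]
    · simp [Bounds.instantPot]
  induction hR with
  | start h =>
    rw [← h.thr_eq]
    refine (Inv.of_initSize hq.valid hU hid hbd hP hm).mono (le_trans ?_ hpot)
    exact ⟨Nat.le_add_right _ _, fun _ => Nat.le_add_right _ _⟩
  | next E _ hs he hR ih =>
    obtain ⟨κ, hκ, h1, -⟩ := (ih fun E hE => hEs E (List.mem_cons_of_mem _ hE)).steps hq hann hfin
      hread hbd.one_le hs
    have h2 := h1.endInstant hq.valid hann hread hU he fun ρ =>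
      le_trans (Nat.mul_le_mul_right _ (by
        have := hκ.2 ρ
        simpa [Bounds.instantPot, tick] using this)) (hbd.read ρ)
    rw [hR.thr_eq, thr_par]
    refine (h2.add (Inv.env_of_size hU hbd (hEs E List.mem_cons_self))).mono (le_trans ?_ hpot)
    refine add_le_add (nsmul_le_nsmul_left ⟨Nat.zero_le _, fun _ => Nat.zero_le _⟩ hκ.1) le_rfl

theorem Reaches.hasSize {body : ∀ A : S.Id, Prog S (S.params A)} {P R : Prog S []}
    {Es : List (Input S)} (hR : Reaches body P Es R) {m : ℕ} (hP : HasInitSize P m) :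
    ∃ m, HasSize R m := by
  cases hR with
  | start h => exact ⟨m, HasSize.of_init hP h⟩
  | next E _ _ he hR => exact he.hasSize hR

theorem Assign.PolyBounded.exists_boundedBy (h : q.PolyBounded) :
    ∃ U : ℕ[X], q.BoundedBy U ∧ ∀ n : ℕ, n ≤ U.eval n := by
  obtain ⟨U, hU⟩ := h
  refine ⟨U + .X, fun n => ?_, fun n => by simp⟩
  obtain ⟨h1, h2, h3⟩ := hU n
  simp only [eval_add, eval_X]
  exact ⟨fun c => Nat.le_add_right_of_le (h1 c), fun f => Nat.le_add_right_of_le (h2 f),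
    fun A => Nat.le_add_right_of_le (h3 A)⟩

theorem Assign.IsQuasi.feasiblyReactive (hq : q.IsQuasi) (hfin : X.FiniteControl)
    (hann : N.Valid X) (hread : ReadOnce X N) (P : Prog S []) : FeasiblyReactive X.body P := by
  obtain ⟨U, hU, hid⟩ := hq.poly.exists_boundedBy
  obtain ⟨pc, ps, hb⟩ := exists_bounds hq.valid hU hid
  -- The size is at most `cost * d + κ`, and the time at most `cost * κ`, where `κ` is the component
  -- `⊤` of `instantPot`; the final `1` makes the bound on the time strict.
  refine ⟨pc * .X + (pc + 1) * (.X * ps + (1 + .X)) + 1, fun Es R d hR ⟨m, hP, hm⟩ hEs => ?_⟩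
  obtain ⟨bd, hbd, hc, hs⟩ := hb d
  have hinv := Inv.of_reaches hq hann hfin hread hU hid hbd hR hP hm hEs
  have hpot : (bd.instantPot d).2 ⊤ = d * ps.eval d + (1 + d) := by
    simp [Bounds.instantPot, tick, hs]
  simp only [eval_add, eval_mul, eval_X, eval_one]
  rw [← hpot, ← hc, add_mul, one_mul]
  refine ⟨hR.hasSize hP, fun m' hm' => ?_, fun c R' hst => ?_⟩
  · have h1 : m' ≤ bd.cost * d + (bd.instantPot d).2 ⊤ := hm'.le hq.valid hinv
    omega
  · obtain ⟨κ, -, -, h1⟩ := hinv.steps hq hann hfin hread hbd.one_le hst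
    omega

end Main

end SPi

theorem mainTheorem1 (S : SPi.Sgn) (X : SPi.Sys S) (N : SPi.Ann S)
    (hfin : X.FiniteControl) (hann : N.Valid X) (hread : SPi.ReadOnce X N)
    (hquasi : ∃ q : SPi.Assign X N, q.IsQuasi)
    (P : SPi.Prog S []) (hP : ∃ m, SPi.HasInitSize P m) :
    SPi.FeasiblyReactive X.body P := by
  obtain ⟨q, hq⟩ := hquasi
  exact hq.feasiblyReactive hfin hann hread P
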